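/- Let $X=\prod_{1}^{\infty}\{0,1\}$ with its Borel $\sigma$-algebra, let $\mu=\nu^{\otimes\infty}$ with $\nu(\{0\})=\nu(\{1\})=1/2$, and let $T:X\to X$, $Tx=x+\underline{1}$ (addition of $1$ to the first coordinate with carry to the right) be the dyadic odometer. Let $[T]$ be its full group: the group of all Borel automorphisms $S$ of $X$ with $Sx\in\{T^kx:k\in\mathbb{Z}\}$ for all $x\in X$, where $S_1,S_2$ are identified if their uniform distance $\|S_1-S_2\|=\mu(\{x:S_1x\neq S_2x\})$ is $0$. For $f\in[T]$ let $\mathrm{Fix}(f)=\{x\in X:f(x)=x\}$; its measure is well defined. A character on a group $G$ is a function $\chi:G\to\mathbb{C}$ such that (1) $\chi(g_1g_2)=\chi(g_2g_1)$ for all $g_1,g_2\in G$; (2) for all $n$ and $g_1,\dots,g_n\in G$ the matrix $\left(\chi(g_ig_j^{-1})\right)_{i,j=1}^n$ is positive semidefinite; (3) $\chi(e)=1$. A character is indecomposable if it cannot be written as $a\chi_1+(1-a)\chi_2$ with $0<a<1$ and distinct characters $\chi_1,\chi_2$. (No continuity is required.) Then a function $\chi:[T]\to\mathbb{C}$ is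 an indecomposable character if and only if there exists $\alpha\in\{0,1,2,\dots\}\cup\{\infty\}$ such that $\chi(f)=\mu(\mathrm{Fix}(f))^{\alpha}$ for all $f\in[T]$, where $0^0=1$, $1^\infty=1$ and $x^\infty=0$ for $x\in[0,1)$. -/

import Mathlib

open MeasureTheory

namespace Odometer

/-- The space `X` of infinite `0,1`-sequences (`false` is `0`, `true` is `1`), with the product
topology and its Borel (equivalently, product) σ-algebra. -/
abbrev X : Type := ℕ → Bool

/-- `x ↦ x + 1` with carry to the right: the `n`-th digit changes iff all earlier digits are `1`. -/
def addOne (x : X) : X := fun n => if ∀ m < n, x m = true then !(x n) else x n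

/-- `x ↦ x - 1` with borrow: the `n`-th digit changes iff all earlier digits are `0`. -/
def subOne (x : X) : X := fun n => if ∀ m < n, x m = false then !(x n) else x n

theorem addOne_prefix (x : X) (n : ℕ) :
    (∀ m < n, addOne x m = false) ↔ ∀ m < n, x m = true := by
  induction n with
  | zero => simp
  | succ n ih =>
    constructor
    · intro h
      have h1 := ih.1 fun m hm => h m (by omega)
      have h2 := h n (by omega)
      simp only [addOne, if_pos h1] at h2
      intro m hm
      rcases Nat.lt_succ_iff_lt_or_eq.1 hm with hm | rfl
      · exact h1 m hm
      · simpa using h2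
    · intro h
      have h1 : ∀ m < n, x m = true := fun m hm => h m (by omega)
      intro m hm
      rcases Nat.lt_succ_iff_lt_or_eq.1 hm with hm | rfl
      · exact ih.2 h1 m hm
      · simp [addOne, if_pos h1, h m (by omega)]

theorem subOne_prefix (x : X) (n : ℕ) :
    (∀ m < n, subOne x m = true) ↔ ∀ m < n, x m = false := by
  induction n with
  | zero => simp
  | succ n ih =>
    constructor
    · intro h
      have h1 := ih.1 fun m hm => h m (by omega)
      have h2 := h n (by omega)
      simp only [subOne, if_pos h1] at h2
      intro m hm
      rcases Nat.lt_succ_iff_lt_or_eq.1 hm with hm | rfl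
      · exact h1 m hm
      · simpa using h2
    · intro h
      have h1 : ∀ m < n, x m = false := fun m hm => h m (by omega)
      intro m hm
      rcases Nat.lt_succ_iff_lt_or_eq.1 hm with hm | rfl
      · exact ih.2 h1 m hm
      · simp [subOne, if_pos h1, h m (by omega)]

/-- The dyadic odometer `T : X → X`, `T x = x + 1`. -/
def T : Equiv.Perm X where
  toFun := addOne
  invFun := subOne
  left_inv x := by
    funext n
    change (if ∀ m < n, addOne x m = false then !(addOne x n) else addOne x n) = x n
    by_cases h : ∀ m < n, x m = true
    · rw [if_pos ((addOne_prefix x n).2 h)]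
      simp [addOne, if_pos h]
    · rw [if_neg (mt (addOne_prefix x n).1 h)]
      simp only [addOne, if_neg h]
  right_inv x := by
    funext n
    change (if ∀ m < n, subOne x m = true then !(subOne x n) else subOne x n) = x n
    by_cases h : ∀ m < n, x m = false
    · rw [if_pos ((subOne_prefix x n).2 h)]
      simp [subOne, if_pos h]
    · rw [if_neg (mt (subOne_prefix x n).1 h)]
      simp only [subOne, if_neg h]

/-- The orbit `O_T(x) = {T^k x : k ∈ ℤ}`. -/
def orbit (x : X) : Set X := {y | ∃ k : ℤ, (T ^ k) x = y}

/-- The product measure `μ = ν^{⊗∞}` on `X`, with `ν({0}) = ν({1}) = 1/2`. -/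
noncomputable def μ : Measure X :=
  Measure.infinitePi fun _ : ℕ => (PMF.uniformOfFintype Bool).toMeasure

instance : IsProbabilityMeasure μ := by unfold μ; infer_instance

/-- The group of all Borel automorphisms `S` of `X` with `S x ∈ O_T(x)` for every `x`
(before identifying automorphisms that agree `μ`-almost everywhere). -/
def borelFullGroup : Subgroup (Equiv.Perm X) where
  carrier := {S | Measurable S ∧ Measurable S.symm ∧ ∀ x, S x ∈ orbit x}
  mul_mem' := by
    rintro a b ⟨ha, ha', hao⟩ ⟨hb, hb', hbo⟩
    refine ⟨ha.comp hb, hb'.comp ha', fun x => ?_⟩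
    obtain ⟨k, hk⟩ := hbo x
    obtain ⟨l, hl⟩ := hao (b x)
    refine ⟨l + k, ?_⟩
    rw [zpow_add, Equiv.Perm.mul_apply, hk, hl, Equiv.Perm.mul_apply]
  one_mem' := ⟨measurable_id, measurable_id, fun _ => ⟨0, rfl⟩⟩
  inv_mem' := by
    rintro a ⟨ha, ha', hao⟩
    refine ⟨ha', ha, fun x => ?_⟩
    obtain ⟨k, hk⟩ := hao (a⁻¹ x)
    have hk' : (T ^ k) (a⁻¹ x) = x := hk.trans (a.apply_symm_apply x)
    refine ⟨-k, ?_⟩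
    rw [zpow_neg, Equiv.Perm.inv_eq_iff_eq]
    exact hk'.symm

/-- The uniform distance `‖S₁ - S₂‖ = μ({x : S₁ x ≠ S₂ x})`. -/
noncomputable def uniformDist (S₁ S₂ : Equiv.Perm X) : ℝ := μ.real {x | S₁ x ≠ S₂ x}

theorem uniformDist_eq_zero {S₁ S₂ : Equiv.Perm X} :
    uniformDist S₁ S₂ = 0 ↔ μ {x | S₁ x ≠ S₂ x} = 0 := by
  simp [uniformDist, measureReal_eq_zero_iff]

/-! ### `T` preserves `μ` (needed for the quotient group below to make sense) -/

def cyl (n : ℕ) (a : X) : Set X := {x | ∀ i < n, x i = a i}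

theorem μ_cyl (n : ℕ) (a : X) : μ (cyl n a) = (2⁻¹ : ENNReal) ^ n := by
  have h : cyl n a = Set.pi (Finset.range n : Finset ℕ) fun i => {a i} := by
    ext x; simp [cyl]
  rw [h, μ, Measure.infinitePi_pi _ fun i _ => measurableSet_singleton _]
  simp

theorem addOne_congr {n : ℕ} {x y : X} (h : ∀ i < n, x i = y i) :
    ∀ i < n, addOne x i = addOne y i := by
  intro i hi
  have : (∀ m < i, x m = true) ↔ ∀ m < i, y m = true :=
    forall₂_congr fun m hm => by rw [h m (by omega)]
  simp only [addOne, this, h i hi]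

theorem subOne_congr {n : ℕ} {x y : X} (h : ∀ i < n, x i = y i) :
    ∀ i < n, subOne x i = subOne y i := by
  intro i hi
  have : (∀ m < i, x m = false) ↔ ∀ m < i, y m = false :=
    forall₂_congr fun m hm => by rw [h m (by omega)]
  simp only [subOne, this, h i hi]

theorem T_preimage_cyl (n : ℕ) (a : X) : T ⁻¹' cyl n a = cyl n (T.symm a) := by
  ext x
  constructor
  · intro h i hi
    have h1 := subOne_congr (show ∀ i < n, T x i = a i from h) i hi
    rwa [show subOne (T x) = x from T.symm_apply_apply x] at h1
  · intro h i hi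
    have h1 := addOne_congr (show ∀ i < n, x i = T.symm a i from h) i hi
    rwa [show addOne (T.symm a) = a from T.apply_symm_apply a] at h1

theorem generateFrom_cyl :
    (MeasurableSpace.pi : MeasurableSpace X) =
      MeasurableSpace.generateFrom {s | ∃ n a, s = cyl n a} := by
  apply le_antisymm
  · refine iSup_le fun i => ?_
    rintro _ ⟨t, -, rfl⟩
    let e : (Fin (i + 1) → Bool) → X := fun b m => if h : m < i + 1 then b ⟨m, h⟩ else false
    have h : (fun x : X => x i) ⁻¹' t =
        ⋃ b : {b : Fin (i + 1) → Bool // b (Fin.last i) ∈ t}, cyl (i + 1) (e b) := by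
      ext x
      simp only [Set.mem_preimage, Set.mem_iUnion]
      constructor
      · intro hx
        refine ⟨⟨fun j => x j, by simpa using hx⟩, fun m hm => ?_⟩
        simp only [e, dif_pos hm]
      · rintro ⟨⟨b, hb⟩, hx⟩
        rw [hx i (by omega)]
        simp only [e, dif_pos (Nat.lt_succ_self i)]
        exact hb
    rw [h]
    exact MeasurableSet.iUnion fun b => MeasurableSpace.measurableSet_generateFrom ⟨_, _, rfl⟩
  · refine MeasurableSpace.generateFrom_le ?_
    rintro _ ⟨n, a, rfl⟩
    have h : cyl n a = Set.pi (Finset.range n : Finset ℕ) fun i => {a i} := by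
      ext x; simp [cyl]
    rw [h]
    exact MeasurableSet.pi (Finset.countable_toSet _) fun i _ => measurableSet_singleton _

theorem isPiSystem_cyl : IsPiSystem {s : Set X | ∃ n a, s = cyl n a} := by
  rintro _ ⟨n, a, rfl⟩ _ ⟨m, b, rfl⟩ ⟨c, hc, hc'⟩
  refine ⟨max n m, c, ?_⟩
  ext x
  constructor
  · rintro ⟨h, h'⟩ i hi
    rcases lt_max_iff.1 hi with hi | hi
    · rw [h i hi, hc i hi]
    · rw [h' i hi, hc' i hi]
  · intro h
    exact ⟨fun i hi => by rw [h i (lt_max_of_lt_left hi), hc i hi],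
      fun i hi => by rw [h i (lt_max_of_lt_right hi), hc' i hi]⟩

theorem measurable_T : Measurable T := by
  have : @Measurable X X MeasurableSpace.pi
      (MeasurableSpace.generateFrom {s | ∃ n a, s = cyl n a}) T := by
    refine measurable_generateFrom ?_
    rintro _ ⟨n, a, rfl⟩
    rw [T_preimage_cyl, generateFrom_cyl]
    exact MeasurableSpace.measurableSet_generateFrom ⟨_, _, rfl⟩
  rwa [← generateFrom_cyl] at this

theorem measurable_T_symm : Measurable T.symm := by
  have : @Measurable X X MeasurableSpace.pi
      (MeasurableSpace.generateFrom {s | ∃ n a, s = cyl n a}) T.symm := by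
    refine measurable_generateFrom ?_
    rintro _ ⟨n, a, rfl⟩
    have h : T.symm ⁻¹' cyl n a = cyl n (T a) := by
      rw [← Equiv.image_eq_preimage_symm, ← T.symm_apply_apply a, ← T_preimage_cyl,
        Set.image_preimage_eq _ T.surjective, T.symm_apply_apply]
    rw [h, generateFrom_cyl]
    exact MeasurableSpace.measurableSet_generateFrom ⟨_, _, rfl⟩
  rwa [← generateFrom_cyl] at this

theorem measurePreserving_T : MeasurePreserving T μ μ := by
  refine ⟨measurable_T, ?_⟩
  have : IsProbabilityMeasure (μ.map T) :=
    Measure.isProbabilityMeasure_map measurable_T.aemeasurable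
  refine ext_of_generate_finite _ generateFrom_cyl isPiSystem_cyl ?_ (by simp)
  rintro _ ⟨n, a, rfl⟩
  have hm : MeasurableSet (cyl n a) := by
    rw [generateFrom_cyl]
    exact MeasurableSpace.measurableSet_generateFrom ⟨_, _, rfl⟩
  rw [Measure.map_apply measurable_T hm, T_preimage_cyl, μ_cyl, μ_cyl]

theorem measurePreserving_T_symm : MeasurePreserving T.symm μ μ :=
  MeasurePreserving.symm (⟨T, measurable_T, measurable_T_symm⟩ : X ≃ᵐ X) measurePreserving_T

theorem null_preimage_zpow (k : ℤ) {s : Set X} (hs : μ s = 0) : μ ((T ^ k) ⁻¹' s) = 0 := by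
  cases k with
  | ofNat n =>
    have h := (measurePreserving_T.iterate n).quasiMeasurePreserving.preimage_null hs
    rwa [← Equiv.Perm.coe_pow] at h
  | negSucc n =>
    have h := (measurePreserving_T_symm.iterate (n + 1)).quasiMeasurePreserving.preimage_null hs
    rwa [← Equiv.Perm.coe_pow, show T.symm = T⁻¹ from rfl, inv_pow, ← zpow_negSucc] at h

theorem null_preimage {S : Equiv.Perm X} (hS : S ∈ borelFullGroup) {s : Set X} (hs : μ s = 0) :
    μ (S ⁻¹' s) = 0 := by
  refine measure_mono_null (t := ⋃ k : ℤ, (T ^ k) ⁻¹' s) ?_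
    (measure_iUnion_null fun k => null_preimage_zpow k hs)
  intro x hx
  obtain ⟨k, hk⟩ := hS.2.2 x
  exact Set.mem_iUnion.2 ⟨k, by simpa [hk] using hx⟩

/-- The automorphisms at uniform distance `0` from the identity. -/
def nullSubgroup : Subgroup borelFullGroup where
  carrier := {S | uniformDist S 1 = 0}
  mul_mem' := by
    intro a b ha hb
    rw [Set.mem_ofPred_eq, uniformDist_eq_zero] at *
    refine measure_mono_null ?_ (measure_union_null (null_preimage b.2 ha) hb)
    intro x hx
    by_contra h
    simp only [Set.mem_union, Set.mem_preimage, Set.mem_ofPred_eq, not_or, not_not,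
      Equiv.Perm.one_apply] at h
    exact hx (h.1.trans h.2)
  one_mem' := by simp [uniformDist]
  inv_mem' := by
    intro a ha
    rw [Set.mem_ofPred_eq, uniformDist_eq_zero] at *
    refine measure_mono_null ?_ ha
    intro x hx h
    apply hx
    simp only [Equiv.Perm.one_apply] at h ⊢
    rw [Subgroup.coe_inv, Equiv.Perm.inv_eq_iff_eq]
    exact h.symm

instance : nullSubgroup.Normal where
  conj_mem := by
    intro n hn g
    change uniformDist _ _ = 0 at hn
    change uniformDist _ _ = 0
    rw [uniformDist_eq_zero] at *
    refine measure_mono_null ?_ (null_preimage (inv_mem g.2) hn)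
    intro x hx h
    apply hx
    simp only [Equiv.Perm.one_apply] at h ⊢
    simp only [Subgroup.coe_mul, Subgroup.coe_inv, Equiv.Perm.mul_apply]
    rw [h]
    exact Equiv.apply_symm_apply _ x

/-- The full group `[T]`: orbit-preserving Borel automorphisms, two of them being identified when
their uniform distance is `0` (that is, when they agree `μ`-almost everywhere). -/
abbrev FullGroup : Type := borelFullGroup ⧸ nullSubgroup

theorem mk_eq_mk_iff (S₁ S₂ : borelFullGroup) :
    (S₁ : FullGroup) = (S₂ : FullGroup) ↔ uniformDist S₁ S₂ = 0 := by
  rw [QuotientGroup.eq]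
  change uniformDist _ _ = 0 ↔ _
  rw [uniformDist_eq_zero, uniformDist_eq_zero]
  have h : {x | ((S₁⁻¹ * S₂ : borelFullGroup) : Equiv.Perm X) x ≠ (1 : Equiv.Perm X) x} =
      {x | (S₁ : Equiv.Perm X) x ≠ (S₂ : Equiv.Perm X) x} := by
    ext x
    simp only [Set.mem_ofPred_eq, Subgroup.coe_mul, Subgroup.coe_inv, Equiv.Perm.mul_apply,
      Equiv.Perm.one_apply, ne_eq, Equiv.Perm.inv_eq_iff_eq]
    exact not_congr eq_comm
  rw [h]

/-- `Fix(S) = {x : S x = x}`. -/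
def fixSet (S : borelFullGroup) : Set X := {x | (S : Equiv.Perm X) x = x}

theorem measure_fixSet_congr {S₁ S₂ : borelFullGroup} (h : (S₁ : FullGroup) = (S₂ : FullGroup)) :
    μ.real (fixSet S₁) = μ.real (fixSet S₂) := by
  rw [mk_eq_mk_iff, uniformDist_eq_zero] at h
  refine measureReal_congr ?_
  have h' : ∀ᵐ x ∂μ, (S₁ : Equiv.Perm X) x = (S₂ : Equiv.Perm X) x := h
  filter_upwards [h'] with x hx
  exact propext (by
    change (S₁ : Equiv.Perm X) x = x ↔ (S₂ : Equiv.Perm X) x = x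
    rw [hx])

/-- The function `f ↦ μ(Fix(f))` on `[T]`; it does not depend on the representative of `f`. -/
noncomputable def fixMeasure (f : FullGroup) : ℝ :=
  Quotient.liftOn' f (fun S => μ.real (fixSet S))
    fun _ _ h => measure_fixSet_congr (Quotient.sound' h)

/-- `t ^ α` for `t ∈ [0,1]` and `α ∈ {0, 1, 2, …} ∪ {∞}`, with `0^0 = 1`, `1^∞ = 1` and
`t^∞ = 0` for `t < 1`. -/
noncomputable def extPow (t : ℝ) (α : ℕ∞) : ℝ :=
  if α = ⊤ then (if t = 1 then 1 else 0) else t ^ α.toNat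

end Odometer

open scoped ComplexOrder in
/-- A character on a group: a central, positive definite, normalized function. -/
structure IsGroupCharacter {G : Type*} [Group G] (χ : G → ℂ) : Prop where
  central : ∀ g₁ g₂ : G, χ (g₁ * g₂) = χ (g₂ * g₁)
  posSemidef : ∀ (n : ℕ) (g : Fin n → G),
    (Matrix.of fun i j : Fin n => χ (g i * (g j)⁻¹)).PosSemidef
  map_one : χ 1 = 1

/-- A character that is not a proper convex combination of two distinct characters. -/
def IsIndecomposableCharacter {G : Type*} [Group G] (χ : G → ℂ) : Prop :=
  IsGroupCharacter χ ∧
    ¬ ∃ (a : ℝ) (χ₁ χ₂ : G → ℂ), 0 < a ∧ a < 1 ∧ IsGroupCharacter χ₁ ∧ IsGroupCharacter χ₂ ∧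
      χ₁ ≠ χ₂ ∧ ∀ g, χ g = (a : ℂ) * χ₁ g + (1 - (a : ℂ)) * χ₂ g

/-! On involutions a character χ is a function F of μ(Fix), because ergodicity makes involutions
with supports of equal measure conjugate (`conj_of_involutive`). The rest comes from positivity,
applied to finite groups of flips: over each of finitely many disjoint sets of measure 2⁻ⁿ sits a
copy of (ℤ/2)^M. As M → ∞ a random element of this group is nontrivial over every one of the sets
with probability tending to 1, so averages over such groups have traces that converge to explicit
values of F. There are three consequences.

First, the projections `cutoff` built from these averages have nonnegative trace. In the limit this
says that all iterated differences of j ↦ F(j/2ⁿ) at 0 are nonnegative, and a Bernstein-type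
compactness argument (`exists_power_series_of_fwdDiff_nonneg`) yields F(t) = Σ cₖ tᵏ at dyadic t <
1, with cₖ ≥ 0 and C = Σ cₖ ≤ 1.

Second, χ equals F(μ(Fix)) at every permutation of initial words, not only at involutions: the
average of the conjugates of such a permutation under the flips converges, in the seminorm of χ, to
an average of flips supported on the same set (`value_of_perm`).

Third, the missing mass 1 - C sits at the identity. A nontrivial g displaces some set of positive
measure, and cutoffs over small displaced sets asymptotically annihilate g but not 1. Compressing by
such cutoffs shows that ψ = χ - (1 - C)δ₁ is still positive definite (`isCentralPD_sub_delta`).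

Since F(t) → C as t → 1 along dyadics below 1, ψ is continuous at the identity along involutions. No
continuity was assumed, so it has to be propagated algebraically: by `exists_swindle` an element of
small support is, up to conjugation, a product of five conjugates of involutions of small support,
and g ↦ ‖g - 1‖ is a conjugation-invariant length function. Hence ψ is uniformly continuous.
Permutations of words are dense (`exists_lift_close`), so ψ(g) = Σ cₖ μ(Fix g)ᵏ for all g. This is
`exists_eq_mixture`: every character is a mixture of the functions μ(Fix)^α.

Conversely, μ(Fix) is positive definite as an integral of Gram matrices, its powers are so by the
Schur product theorem, and δ₁ is the case α = ∞. A power series with nonnegative coefficients equal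
to tⁿ, or to 0, on (0, 1) has no other terms, so the single functions μ(Fix)^α cannot be split,
while any other mixture can. -/

set_option linter.unusedSectionVars false

/-! ### Positive definite functions as traces on the group algebra -/

section GroupAlgebra

open MonoidAlgebra ComplexConjugate
open scoped ComplexOrder

variable {G : Type*} [Group G]

/-- The adjoint `∑ a_g g ↦ ∑ conj a_g g⁻¹` on the complex group algebra. -/
noncomputable def gstar (x : MonoidAlgebra ℂ G) : MonoidAlgebra ℂ G :=
  x.coeff.sum fun g a => single g⁻¹ (conj a)

/-- The linear extension of a function on a group to the group algebra. -/
noncomputable def tr (φ : G → ℂ) (x : MonoidAlgebra ℂ G) : ℂ :=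
  x.coeff.sum fun g a => a * φ g

theorem gstar_single (g : G) (a : ℂ) : gstar (single g a) = single g⁻¹ (conj a) := by
  simp [gstar]

theorem gstar_add (x y : MonoidAlgebra ℂ G) : gstar (x + y) = gstar x + gstar y := by
  classical
  simp only [gstar, coeff_add]
  rw [Finsupp.sum_add_index'] <;> simp

theorem tr_add (φ : G → ℂ) (x y : MonoidAlgebra ℂ G) : tr φ (x + y) = tr φ x + tr φ y := by
  classical
  simp only [tr, coeff_add]
  rw [Finsupp.sum_add_index'] <;> simp [add_mul]

@[simp] theorem gstar_zero : gstar (0 : MonoidAlgebra ℂ G) = 0 := by simp [gstar]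
@[simp] theorem tr_zero (φ : G → ℂ) : tr φ (0 : MonoidAlgebra ℂ G) = 0 := by simp [tr]

theorem tr_single (φ : G → ℂ) (g : G) (a : ℂ) : tr φ (single g a) = a * φ g := by
  simp [tr]

theorem alg_induction {p : MonoidAlgebra ℂ G → Prop} (x : MonoidAlgebra ℂ G) (h0 : p 0)
    (hs : ∀ g a, p (single g a)) (ha : ∀ x y, p x → p y → p (x + y)) : p x := by
  obtain ⟨x⟩ := x
  induction x using Finsupp.induction_linear with
  | zero => exact h0
  | add f g hf hg => exact ha _ _ hf hg
  | single g a => exact hs g a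

theorem gstar_smul (c : ℂ) (x : MonoidAlgebra ℂ G) : gstar (c • x) = conj c • gstar x := by
  induction x using alg_induction with
  | h0 => simp
  | hs g a => simp [gstar_single, smul_single]
  | ha x y hx hy => rw [smul_add, gstar_add, hx, hy, gstar_add, smul_add]

theorem tr_smul (φ : G → ℂ) (c : ℂ) (x : MonoidAlgebra ℂ G) : tr φ (c • x) = c * tr φ x := by
  induction x using alg_induction with
  | h0 => simp
  | hs g a => simp [tr_single, smul_single, mul_assoc]
  | ha x y hx hy => rw [smul_add, tr_add, hx, hy, tr_add, mul_add]

theorem gstar_neg (x : MonoidAlgebra ℂ G) : gstar (-x) = -gstar x := by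
  have := gstar_smul (-1) x
  simpa using this

theorem tr_neg (φ : G → ℂ) (x : MonoidAlgebra ℂ G) : tr φ (-x) = -tr φ x := by
  have := tr_smul φ (-1) x
  simpa using this

theorem gstar_sub (x y : MonoidAlgebra ℂ G) : gstar (x - y) = gstar x - gstar y := by
  rw [sub_eq_add_neg, gstar_add, gstar_neg, sub_eq_add_neg]

theorem tr_sub (φ : G → ℂ) (x y : MonoidAlgebra ℂ G) : tr φ (x - y) = tr φ x - tr φ y := by
  rw [sub_eq_add_neg, tr_add, tr_neg, sub_eq_add_neg]

theorem tr_sum (φ : G → ℂ) {ι : Type*} (s : Finset ι) (f : ι → MonoidAlgebra ℂ G) :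
    tr φ (∑ i ∈ s, f i) = ∑ i ∈ s, tr φ (f i) := by
  classical
  induction s using Finset.induction_on with
  | empty => simp
  | insert a s ha ih => rw [Finset.sum_insert ha, Finset.sum_insert ha, tr_add, ih]

theorem gstar_sum {ι : Type*} (s : Finset ι) (f : ι → MonoidAlgebra ℂ G) :
    gstar (∑ i ∈ s, f i) = ∑ i ∈ s, gstar (f i) := by
  classical
  induction s using Finset.induction_on with
  | empty => simp
  | insert a s ha ih => rw [Finset.sum_insert ha, Finset.sum_insert ha, gstar_add, ih]

theorem gstar_mul (x y : MonoidAlgebra ℂ G) : gstar (x * y) = gstar y * gstar x := by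
  induction x using alg_induction with
  | h0 => simp
  | ha x x' hx hx' => rw [add_mul, gstar_add, hx, hx', gstar_add, mul_add]
  | hs g a =>
    induction y using alg_induction with
    | h0 => simp
    | ha y y' hy hy' => rw [mul_add, gstar_add, hy, hy', gstar_add, add_mul]
    | hs h b => simp [gstar_single, single_mul_single, mul_comm]

@[simp] theorem gstar_gstar (x : MonoidAlgebra ℂ G) : gstar (gstar x) = x := by
  induction x using alg_induction with
  | h0 => simp
  | ha x x' hx hx' => rw [gstar_add, gstar_add, hx, hx']
  | hs g a => simp [gstar_single]

@[simp] theorem gstar_one : gstar (1 : MonoidAlgebra ℂ G) = 1 := by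
  rw [one_def, gstar_single]; simp

/-- The group element `g` viewed in the group algebra. -/
noncomputable def el (g : G) : MonoidAlgebra ℂ G := single g 1

theorem el_mul (g h : G) : el (g * h) = el g * el h := by
  simp [el, single_mul_single]

@[simp] theorem el_one : el (1 : G) = 1 := rfl

@[simp] theorem gstar_el (g : G) : gstar (el g) = el g⁻¹ := by simp [el, gstar_single]

@[simp] theorem tr_one (φ : G → ℂ) : tr φ (1 : MonoidAlgebra ℂ G) = φ 1 := by
  rw [one_def, tr_single, one_mul]

@[simp] theorem tr_el (φ : G → ℂ) (g : G) : tr φ (el g) = φ g := by simp [el, tr_single]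

theorem tr_map {K : Type*} [Group K] (φ : G → ℂ) (κ : K →* G) (x : MonoidAlgebra ℂ K) :
    tr φ (mapDomainRingHom ℂ κ x) = tr (fun k => φ (κ k)) x := by
  induction x using alg_induction with
  | h0 => simp
  | ha x y hx hy => rw [tr_add, map_add, tr_add, hx, hy]
  | hs g a => rw [tr_single, mapDomainRingHom_apply, mapDomain_single, tr_single]

theorem gstar_map {K : Type*} [Group K] (κ : K →* G) (x : MonoidAlgebra ℂ K) :
    gstar (mapDomainRingHom ℂ κ x) = mapDomainRingHom ℂ κ (gstar x) := by
  induction x using alg_induction with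
  | h0 => simp
  | ha x y hx hy => rw [gstar_add, map_add, gstar_add, map_add, hx, hy]
  | hs g a => simp [gstar_single, mapDomainRingHom_apply, mapDomain_single]

theorem map_el {K : Type*} [Group K] (κ : K →* G) (k : K) :
    mapDomainRingHom ℂ κ (el k) = el (κ k) := by
  simp [el, mapDomainRingHom_apply, mapDomain_single]

/-- Central positive semidefinite functions on a group, without normalization. -/
structure IsCentralPD (φ : G → ℂ) : Prop where
  central : ∀ g h : G, φ (g * h) = φ (h * g)
  nonneg : ∀ x : MonoidAlgebra ℂ G, 0 ≤ tr φ (gstar x * x)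

theorem tr_gstar_mul_self (φ : G → ℂ) (x : MonoidAlgebra ℂ G) :
    tr φ (gstar x * x) =
      ∑ g ∈ x.coeff.support, ∑ h ∈ x.coeff.support, conj (x.coeff g) * x.coeff h * φ (g⁻¹ * h) := by
  have hx : x = ∑ g ∈ x.coeff.support, single g (x.coeff g) := by
    apply coeff_injective
    rw [coeff_sum]
    simp only [coeff_single]
    exact (Finsupp.sum_single x.coeff).symm
  conv_lhs => rw [hx, gstar_sum, Finset.sum_mul_sum, tr_sum]
  simp only [tr_sum, gstar_single, single_mul_single, tr_single]

/-- Nonnegativity at 1 + z g forces the imaginary part to vanish; z = 1 and z = i give the two real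
equations. -/
theorem map_inv_eq_conj {φ : G → ℂ} (h : ∀ x : MonoidAlgebra ℂ G, 0 ≤ tr φ (gstar x * x)) (g : G) :
    φ g⁻¹ = conj (φ g) := by
  have key : ∀ z : ℂ, tr φ (gstar (el 1 + z • el g) * (el 1 + z • el g)) =
      φ 1 + z * φ g + (conj z * φ g⁻¹ + conj z * z * φ 1) := by
    intro z
    rw [gstar_add, gstar_smul, gstar_el, gstar_el, add_mul, mul_add, mul_add, tr_add, tr_add,
      tr_add, mul_smul_comm, smul_mul_assoc, smul_mul_smul_comm, tr_smul, tr_smul, tr_smul,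
      ← el_mul, ← el_mul, ← el_mul, ← el_mul]
    simp
  have h0 := (Complex.le_def.1 (h (el 1))).2
  have h1 := (Complex.le_def.1 (h (el 1 + (1 : ℂ) • el g))).2
  have h2 := (Complex.le_def.1 (h (el 1 + Complex.I • el g))).2
  rw [key] at h1 h2
  simp [Complex.add_im, Complex.mul_im] at h0 h1 h2
  apply Complex.ext
  · simp only [Complex.conj_re]; linarith
  · simp only [Complex.conj_im]; linarith

/-- The matrix has entries at gᵢ gⱼ⁻¹ while `gstar x * x` produces g⁻¹ h, so the coefficients of x
are attached to the inverses of the gᵢ. -/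
theorem posSemidef_iff_tr (φ : G → ℂ) :
    (∀ (n : ℕ) (g : Fin n → G), (Matrix.of fun i j : Fin n => φ (g i * (g j)⁻¹)).PosSemidef) ↔
      ∀ x : MonoidAlgebra ℂ G, 0 ≤ tr φ (gstar x * x) := by
  classical
  constructor
  · intro h x
    let n := x.coeff.support.card
    let e : Fin n ≃ x.coeff.support := x.coeff.support.equivFin.symm
    have h1 := (Matrix.posSemidef_iff_dotProduct_mulVec.1 (h n fun i => ((e i : G))⁻¹)).2
      (fun i => x.coeff (e i))
    rw [tr_gstar_mul_self]
    convert h1 using 1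
    simp only [dotProduct, Matrix.mulVec, Matrix.of_apply, Finset.mul_sum, Pi.star_apply, inv_inv]
    rw [← Finset.sum_coe_sort, ← e.sum_comp]
    refine Finset.sum_congr rfl fun i _ => ?_
    rw [← Finset.sum_coe_sort, ← e.sum_comp]
    refine Finset.sum_congr rfl fun j _ => ?_
    simp only [RCLike.star_def]
    ring
  · intro h n g
    have key : ∀ a : Fin n → ℂ, star a ⬝ᵥ (Matrix.of fun i j : Fin n => φ (g i * (g j)⁻¹)).mulVec a
        = tr φ (gstar (∑ i, single (g i)⁻¹ (a i)) * ∑ i, single (g i)⁻¹ (a i)) := by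
      intro a
      rw [gstar_sum, Finset.sum_mul_sum, tr_sum]
      simp only [tr_sum, gstar_single, single_mul_single, tr_single, dotProduct, Matrix.mulVec,
        Matrix.of_apply, Finset.mul_sum, Pi.star_apply, inv_inv]
      refine Finset.sum_congr rfl fun i _ => Finset.sum_congr rfl fun j _ => ?_
      simp only [RCLike.star_def]
      ring
    refine Matrix.posSemidef_iff_dotProduct_mulVec.2 ⟨?_, fun a => by rw [key]; exact h _⟩
    ext i j
    rw [Matrix.conjTranspose_apply, Matrix.of_apply, Matrix.of_apply, RCLike.star_def,
      ← map_inv_eq_conj h, mul_inv_rev, inv_inv]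

theorem IsGroupCharacter.isCentralPD {χ : G → ℂ} (h : IsGroupCharacter χ) : IsCentralPD χ :=
  ⟨h.central, (posSemidef_iff_tr χ).1 h.posSemidef⟩

theorem IsCentralPD.isGroupCharacter {χ : G → ℂ} (h : IsCentralPD χ) (h1 : χ 1 = 1) :
    IsGroupCharacter χ :=
  ⟨h.central, (posSemidef_iff_tr χ).2 h.nonneg, h1⟩

/-- The seminorm attached to a central positive semidefinite function. -/
noncomputable def nm (φ : G → ℂ) (x : MonoidAlgebra ℂ G) : ℝ :=
  Real.sqrt (tr φ (gstar x * x)).re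

namespace IsCentralPD

variable {φ : G → ℂ}

theorem map_inv (hφ : IsCentralPD φ) (g : G) : φ g⁻¹ = conj (φ g) := map_inv_eq_conj hφ.nonneg g

theorem tr_mul_comm (hφ : IsCentralPD φ) (x y : MonoidAlgebra ℂ G) : tr φ (x * y) = tr φ (y * x) := by
  induction x using alg_induction with
  | h0 => simp
  | ha x x' hx hx' => rw [add_mul, mul_add, tr_add, tr_add, hx, hx']
  | hs g a =>
    induction y using alg_induction with
    | h0 => simp
    | ha y y' hy hy' => rw [add_mul, mul_add, tr_add, tr_add, hy, hy']
    | hs h b => rw [single_mul_single, single_mul_single, tr_single, tr_single, hφ.central, mul_comm a]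

theorem tr_gstar (hφ : IsCentralPD φ) (x : MonoidAlgebra ℂ G) : tr φ (gstar x) = conj (tr φ x) := by
  induction x using alg_induction with
  | h0 => simp
  | ha x x' hx hx' => rw [gstar_add, tr_add, tr_add, hx, hx', map_add]
  | hs g a => rw [gstar_single, tr_single, tr_single, hφ.map_inv, map_mul]

/-- The positive semidefinite inner product `⟨x, y⟩ = φ (x* y)` on the group algebra. -/
@[reducible] noncomputable def core (hφ : IsCentralPD φ) :
    PreInnerProductSpace.Core ℂ (MonoidAlgebra ℂ G) where
  inner x y := tr φ (gstar x * y)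
  conj_inner_symm x y := by rw [← hφ.tr_gstar, gstar_mul, gstar_gstar]
  re_inner_nonneg x := (Complex.le_def.1 (hφ.nonneg x)).1
  add_left x y z := by rw [gstar_add, add_mul, tr_add]
  smul_left x y r := by rw [gstar_smul, smul_mul_assoc, tr_smul]

theorem norm_tr_gstar_mul_le (hφ : IsCentralPD φ) (x y : MonoidAlgebra ℂ G) :
    ‖tr φ (gstar x * y)‖ ≤ nm φ x * nm φ y :=
  letI := hφ.core
  InnerProductSpace.Core.norm_inner_le_norm (𝕜 := ℂ) x y

theorem nm_add_le (hφ : IsCentralPD φ) (x y : MonoidAlgebra ℂ G) : nm φ (x + y) ≤ nm φ x + nm φ y :=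
  letI := hφ.core
  letI := InnerProductSpace.Core.toSeminormedAddCommGroup (𝕜 := ℂ) (F := MonoidAlgebra ℂ G)
  norm_add_le x y

theorem nm_nonneg (_hφ : IsCentralPD φ) (x : MonoidAlgebra ℂ G) : 0 ≤ nm φ x := Real.sqrt_nonneg _

theorem tr_gstar_mul_self_eq (hφ : IsCentralPD φ) (x : MonoidAlgebra ℂ G) : tr φ (gstar x * x) = ((nm φ x ^ 2 : ℝ) : ℂ) := by
  have := Complex.le_def.1 (hφ.nonneg x)
  rw [nm, Real.sq_sqrt this.1]
  exact Complex.ext rfl this.2.symm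

theorem nm_sq (hφ : IsCentralPD φ) (x : MonoidAlgebra ℂ G) : nm φ x ^ 2 = (tr φ (gstar x * x)).re := by
  rw [hφ.tr_gstar_mul_self_eq, Complex.ofReal_re]

theorem norm_tr_le (hφ : IsCentralPD φ) (x : MonoidAlgebra ℂ G) : ‖tr φ x‖ ≤ nm φ 1 * nm φ x := by
  simpa using hφ.norm_tr_gstar_mul_le 1 x

theorem nm_el_mul (_hφ : IsCentralPD φ) (g : G) (x : MonoidAlgebra ℂ G) : nm φ (el g * x) = nm φ x := by
  rw [nm, nm, gstar_mul, gstar_el, mul_assoc, ← mul_assoc (el g⁻¹), ← el_mul]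
  simp

theorem nm_mul_el (hφ : IsCentralPD φ) (g : G) (x : MonoidAlgebra ℂ G) : nm φ (x * el g) = nm φ x := by
  rw [nm, nm, gstar_mul, gstar_el, mul_assoc, hφ.tr_mul_comm, mul_assoc, mul_assoc, ← el_mul]
  simp

/-- Pythagoras for x = x e + x (1 - e); the trace property reduces both squares to traces of x* x e
and x* x (1 - e). -/
theorem nm_mul_le_of_proj (hφ : IsCentralPD φ) {e : MonoidAlgebra ℂ G} (he : gstar e = e) (hee : e * e = e)
    (x : MonoidAlgebra ℂ G) : nm φ (x * e) ≤ nm φ x := by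
  have h1 : tr φ (gstar x * x) = tr φ (gstar (x * e) * (x * e)) +
      tr φ (gstar (x * (1 - e)) * (x * (1 - e))) := by
    have a1 : tr φ (gstar (x * e) * (x * e)) = tr φ (gstar x * x * e) := by
      rw [gstar_mul, he, hφ.tr_mul_comm, mul_assoc, ← mul_assoc e, hee, hφ.tr_mul_comm, mul_assoc,
        hφ.tr_mul_comm, mul_assoc, hφ.tr_mul_comm, mul_assoc]
    have a2 : tr φ (gstar (x * (1 - e)) * (x * (1 - e))) = tr φ (gstar x * x * (1 - e)) := by
      have hee' : (1 - e) * (1 - e) = 1 - e := by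
        rw [mul_sub, sub_mul, sub_mul, hee]; simp
      rw [gstar_mul, gstar_sub, gstar_one, he, hφ.tr_mul_comm, mul_assoc, ← mul_assoc (1 - e), hee',
        hφ.tr_mul_comm, mul_assoc,
        hφ.tr_mul_comm, mul_assoc, hφ.tr_mul_comm, mul_assoc]
    rw [a1, a2, ← tr_add, ← mul_add]; simp
  have h2 : nm φ (x * e) ^ 2 ≤ nm φ x ^ 2 := by
    rw [hφ.nm_sq, hφ.nm_sq x, h1, Complex.add_re]
    have := (Complex.le_def.1 (hφ.nonneg (x * (1 - e)))).1
    simp at this ⊢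
    exact this
  exact le_of_sq_le_sq h2 (hφ.nm_nonneg _)

theorem tr_proj_nonneg (hφ : IsCentralPD φ) {e : MonoidAlgebra ℂ G} (he : gstar e = e) (hee : e * e = e) :
    0 ≤ tr φ e := by
  have := hφ.nonneg e
  rwa [he, hee] at this

theorem norm_apply_le (hφ : IsCentralPD φ) (g : G) : ‖φ g‖ ≤ (φ 1).re := by
  have h := hφ.norm_tr_le (el g)
  have h1 : nm φ (el g) = nm φ 1 := by simpa using hφ.nm_el_mul g 1
  have h2 : nm φ (1 : MonoidAlgebra ℂ G) ^ 2 = (φ 1).re := by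
    rw [hφ.nm_sq, gstar_one, mul_one, ← el_one, tr_el]
  rw [h1, tr_el, ← sq, h2] at h
  exact h

/-- The distance between group elements. -/
theorem nm_el_sub_sq (hφ : IsCentralPD φ) (g h : G) : nm φ (el g - el h) ^ 2 = 2 * ((φ 1).re - (φ (g⁻¹ * h)).re) := by
  rw [hφ.nm_sq, gstar_sub, gstar_el, gstar_el, sub_mul, mul_sub, mul_sub, ← el_mul, ← el_mul,
    ← el_mul, ← el_mul, tr_sub, tr_sub, tr_sub, tr_el, tr_el, tr_el, tr_el]
  have : φ (h⁻¹ * g) = conj (φ (g⁻¹ * h)) := by rw [← hφ.map_inv]; simp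
  rw [this]
  simp
  ring

/-- The length function `ℓ(g) = ‖g - 1‖`. -/
theorem nm_el_mul_sub_one_le (hφ : IsCentralPD φ) (g h : G) :
    nm φ (el (g * h) - 1) ≤ nm φ (el g - 1) + nm φ (el h - 1) := by
  have : el (g * h) - 1 = el g * (el h - 1) + (el g - 1) := by rw [el_mul, mul_sub]; simp
  rw [this]
  refine (hφ.nm_add_le _ _).trans ?_
  rw [hφ.nm_el_mul, add_comm]

theorem nm_el_conj_sub_one (hφ : IsCentralPD φ) (g h : G) : nm φ (el (g * h * g⁻¹) - 1) = nm φ (el h - 1) := by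
  have : el (g * h * g⁻¹) - 1 = el g * (el h - 1) * el g⁻¹ := by
    rw [mul_sub, sub_mul, ← el_mul, ← el_mul, mul_one, ← el_mul]; simp
  rw [this, hφ.nm_mul_el, hφ.nm_el_mul]

/-- Turns smallness of the length function near the identity into uniform continuity of φ. -/
theorem norm_sub_le (hφ : IsCentralPD φ) (g h : G) : ‖φ g - φ h‖ ≤ nm φ 1 * nm φ (el (g⁻¹ * h) - 1) := by
  have h1 := hφ.norm_tr_le (el h - el g)
  rw [tr_sub, tr_el, tr_el, norm_sub_rev] at h1
  have : el h - el g = el g * (el (g⁻¹ * h) - 1) := by rw [mul_sub, ← el_mul]; simp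
  rwa [this, hφ.nm_el_mul] at h1

theorem comp_hom (hφ : IsCentralPD φ) {K : Type*} [Group K] (κ : K →* G) : IsCentralPD (fun k => φ (κ k)) := by
  refine ⟨fun g h => by rw [map_mul, hφ.central, map_mul], fun x => ?_⟩
  rw [← tr_map, map_mul, ← gstar_map]
  exact hφ.nonneg _

end IsCentralPD

/-! ### Averages over finite subgroups -/

section Average

variable {K : Type*} [Group K] [Fintype K]

/-- The average of the image of a finite group, a projection in the group algebra. -/
noncomputable def avg (κ : K →* G) : MonoidAlgebra ℂ G :=
  ((Fintype.card K : ℂ)⁻¹) • ∑ k, el (κ k)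

theorem gstar_avg (κ : K →* G) : gstar (avg κ) = avg κ := by
  rw [avg, gstar_smul, gstar_sum]
  simp only [gstar_el, map_inv₀, Complex.conj_natCast]
  rw [← Equiv.sum_comp (Equiv.inv K)]
  simp

theorem el_mul_avg (κ : K →* G) (k : K) : el (κ k) * avg κ = avg κ := by
  rw [avg, mul_smul_comm, Finset.mul_sum]
  simp only [← el_mul, ← map_mul]
  congr 1
  exact Equiv.sum_comp (Equiv.mulLeft k) (fun k => el (κ k))

theorem avg_mul_el (κ : K →* G) (k : K) : avg κ * el (κ k) = avg κ := by
  rw [avg, smul_mul_assoc, Finset.sum_mul]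
  simp only [← el_mul, ← map_mul]
  congr 1
  exact Equiv.sum_comp (Equiv.mulRight k) (fun k => el (κ k))

theorem avg_mul_avg (κ : K →* G) : avg κ * avg κ = avg κ := by
  conv_lhs => enter [1]; rw [avg]
  rw [smul_mul_assoc, Finset.sum_mul]
  simp only [el_mul_avg]
  rw [Finset.sum_const, Finset.card_univ, ← Nat.cast_smul_eq_nsmul ℂ, smul_smul,
    inv_mul_cancel₀, one_smul]
  exact_mod_cast Fintype.card_ne_zero

theorem tr_mul_avg (φ : G → ℂ) (κ : K →* G) (x : MonoidAlgebra ℂ G) :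
    tr φ (x * avg κ) = (Fintype.card K : ℂ)⁻¹ * ∑ k, tr φ (x * el (κ k)) := by
  rw [avg, mul_smul_comm, tr_smul, Finset.mul_sum, tr_sum]

end Average

/-- If all but `m` of the values of a bounded function equal `c`, its average is close to `c`. -/
theorem norm_average_sub_le {ι : Type*} [Fintype ι] [Nonempty ι] (f : ι → ℂ) (c : ℂ) (B : ℝ)
    (s : Finset ι) (hB : ∀ i, ‖f i - c‖ ≤ B) (hf : ∀ i ∉ s, f i = c) :
    ‖(Fintype.card ι : ℂ)⁻¹ * ∑ i, f i - c‖ ≤ B * (s.card / Fintype.card ι) := by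
  have hc : (Fintype.card ι : ℂ) ≠ 0 := by exact_mod_cast Fintype.card_ne_zero
  have h1 : (Fintype.card ι : ℂ)⁻¹ * ∑ i, f i - c = (Fintype.card ι : ℂ)⁻¹ * ∑ i, (f i - c) := by
    rw [Finset.sum_sub_distrib, mul_sub, Finset.sum_const, Finset.card_univ, nsmul_eq_mul,
      ← mul_assoc, inv_mul_cancel₀ hc, one_mul]
  have h2 : ∑ i, (f i - c) = ∑ i ∈ s, (f i - c) :=
    (Finset.sum_subset (Finset.subset_univ s) fun i _ hi => by rw [hf i hi, sub_self]).symm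
  rw [h1, h2, norm_mul, norm_inv, Complex.norm_natCast, inv_mul_eq_div, mul_div_assoc']
  gcongr
  calc ‖∑ i ∈ s, (f i - c)‖ ≤ ∑ i ∈ s, B := norm_sum_le_of_le _ fun i _ => hB i
    _ = B * s.card := by rw [Finset.sum_const, nsmul_eq_mul, mul_comm]

end GroupAlgebra

/-! ### Orbits, measure preservation and ergodicity -/

namespace Odometer

theorem mem_orbit_self (x : X) : x ∈ orbit x := ⟨0, rfl⟩

theorem mem_orbit_zpow (k : ℤ) (x : X) : (T ^ k) x ∈ orbit x := ⟨k, rfl⟩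

theorem mem_orbit_symm {x y : X} (h : y ∈ orbit x) : x ∈ orbit y := by
  obtain ⟨k, rfl⟩ := h
  exact ⟨-k, by rw [zpow_neg]; exact Equiv.symm_apply_apply _ _⟩

theorem mem_orbit_trans {x y z : X} (h : y ∈ orbit x) (h' : z ∈ orbit y) : z ∈ orbit x := by
  obtain ⟨k, rfl⟩ := h
  obtain ⟨l, rfl⟩ := h'
  exact ⟨l + k, by rw [zpow_add, Equiv.Perm.mul_apply]⟩

theorem addOne_zero (y : X) : addOne y 0 = !(y 0) := by simp [addOne]

theorem addOne_succ (y : X) (j : ℕ) :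
    addOne y (j + 1) = if y 0 = true then addOne (fun i => y (i + 1)) j else y (j + 1) := by
  by_cases h : y 0 = true
  · have : (∀ m < j + 1, y m = true) ↔ ∀ m < j, y (m + 1) = true := by
      constructor
      · intro h' m hm; exact h' _ (by omega)
      · intro h' m hm
        cases m with
        | zero => exact h
        | succ m => exact h' m (by omega)
    rw [if_pos h]
    simp only [addOne, this]
  · have : ¬ ∀ m < j + 1, y m = true := fun h' => h (h' 0 (by omega))
    rw [if_neg h, addOne, if_neg this]

/-- Exactly one of two consecutive additions carries out of the first digit. -/
theorem addOne_addOne_succ (y : X) (j : ℕ) :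
    addOne (addOne y) (j + 1) = addOne (fun i => y (i + 1)) j := by
  rw [addOne_succ, addOne_zero]
  cases h : y 0
  · have h' : (fun i => addOne y (i + 1)) = fun i => y (i + 1) := by
      funext i; simp [addOne_succ, h]
    simp [h']
  · simp [addOne_succ, h]

/-- The power of exponent 2ⁿ is the odometer on the tail after n digits, by doubling. It gives
access to single digits. -/
theorem T_pow_two_pow (n : ℕ) (x : X) :
    (∀ i < n, (T ^ 2 ^ n) x i = x i) ∧
      ∀ j, (T ^ 2 ^ n) x (n + j) = addOne (fun i => x (n + i)) j := by
  induction n generalizing x with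
  | zero => simp [T]
  | succ n ih =>
    have h : (T ^ 2 ^ (n + 1)) x = (T ^ 2 ^ n) ((T ^ 2 ^ n) x) := by
      rw [pow_succ, mul_two, pow_add, Equiv.Perm.mul_apply]
    have h2 : (fun i => (T ^ 2 ^ n) x (n + i)) = addOne fun i => x (n + i) := by
      funext i; exact (ih x).2 i
    rw [h]
    constructor
    · intro i hi
      rcases Nat.lt_succ_iff_lt_or_eq.1 hi with hi | rfl
      · rw [(ih _).1 i hi, (ih x).1 i hi]
      · have := (ih ((T ^ 2 ^ i) x)).2 0
        rw [h2] at this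
        simpa [addOne_zero] using this
    · intro j
      have := (ih ((T ^ 2 ^ n) x)).2 (j + 1)
      rw [h2, addOne_addOne_succ] at this
      rw [show n + 1 + j = n + (j + 1) by ring, this]
      congr 1
      funext i
      congr 1
      ring

/-- When the n-th digit is 0, adding 2ⁿ causes no carry and changes only that digit. -/
theorem update_mem_orbit (x : X) (n : ℕ) (b : Bool) : Function.update x n b ∈ orbit x := by
  have key : ∀ x : X, x n = false → Function.update x n true ∈ orbit x := by
    intro x hx
    refine ⟨((2 ^ n : ℕ) : ℤ), ?_⟩
    rw [zpow_natCast]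
    funext i
    rcases lt_or_ge i n with hi | hi
    · rw [(T_pow_two_pow n x).1 i hi, Function.update_of_ne hi.ne]
    · obtain ⟨j, rfl⟩ := Nat.exists_eq_add_of_le hi
      rw [(T_pow_two_pow n x).2 j]
      cases j with
      | zero => simp [addOne_zero, hx]
      | succ j =>
        rw [addOne_succ, if_neg (by simp [hx]), Function.update_of_ne (by omega)]
  by_cases hb : x n = b
  · rw [← hb, Function.update_eq_self]; exact mem_orbit_self x
  · cases b
    · have h1 := key (Function.update x n false) (by simp)
      rw [Function.update_idem] at h1
      have : Function.update x n true = x := by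
        rw [Function.update_eq_iff]; simpa using hb
      rw [this] at h1
      exact mem_orbit_symm h1
    · exact key x (by simpa using hb)

theorem mem_orbit_of_tail {x y : X} (n : ℕ) (h : ∀ i, n ≤ i → y i = x i) : y ∈ orbit x := by
  induction n generalizing x with
  | zero => rw [show y = x from funext fun i => h i (Nat.zero_le _)]; exact mem_orbit_self x
  | succ n ih =>
    refine mem_orbit_trans (update_mem_orbit x n (y n)) (ih fun i hi => ?_)
    rcases hi.eq_or_lt with rfl | hi
    · simp
    · rw [Function.update_of_ne (by omega)]; exact h i hi

theorem measurePreserving_zpow (k : ℤ) : MeasurePreserving (⇑(T ^ k)) μ μ := by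
  cases k with
  | ofNat n =>
    have h := measurePreserving_T.iterate n
    rwa [← Equiv.Perm.coe_pow] at h
  | negSucc n =>
    have h := measurePreserving_T_symm.iterate (n + 1)
    rwa [← Equiv.Perm.coe_pow, show T.symm = T⁻¹ from rfl, inv_pow, ← zpow_negSucc] at h

/-- Orbits are countable, so the saturation of a null set is null. This turns almost everywhere
statements into pointwise ones on an invariant set. -/
theorem exists_invariant_conull {p : X → Prop} (h : ∀ᵐ x ∂μ, p x) :
    ∃ Y : Set X, MeasurableSet Y ∧ (∀ᵐ x ∂μ, x ∈ Y) ∧ (∀ x ∈ Y, ∀ y ∈ orbit x, y ∈ Y) ∧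
      ∀ x ∈ Y, p x := by
  let N := toMeasurable μ {x | ¬ p x}
  have hN : μ N = 0 := by rw [measure_toMeasurable]; exact h
  refine ⟨(⋃ k : ℤ, (T ^ k) ⁻¹' N)ᶜ, ?_, ?_, ?_, ?_⟩
  · exact (MeasurableSet.iUnion fun k =>
      (measurePreserving_zpow k).measurable (measurableSet_toMeasurable _ _)).compl
  · have : μ (⋃ k : ℤ, (T ^ k) ⁻¹' N) = 0 := measure_iUnion_null fun k => null_preimage_zpow k hN
    exact measure_eq_zero_iff_ae_notMem.1 this
  · rintro x hx y ⟨k, rfl⟩ hy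
    apply hx
    obtain ⟨l, hl⟩ := Set.mem_iUnion.1 hy
    refine Set.mem_iUnion.2 ⟨l + k, ?_⟩
    rw [Set.mem_preimage, zpow_add, Equiv.Perm.mul_apply]
    exact hl
  · intro x hx
    by_contra hp
    exact hx (Set.mem_iUnion.2 ⟨0, by simpa using subset_toMeasurable μ _ hp⟩)

theorem measurableSet_eq {f g : X → X} (hf : Measurable f) (hg : Measurable g) :
    MeasurableSet {x | f x = g x} := measurableSet_eq_fun hf hg

/-- A measurable injection that moves points inside their orbits preserves measure. -/
theorem measure_image_eq {f : X → X} (hf : Measurable f) (ho : ∀ x, f x ∈ orbit x) {A : Set X}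
    (hA : MeasurableSet A) (hi : Set.InjOn f A) : μ (f '' A) = μ A := by
  let e : ℕ ≃ ℤ := (Denumerable.eqv ℤ).symm
  -- Cut A into countably many pieces on each of which f is a single power of T; injectivity keeps
  -- their images disjoint.
  let P : ℕ → Set X := fun n => {x | f x = (T ^ e n) x}
  have hP : ∀ n, MeasurableSet (P n) := fun n =>
    measurableSet_eq hf (measurePreserving_zpow _).measurable
  let B : ℕ → Set X := fun n => A ∩ disjointed P n
  have hB : ∀ n, MeasurableSet (B n) := fun n => hA.inter (MeasurableSet.disjointed hP n)
  have hAB : A = ⋃ n, B n := by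
    rw [← Set.inter_iUnion, iUnion_disjointed, Set.inter_eq_left.2]
    intro x _
    obtain ⟨k, hk⟩ := ho x
    exact Set.mem_iUnion.2 ⟨e.symm k, by simp [P, hk]⟩
  have hd : Pairwise (Function.onFun Disjoint B) := fun i j hij =>
    (disjoint_disjointed P hij).mono Set.inter_subset_right Set.inter_subset_right
  have him : ∀ n, f '' B n = (T ^ (-e n)) ⁻¹' B n := by
    intro n
    have : f '' B n = (T ^ e n) '' B n := Set.image_congr fun x hx =>
      (disjointed_subset P n hx.2 : x ∈ P n)
    rw [this, zpow_neg]
    exact Equiv.image_eq_preimage_symm _ _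
  have hBA : ∀ n, B n ⊆ A := fun n => Set.inter_subset_left
  have hd' : Pairwise (Function.onFun Disjoint fun n => f '' B n) := by
    intro i j hij
    rw [Function.onFun, Set.disjoint_left]
    rintro _ ⟨x, hx, rfl⟩ ⟨y, hy, hxy⟩
    rw [hi (hBA j hy) (hBA i hx) hxy] at hy
    exact Set.disjoint_left.1 (hd hij) hx hy
  rw [hAB, Set.image_iUnion, measure_iUnion hd', measure_iUnion hd hB]
  · refine tsum_congr fun n => ?_
    rw [him, (measurePreserving_zpow _).measure_preimage (hB n).nullMeasurableSet]
  · intro n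
    rw [him]; exact (measurePreserving_zpow _).measurable (hB n)

theorem coe_measurable (g : borelFullGroup) : Measurable (g : Equiv.Perm X) := g.2.1

theorem coe_mem_orbit (g : borelFullGroup) (x : X) : (g : Equiv.Perm X) x ∈ orbit x := g.2.2.2 x

theorem measurePreserving_coe (g : borelFullGroup) : MeasurePreserving (g : Equiv.Perm X) μ μ := by
  refine ⟨coe_measurable g, Measure.ext fun s hs => ?_⟩
  rw [Measure.map_apply (coe_measurable g) hs]
  have h : (g : Equiv.Perm X) ⁻¹' s = ((g⁻¹ : borelFullGroup) : Equiv.Perm X) '' s :=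
    (Equiv.image_symm_eq_preimage _ _).symm
  rw [h, measure_image_eq (coe_measurable _) (coe_mem_orbit _) hs (Equiv.injective _).injOn]

/-- An element of the full group is determined by an almost everywhere injective measurable map
that moves points inside their orbits. -/
theorem exists_ae_eq {f : X → X} (hf : Measurable f) (ho : ∀ x, f x ∈ orbit x) {S : Set X}
    (hS : ∀ᵐ x ∂μ, x ∈ S) (hi : Set.InjOn f S) :
    ∃ g : borelFullGroup, ∀ᵐ x ∂μ, (g : Equiv.Perm X) x = f x := by
  classical
  obtain ⟨Y, hYm, hYae, hYo, hYS⟩ := exists_invariant_conull hS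
  have hYi : Set.InjOn f Y := hi.mono hYS
  have hfY : MeasurableSet (f '' Y) := hYm.image_of_measurable_injOn hf hYi
  have hfYae : ∀ᵐ x ∂μ, x ∈ f '' Y := by
    have h1 : μ (f '' Y) = 1 := by
      rw [measure_image_eq hf ho hYm hYi]
      exact (prob_compl_eq_zero_iff hYm).1 hYae
    exact (prob_compl_eq_zero_iff hfY).2 h1
  -- An invariant set inside the image of f: on it f is injective and onto, so f can be replaced by
  -- the identity outside.
  obtain ⟨Z, hZm, hZae, hZo, hZS⟩ := exists_invariant_conull (hYae.and hfYae)
  have hZi : Set.InjOn f Z := hYi.mono fun x hx => (hZS x hx).1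
  let F : X → X := fun x => if x ∈ Z then f x else x
  have hFm : Measurable F := Measurable.ite hZm hf measurable_id
  have hFo : ∀ x, F x ∈ orbit x := by
    intro x
    by_cases hx : x ∈ Z
    · simp only [F, if_pos hx]; exact ho x
    · simp only [F, if_neg hx]; exact mem_orbit_self x
  have hFZ : ∀ x, F x ∈ Z ↔ x ∈ Z := fun x =>
    ⟨fun h => hZo _ h _ (mem_orbit_symm (hFo x)), fun h => hZo _ h _ (hFo x)⟩
  have hFi : Function.Injective F := by
    intro x y hxy
    have h1 : x ∈ Z ↔ y ∈ Z := by rw [← hFZ x, hxy, hFZ]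
    by_cases hx : x ∈ Z
    · simp only [F, if_pos hx, if_pos (h1.1 hx)] at hxy
      exact hZi hx (h1.1 hx) hxy
    · simpa only [F, if_neg hx, if_neg (mt h1.2 hx)] using hxy
  have hFs : Function.Surjective F := by
    intro y
    by_cases hy : y ∈ Z
    · obtain ⟨x, -, hx⟩ := (hZS y hy).2
      have hxZ : x ∈ Z := hZo y hy x (mem_orbit_symm (hx ▸ ho x))
      exact ⟨x, by simp only [F, if_pos hxZ, hx]⟩
    · exact ⟨y, by simp only [F, if_neg hy]⟩
  have hFe : MeasurableEmbedding F := hFm.measurableEmbedding hFi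
  let E : Equiv.Perm X := Equiv.ofBijective F ⟨hFi, hFs⟩
  have hE : Measurable E.symm := by
    intro s hs
    rw [← Equiv.image_eq_preimage_symm]
    exact hFe.measurableSet_image.2 hs
  refine ⟨⟨E, hFm, hE, hFo⟩, ?_⟩
  filter_upwards [hZae] with x hx
  exact if_pos hx

/-- An involutive measurable map that moves points inside their orbits. -/
def ofInvolutive (f : X → X) (hf : Measurable f) (ho : ∀ x, f x ∈ orbit x)
    (hi : Function.Involutive f) : borelFullGroup :=
  ⟨hi.toPerm, hf, hf, ho⟩

theorem mk_eq_iff_ae {g h : borelFullGroup} :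
    (g : FullGroup) = (h : FullGroup) ↔ ∀ᵐ x ∂μ, (g : Equiv.Perm X) x = (h : Equiv.Perm X) x := by
  rw [mk_eq_mk_iff, uniformDist_eq_zero]
  rfl

theorem measurableSet_cyl (n : ℕ) (a : X) : MeasurableSet (cyl n a) := by
  rw [generateFrom_cyl]
  exact MeasurableSpace.measurableSet_generateFrom ⟨_, _, rfl⟩

/-- An invariant set is independent of every cylinder: adding 2ⁿ exchanges the two halves of a
cylinder of length n and preserves E, so E meets both halves in the same measure. -/
theorem measure_inter_cyl {E : Set X} (hE : MeasurableSet E)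
    (hi : ∀ x ∈ E, ∀ y ∈ orbit x, y ∈ E) (n : ℕ) (a : X) :
    μ (E ∩ cyl n a) = μ E * (2⁻¹ : ENNReal) ^ n := by
  induction n generalizing a with
  | zero => simp [cyl]
  | succ n ih =>
    let a' := Function.update a n (!(a n))
    have hflip : ∀ x, x ∈ E ∩ cyl (n + 1) a' ↔ (T ^ ((2 ^ n : ℕ) : ℤ)) x ∈ E ∩ cyl (n + 1) a := by
      intro x
      have hp := T_pow_two_pow n x
      have h0 := hp.2 0
      rw [addOne_zero] at h0
      simp only [add_zero] at h0
      rw [zpow_natCast]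
      have hEx : x ∈ E ↔ (T ^ 2 ^ n) x ∈ E := by
        have ho : (T ^ 2 ^ n) x ∈ orbit x := ⟨((2 ^ n : ℕ) : ℤ), by rw [zpow_natCast]⟩
        exact ⟨fun h => hi x h _ ho, fun h => hi _ h _ (mem_orbit_symm ho)⟩
      refine and_congr hEx ⟨fun h i hi => ?_, fun h i hi => ?_⟩
      · rcases Nat.lt_succ_iff_lt_or_eq.1 hi with hi' | rfl
        · rw [hp.1 i hi', h i hi]; simp [a', hi'.ne]
        · rw [h0, h i hi]; simp [a']
      · rcases Nat.lt_succ_iff_lt_or_eq.1 hi with hi' | rfl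
        · rw [← hp.1 i hi', h i hi]; simp [a', hi'.ne]
        · have := h i hi
          rw [h0] at this
          simp [a', ← this]
    have heq : μ (E ∩ cyl (n + 1) a') = μ (E ∩ cyl (n + 1) a) := by
      have : E ∩ cyl (n + 1) a' = (T ^ ((2 ^ n : ℕ) : ℤ)) ⁻¹' (E ∩ cyl (n + 1) a) := by
        ext x; exact hflip x
      rw [this, (measurePreserving_zpow _).measure_preimage
        (hE.inter (measurableSet_cyl _ _)).nullMeasurableSet]
    have hun : E ∩ cyl n a = (E ∩ cyl (n + 1) a) ∪ (E ∩ cyl (n + 1) a') := by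
      rw [← Set.inter_union_distrib_left]
      congr 1
      ext x
      simp only [cyl, Set.mem_ofPred_eq, Set.mem_union]
      constructor
      · intro h
        by_cases hx : x n = a n
        · left; intro i hi
          rcases Nat.lt_succ_iff_lt_or_eq.1 hi with hi' | rfl
          exacts [h i hi', hx]
        · right; intro i hi
          rcases Nat.lt_succ_iff_lt_or_eq.1 hi with hi' | rfl
          · simp [a', hi'.ne, h i hi']
          · simp only [a', Function.update_self]
            exact Bool.eq_not_of_ne hx
      · rintro (h | h) i hi
        · exact h i (by omega)
        · rw [h i (by omega)]; simp [a', hi.ne]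
    have hdis : Disjoint (E ∩ cyl (n + 1) a) (E ∩ cyl (n + 1) a') := by
      rw [Set.disjoint_left]
      rintro x ⟨_, h⟩ ⟨_, h'⟩
      have h1 := h n (by omega)
      have h2 := h' n (by omega)
      rw [h1] at h2
      simp [a'] at h2
    have h1 := ih a
    rw [hun, measure_union hdis (hE.inter (measurableSet_cyl _ _)), heq, ← two_mul] at h1
    rw [pow_succ, ← mul_assoc, ← h1, mul_comm, ← mul_assoc, ENNReal.inv_mul_cancel (by simp) (by simp),
      one_mul]

/-- Ergodicity of the odometer. -/
theorem measure_eq_zero_or_one {E : Set X} (hE : MeasurableSet E)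
    (hi : ∀ x ∈ E, ∀ y ∈ orbit x, y ∈ E) : μ E = 0 ∨ μ E = 1 := by
  -- Independence from cylinders extends to all measurable sets; applied to E itself it gives μ(E) =
  -- μ(E)².
  have h : μ.restrict E = μ E • μ := by
    refine ext_of_generate_finite _ generateFrom_cyl isPiSystem_cyl ?_ (by simp)
    rintro _ ⟨n, a, rfl⟩
    rw [Measure.restrict_apply (measurableSet_cyl n a), Set.inter_comm, measure_inter_cyl hE hi,
      Measure.smul_apply, μ_cyl, smul_eq_mul]
  have h1 : μ E = μ E * μ E := by
    have := congrArg (fun m => m E) h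
    simpa [Measure.restrict_apply hE] using this
  by_cases h0 : μ E = 0
  · exact Or.inl h0
  · right
    have h2 : μ E * 1 = μ E * μ E := by rw [mul_one]; exact h1
    exact ((ENNReal.mul_right_inj h0 (measure_ne_top _ _)).1 h2).symm

/-- The saturation of R is invariant and misses R', so ergodicity applies to it. -/
theorem measure_eq_zero_of_not_connected {R R' : Set X} (hR : MeasurableSet R)
    (h : ∀ x ∈ R, ∀ k : ℤ, (T ^ k) x ∉ R') : μ R = 0 ∨ μ R' = 0 := by
  let S : Set X := ⋃ k : ℤ, (T ^ k) ⁻¹' R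
  have hS : MeasurableSet S := MeasurableSet.iUnion fun k => (measurePreserving_zpow k).measurable hR
  have hSi : ∀ x ∈ S, ∀ y ∈ orbit x, y ∈ S := by
    rintro x hx y ⟨k, rfl⟩
    obtain ⟨l, hl⟩ := Set.mem_iUnion.1 hx
    refine Set.mem_iUnion.2 ⟨l - k, ?_⟩
    rw [Set.mem_preimage, ← Equiv.Perm.mul_apply, ← zpow_add, sub_add_cancel]
    exact hl
  have hRS : R ⊆ S := fun x hx => Set.mem_iUnion.2 ⟨0, by simpa using hx⟩
  rcases measure_eq_zero_or_one hS hSi with h0 | h1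
  · exact Or.inl (measure_mono_null hRS h0)
  · right
    have : R' ⊆ Sᶜ := by
      intro y hy hyS
      obtain ⟨k, hk⟩ := Set.mem_iUnion.1 hyS
      refine h _ hk (-k) ?_
      rw [← Equiv.Perm.mul_apply, ← zpow_add]
      simpa using hy
    exact measure_mono_null this ((prob_compl_eq_zero_iff hS).2 h1)

end Odometer

/-! ### Sets of prescribed measure and exchange of sets by involutions -/

namespace Odometer

theorem measure_singleton_eq_zero (x : X) : μ {x} = 0 := by
  have h : ∀ n : ℕ, μ {x} ≤ (2⁻¹ : ENNReal) ^ n := fun n => by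
    rw [← μ_cyl n x]
    exact measure_mono (by rintro _ rfl i _; rfl)
  have h2 : Filter.Tendsto (fun n : ℕ => (2⁻¹ : ENNReal) ^ n) Filter.atTop (nhds 0) :=
    ENNReal.tendsto_pow_atTop_nhds_zero_of_lt_one (by simp)
  exact le_antisymm (ge_of_tendsto' h2 h) zero_le

/-- Since μ has no atoms, conditioning on A and embedding X in the line gives a continuous
distribution function, which takes the value r / μ(A). -/
theorem exists_subset_measure_eq {A : Set X} (hA : MeasurableSet A) {r : ℝ} (h0 : 0 ≤ r)
    (hr : r ≤ μ.real A) : ∃ B ⊆ A, MeasurableSet B ∧ μ.real B = r := by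
  rcases h0.eq_or_lt with rfl | h0
  · exact ⟨∅, Set.empty_subset _, MeasurableSet.empty, by simp⟩
  rcases hr.eq_or_lt with rfl | hr
  · exact ⟨A, subset_rfl, hA, rfl⟩
  have hA0 : μ A ≠ 0 := by
    intro h
    rw [measureReal_def, h] at hr
    simp at hr
    linarith
  have hAr : 0 < μ.real A := h0.trans hr
  let φ := embeddingReal X
  have hφ : MeasurableEmbedding φ := measurableEmbedding_embeddingReal X
  let P := ProbabilityTheory.cond μ A
  have hPp : IsProbabilityMeasure P := ProbabilityTheory.cond_isProbabilityMeasure hA0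
  let m := P.map φ
  have hmp : IsProbabilityMeasure m := Measure.isProbabilityMeasure_map hφ.measurable.aemeasurable
  have hPφ : ∀ s, MeasurableSet s → m s = (μ A)⁻¹ * μ (A ∩ φ ⁻¹' s) := by
    intro s hs
    rw [Measure.map_apply hφ.measurable hs, ProbabilityTheory.cond_apply hA]
  have hatom : ∀ t : ℝ, m {t} = 0 := by
    intro t
    rw [hPφ _ (measurableSet_singleton t)]
    have hsub : (φ ⁻¹' {t}).Subsingleton := fun x hx y hy => hφ.injective (hx.trans hy.symm)
    have : μ (A ∩ φ ⁻¹' {t}) = 0 := by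
      refine measure_mono_null Set.inter_subset_right ?_
      rcases hsub.eq_empty_or_singleton with h | ⟨x, h⟩
      · rw [h]; simp
      · rw [h]; exact measure_singleton_eq_zero x
    rw [this, mul_zero]
  have hcont : Continuous (ProbabilityTheory.cdf m) := by
    rw [continuous_iff_continuousAt]
    intro t
    rw [(ProbabilityTheory.monotone_cdf m).continuousAt_iff_leftLim_eq_rightLim,
      StieltjesFunction.rightLim_eq]
    have h1 := StieltjesFunction.measure_singleton (ProbabilityTheory.cdf m) t
    rw [ProbabilityTheory.measure_cdf, hatom] at h1
    have h2 := ENNReal.ofReal_eq_zero.1 h1.symm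
    exact le_antisymm ((ProbabilityTheory.monotone_cdf m).leftLim_le le_rfl) (by linarith)
  have hq : r / μ.real A < 1 := (div_lt_one hAr).2 hr
  have hq0 : 0 < r / μ.real A := div_pos h0 hAr
  obtain ⟨t, ht⟩ := mem_range_of_exists_le_of_exists_ge hcont
    ((ProbabilityTheory.tendsto_cdf_atBot m).eventually_lt_const hq0 |>.exists.imp fun _ => le_of_lt)
    ((ProbabilityTheory.tendsto_cdf_atTop m).eventually_const_lt hq |>.exists.imp fun _ => le_of_lt)
  refine ⟨A ∩ φ ⁻¹' Set.Iic t, Set.inter_subset_left, hA.inter (hφ.measurable measurableSet_Iic), ?_⟩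
  rw [ProbabilityTheory.cdf_eq_real, measureReal_def, hPφ _ measurableSet_Iic, ENNReal.toReal_mul,
    ENNReal.toReal_inv] at ht
  have h3 : (μ.real A)⁻¹ * μ.real (A ∩ φ ⁻¹' Set.Iic t) = r / μ.real A := ht
  field_simp at h3
  exact h3

theorem measurable_of_pieces {ι : Type*} [Countable ι] {f : X → X} (S : ι → Set X) (g : ι → X → X)
    (hS : ∀ i, MeasurableSet (S i)) (hg : ∀ i, Measurable (g i)) (hcov : ∀ x, ∃ i, x ∈ S i)
    (hf : ∀ i, ∀ x ∈ S i, f x = g i x) : Measurable f := by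
  intro s hs
  have : f ⁻¹' s = ⋃ i, S i ∩ g i ⁻¹' s := by
    ext x
    simp only [Set.mem_preimage, Set.mem_iUnion, Set.mem_inter_iff]
    constructor
    · intro hx
      obtain ⟨i, hi⟩ := hcov x
      exact ⟨i, hi, by rwa [← hf i x hi]⟩
    · rintro ⟨i, hi, hx⟩
      rwa [hf i x hi]
  rw [this]
  exact MeasurableSet.iUnion fun i => (hS i).inter (hg i hs)

section Exchange

variable (D D' : Set X)

/-- The parts of `D` and `D'` left over after `n` steps of the greedy matching along powers of
`T`. -/
noncomputable def leftover : ℕ → Set X × Set X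
  | 0 => (D, D')
  | n + 1 =>
    let k : ℤ := (Denumerable.eqv ℤ).symm n
    let C := (leftover n).1 ∩ (T ^ k) ⁻¹' (leftover n).2
    ((leftover n).1 \ C, (leftover n).2 \ (T ^ (-k)) ⁻¹' C)

/-- The part of `D` matched at step `n`. -/
noncomputable def matched (n : ℕ) : Set X :=
  (leftover D D' n).1 ∩ (T ^ ((Denumerable.eqv ℤ).symm n : ℤ)) ⁻¹' (leftover D D' n).2

theorem leftover_measurable (hD : MeasurableSet D) (hD' : MeasurableSet D') (n : ℕ) :
    MeasurableSet (leftover D D' n).1 ∧ MeasurableSet (leftover D D' n).2 := by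
  induction n with
  | zero => exact ⟨hD, hD'⟩
  | succ n ih =>
    have hC : MeasurableSet (matched D D' n) :=
      ih.1.inter ((measurePreserving_zpow _).measurable ih.2)
    exact ⟨ih.1.diff hC, ih.2.diff ((measurePreserving_zpow _).measurable hC)⟩

theorem leftover_antitone {m n : ℕ} (h : m ≤ n) :
    (leftover D D' n).1 ⊆ (leftover D D' m).1 ∧ (leftover D D' n).2 ⊆ (leftover D D' m).2 := by
  induction n, h using Nat.le_induction with
  | base => exact ⟨subset_rfl, subset_rfl⟩
  | succ n _ ih =>
    exact ⟨Set.sdiff_subset.trans ih.1, Set.sdiff_subset.trans ih.2⟩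

theorem matched_subset (n : ℕ) : matched D D' n ⊆ D :=
  Set.inter_subset_left.trans (leftover_antitone D D' (Nat.zero_le n)).1

theorem matched_image_mem {n : ℕ} {x : X} (hx : x ∈ matched D D' n) :
    (T ^ ((Denumerable.eqv ℤ).symm n : ℤ)) x ∈ D' :=
  (leftover_antitone D D' (Nat.zero_le n)).2 hx.2

theorem zpow_neg_apply_zpow (k : ℤ) (x : X) : (T ^ (-k)) ((T ^ k) x) = x := by
  rw [zpow_neg]; exact Equiv.symm_apply_apply _ _

theorem zpow_apply_zpow_neg (k : ℤ) (x : X) : (T ^ k) ((T ^ (-k)) x) = x := by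
  rw [zpow_neg]; exact Equiv.apply_symm_apply _ _

theorem matched_inj {m n : ℕ} {x y : X} (hx : x ∈ matched D D' m) (hy : y ∈ matched D D' n)
    (h : x = y ∨ (T ^ ((Denumerable.eqv ℤ).symm m : ℤ)) x =
      (T ^ ((Denumerable.eqv ℤ).symm n : ℤ)) y) : m = n := by
  wlog hmn : m < n generalizing m n x y
  · rcases (not_lt.1 hmn).eq_or_lt with h' | h'
    · exact h'.symm
    · exact (this hy hx (h.imp Eq.symm Eq.symm) h').symm
  exfalso
  have h1 := leftover_antitone D D' (Nat.succ_le_of_lt hmn)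
  rcases h with rfl | h
  · exact (h1.1 hy.1).2 hx
  · have h2 := (h1.2 hy.2).2
    apply h2
    rw [Set.mem_preimage, ← h, zpow_neg_apply_zpow]
    exact hx

open Classical in
/-- The exchange of the matched parts of `D` and `D'`. -/
noncomputable def exchangeFun (x : X) : X :=
  if h : ∃ n, x ∈ matched D D' n then (T ^ ((Denumerable.eqv ℤ).symm h.choose : ℤ)) x
  else if h : ∃ n, (T ^ (-((Denumerable.eqv ℤ).symm n : ℤ))) x ∈ matched D D' n then
    (T ^ (-((Denumerable.eqv ℤ).symm h.choose : ℤ))) x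
  else x

variable {D D'}

theorem exchangeFun_of_mem {n : ℕ} {x : X} (hx : x ∈ matched D D' n) :
    exchangeFun D D' x = (T ^ ((Denumerable.eqv ℤ).symm n : ℤ)) x := by
  have h : ∃ n, x ∈ matched D D' n := ⟨n, hx⟩
  rw [exchangeFun, dif_pos h, matched_inj D D' h.choose_spec hx (Or.inl rfl)]

theorem exchangeFun_of_image (hd : Disjoint D D') {n : ℕ} {x : X} (hx : x ∈ matched D D' n) :
    exchangeFun D D' ((T ^ ((Denumerable.eqv ℤ).symm n : ℤ)) x) = x := by
  have h0 : ¬ ∃ m, (T ^ ((Denumerable.eqv ℤ).symm n : ℤ)) x ∈ matched D D' m := by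
    rintro ⟨m, hm⟩
    exact Set.disjoint_left.1 hd (matched_subset D D' m hm) (matched_image_mem D D' hx)
  have h : ∃ m, (T ^ (-((Denumerable.eqv ℤ).symm m : ℤ)))
      ((T ^ ((Denumerable.eqv ℤ).symm n : ℤ)) x) ∈ matched D D' m :=
    ⟨n, by rw [zpow_neg_apply_zpow]; exact hx⟩
  have h2 : h.choose = n := matched_inj D D' h.choose_spec hx (Or.inr (zpow_apply_zpow_neg _ _))
  rw [exchangeFun, dif_neg h0, dif_pos h, h2, zpow_neg_apply_zpow]

theorem exchangeFun_eq_self {x : X} (h : ¬ ∃ n, x ∈ matched D D' n)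
    (h' : ¬ ∃ n, (T ^ (-((Denumerable.eqv ℤ).symm n : ℤ))) x ∈ matched D D' n) :
    exchangeFun D D' x = x := by
  rw [exchangeFun, dif_neg h, dif_neg h']

theorem exchangeFun_cases (x : X) : (∃ n, x ∈ matched D D' n) ∨
    (∃ n, ∃ y ∈ matched D D' n, x = (T ^ ((Denumerable.eqv ℤ).symm n : ℤ)) y) ∨
    ((¬ ∃ n, x ∈ matched D D' n) ∧
      ¬ ∃ n, (T ^ (-((Denumerable.eqv ℤ).symm n : ℤ))) x ∈ matched D D' n) := by
  by_cases h : ∃ n, x ∈ matched D D' n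
  · exact Or.inl h
  by_cases h' : ∃ n, (T ^ (-((Denumerable.eqv ℤ).symm n : ℤ))) x ∈ matched D D' n
  · obtain ⟨n, hn⟩ := h'
    exact Or.inr (Or.inl ⟨n, _, hn, (zpow_apply_zpow_neg _ _).symm⟩)
  · exact Or.inr (Or.inr ⟨h, h'⟩)

/-- Disjoint sets are exchanged, up to null sets, by an involution of the full group, as far as
their measures permit. -/
theorem exists_exchange (hD : MeasurableSet D) (hD' : MeasurableSet D') (hd : Disjoint D D')
    (hle : μ D ≤ μ D') :
    ∃ θ : borelFullGroup, (∀ x, (θ : Equiv.Perm X) ((θ : Equiv.Perm X) x) = x) ∧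
      (∀ x, x ∉ D → x ∉ D' → (θ : Equiv.Perm X) x = x) ∧
      (∀ᵐ x ∂μ, x ∈ D → (θ : Equiv.Perm X) x ∈ D') := by
  have hM : ∀ n, MeasurableSet (matched D D' n) := fun n =>
    (leftover_measurable D D' hD hD' n).1.inter
      ((measurePreserving_zpow _).measurable (leftover_measurable D D' hD hD' n).2)
  have hinv : Function.Involutive (exchangeFun D D') := by
    intro x
    rcases exchangeFun_cases (D := D) (D' := D') x with ⟨n, hn⟩ | ⟨n, y, hy, rfl⟩ | ⟨h, h'⟩
    · rw [exchangeFun_of_mem hn, exchangeFun_of_image hd hn]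
    · rw [exchangeFun_of_image hd hy, exchangeFun_of_mem hy]
    · rw [exchangeFun_eq_self h h', exchangeFun_eq_self h h']
  have ho : ∀ x, exchangeFun D D' x ∈ orbit x := by
    intro x
    rcases exchangeFun_cases (D := D) (D' := D') x with ⟨n, hn⟩ | ⟨n, y, hy, rfl⟩ | ⟨h, h'⟩
    · rw [exchangeFun_of_mem hn]; exact mem_orbit_zpow _ _
    · rw [exchangeFun_of_image hd hy]; exact mem_orbit_symm (mem_orbit_zpow _ _)
    · rw [exchangeFun_eq_self h h']; exact mem_orbit_self _
  have hme : Measurable (exchangeFun D D') := by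
    refine measurable_of_pieces (ι := Option (ℕ ⊕ ℕ))
      (fun i => match i with
        | none => (⋃ n, matched D D' n)ᶜ ∩
            (⋃ n, (T ^ (-((Denumerable.eqv ℤ).symm n : ℤ))) ⁻¹' matched D D' n)ᶜ
        | some (.inl n) => matched D D' n
        | some (.inr n) => (T ^ (-((Denumerable.eqv ℤ).symm n : ℤ))) ⁻¹' matched D D' n)
      (fun i => match i with
        | none => id
        | some (.inl n) => ⇑(T ^ ((Denumerable.eqv ℤ).symm n : ℤ))
        | some (.inr n) => ⇑(T ^ (-((Denumerable.eqv ℤ).symm n : ℤ)))) ?_ ?_ ?_ ?_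
    · rintro (_ | n | n)
      · exact (MeasurableSet.iUnion hM).compl.inter
          (MeasurableSet.iUnion fun n => (measurePreserving_zpow _).measurable (hM n)).compl
      · exact hM n
      · exact (measurePreserving_zpow _).measurable (hM n)
    · rintro (_ | n | n)
      · exact measurable_id
      · exact (measurePreserving_zpow _).measurable
      · exact (measurePreserving_zpow _).measurable
    · intro x
      rcases exchangeFun_cases (D := D) (D' := D') x with ⟨n, hn⟩ | ⟨n, y, hy, rfl⟩ | ⟨h, h'⟩
      · exact ⟨some (.inl n), hn⟩
      · exact ⟨some (.inr n), by simpa only [Set.mem_preimage, zpow_neg_apply_zpow] using hy⟩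
      · exact ⟨none, by simpa using h, by simpa using h'⟩
    · rintro (_ | n | n) x hx
      · exact exchangeFun_eq_self (by simpa using hx.1) (by simpa using hx.2)
      · exact exchangeFun_of_mem hx
      · have := exchangeFun_of_image hd (D := D) (D' := D') (n := n) hx
        rwa [zpow_apply_zpow_neg] at this
  refine ⟨ofInvolutive _ hme ho hinv, hinv, ?_, ?_⟩
  · intro x hx hx'
    refine exchangeFun_eq_self (fun ⟨n, hn⟩ => hx (matched_subset D D' n hn)) ?_
    rintro ⟨n, hn⟩
    have := matched_image_mem D D' hn
    rw [zpow_apply_zpow_neg] at this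
    exact hx' this
  · let U := ⋃ n, matched D D' n
    have hU : MeasurableSet U := MeasurableSet.iUnion hM
    have hUD : U ⊆ D := Set.iUnion_subset fun n => matched_subset D D' n
    have hUD' : exchangeFun D D' '' U ⊆ D' := by
      rintro _ ⟨x, hx, rfl⟩
      obtain ⟨n, hn⟩ := Set.mem_iUnion.1 hx
      rw [exchangeFun_of_mem hn]
      exact matched_image_mem D D' hn
    have hmeas : μ (exchangeFun D D' '' U) = μ U :=
      measure_image_eq hme ho hU hinv.injective.injOn
    have hUm' : MeasurableSet (exchangeFun D D' '' U) :=
      hU.image_of_measurable_injOn hme hinv.injective.injOn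
    -- Unmatched points of D and D' in one orbit, k apart, would have been matched at the step that
    -- treats the power k. By ergodicity one of the two remainders is then null.
    have hsep : ∀ x ∈ D \ U, ∀ k : ℤ, (T ^ k) x ∉ D' \ exchangeFun D D' '' U := by
      rintro x ⟨hxD, hxU⟩ k ⟨hyD, hyU⟩
      have h1 : ∀ n, x ∈ (leftover D D' n).1 := by
        intro n
        induction n with
        | zero => exact hxD
        | succ n ih => exact ⟨ih, fun h => hxU (Set.mem_iUnion.2 ⟨n, h⟩)⟩
      have h2 : ∀ n, (T ^ k) x ∈ (leftover D D' n).2 := by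
        intro n
        induction n with
        | zero => exact hyD
        | succ n ih =>
          refine ⟨ih, fun h => hyU ⟨_, Set.mem_iUnion.2 ⟨n, h⟩, ?_⟩⟩
          rw [exchangeFun_of_mem h, zpow_apply_zpow_neg]
      refine hxU (Set.mem_iUnion.2 ⟨Denumerable.eqv ℤ k, h1 _, ?_⟩)
      simpa using h2 _
    have hnull : μ (D \ U) = 0 := by
      rcases measure_eq_zero_of_not_connected (hD.diff hU) hsep with h | h
      · exact h
      · rw [measure_sdiff hUD hU.nullMeasurableSet (measure_ne_top _ _)]
        rw [measure_sdiff hUD' hUm'.nullMeasurableSet (measure_ne_top _ _), hmeas] at h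
        exact le_antisymm ((tsub_le_tsub_right hle _).trans h.le) zero_le
    filter_upwards [measure_eq_zero_iff_ae_notMem.1 hnull] with x hx hxD
    have hxU : x ∈ U := by
      by_contra h; exact hx ⟨hxD, h⟩
    exact hUD' ⟨x, hxU, rfl⟩

end Exchange

end Odometer

/-! ### Transport of sets and conjugacy of involutions -/

namespace Odometer

theorem ae_apply (g : borelFullGroup) {p : X → Prop} (h : ∀ᵐ x ∂μ, p x) :
    ∀ᵐ x ∂μ, p ((g : Equiv.Perm X) x) :=
  (measurePreserving_coe g).quasiMeasurePreserving.ae h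

theorem measure_preimage_coe (g : borelFullGroup) {A : Set X} (hA : MeasurableSet A) :
    μ ((g : Equiv.Perm X) ⁻¹' A) = μ A :=
  (measurePreserving_coe g).measure_preimage hA.nullMeasurableSet

theorem coe_mul_apply (g h : borelFullGroup) (x : X) :
    ((g * h : borelFullGroup) : Equiv.Perm X) x = (g : Equiv.Perm X) ((h : Equiv.Perm X) x) := rfl

theorem coe_inv_apply_self (g : borelFullGroup) (x : X) :
    ((g⁻¹ : borelFullGroup) : Equiv.Perm X) ((g : Equiv.Perm X) x) = x :=
  Equiv.symm_apply_apply _ _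

theorem coe_apply_inv_self (g : borelFullGroup) (x : X) :
    (g : Equiv.Perm X) (((g⁻¹ : borelFullGroup) : Equiv.Perm X) x) = x :=
  Equiv.apply_symm_apply _ _

/-- Almost all of D goes into D', and equality of the measures leaves nothing uncovered. -/
theorem exists_exchange_of_eq {D D' : Set X} (hD : MeasurableSet D) (hD' : MeasurableSet D')
    (hd : Disjoint D D') (he : μ D = μ D') :
    ∃ θ : borelFullGroup, (∀ x, (θ : Equiv.Perm X) ((θ : Equiv.Perm X) x) = x) ∧
      (∀ x, x ∉ D → x ∉ D' → (θ : Equiv.Perm X) x = x) ∧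
      (∀ᵐ x ∂μ, (x ∈ D ↔ (θ : Equiv.Perm X) x ∈ D') ∧ (x ∈ D' ↔ (θ : Equiv.Perm X) x ∈ D)) := by
  obtain ⟨θ, h1, h2, h3⟩ := exists_exchange hD hD' hd he.le
  refine ⟨θ, h1, h2, ?_⟩
  have h4 : (D : Set X) =ᵐ[μ] (θ : Equiv.Perm X) ⁻¹' D' := by
    refine ae_eq_of_ae_subset_of_measure_ge h3 ?_ hD.nullMeasurableSet (measure_ne_top _ _)
    rw [measure_preimage_coe θ hD', he]
  have h5 : ∀ᵐ x ∂μ, (x ∈ D ↔ (θ : Equiv.Perm X) x ∈ D') := by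
    filter_upwards [h4] with x hx
    exact iff_of_eq hx
  filter_upwards [h5, ae_apply θ h5] with x hx hx'
  refine ⟨hx, ?_⟩
  rw [hx', h1]

/-- Finitely many disjoint sets can be moved simultaneously onto disjoint sets of the same
measures. -/
theorem exists_transport {ι : Type*} [DecidableEq ι] (Λ : Finset ι) (C D : ι → Set X)
    (hC : ∀ l ∈ Λ, MeasurableSet (C l)) (hD : ∀ l ∈ Λ, MeasurableSet (D l))
    (hCd : ∀ l ∈ Λ, ∀ m ∈ Λ, l ≠ m → Disjoint (C l) (C m))
    (hDd : ∀ l ∈ Λ, ∀ m ∈ Λ, l ≠ m → Disjoint (D l) (D m))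
    (he : ∀ l ∈ Λ, μ (C l) = μ (D l)) :
    ∃ θ : borelFullGroup, ∀ l ∈ Λ, ∀ᵐ x ∂μ, (x ∈ C l ↔ (θ : Equiv.Perm X) x ∈ D l) := by
  induction Λ using Finset.induction_on with
  | empty => exact ⟨1, by simp⟩
  | insert l Λ hl ih =>
    simp only [Finset.forall_mem_insert] at hC hD hCd hDd he
    obtain ⟨θ, hθ⟩ := ih hC.2 hD.2 (fun a ha b hb => (hCd.2 a ha).2 b hb)
      (fun a ha b hb => (hDd.2 a ha).2 b hb) he.2
    let C' : Set X := ((θ⁻¹ : borelFullGroup) : Equiv.Perm X) ⁻¹' C l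
    have hC' : MeasurableSet C' := coe_measurable _ hC.1
    let Q : Set X := ⋃ m ∈ Λ, D m
    have hQ : MeasurableSet Q := Finset.measurableSet_biUnion Λ hD.2
    -- C' is where θ has put C l. Exchanging its part outside the target with the missing part of
    -- the target corrects θ there; removing Q, which meets C' only in a null set, keeps the earlier
    -- targets pointwise fixed.
    let P : Set X := (C' \ D l) \ Q
    let P' : Set X := D l \ C'
    have hP : MeasurableSet P := (hC'.diff hD.1).diff hQ
    have hP' : MeasurableSet P' := hD.1.diff hC'
    have hC'Q : ∀ᵐ y ∂μ, y ∈ C' → y ∉ Q := by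
      have h1 : ∀ᵐ x ∂μ, ∀ m ∈ Λ, (x ∈ C m ↔ (θ : Equiv.Perm X) x ∈ D m) :=
        (ae_ball_iff Λ.countable_toSet).2 hθ
      filter_upwards [ae_apply θ⁻¹ h1] with y hy hyC hyQ
      simp only [Q, Set.mem_iUnion] at hyQ
      obtain ⟨m, hm, hym⟩ := hyQ
      have h2 := hy m hm
      rw [coe_apply_inv_self] at h2
      exact Set.disjoint_left.1 (hCd.1.2 m hm (by rintro rfl; exact hl hm)) hyC (h2.2 hym)
    have hPae : P =ᵐ[μ] (C' \ D l : Set X) := by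
      filter_upwards [hC'Q] with y hy
      apply propext
      exact ⟨fun h => h.1, fun h => ⟨h, hy h.1⟩⟩
    have hμ : μ P = μ P' := by
      rw [measure_congr hPae]
      have h1 : μ C' = μ (D l) := by rw [measure_preimage_coe _ hC.1, he.1]
      have h2 := measure_inter_add_sdiff C' hD.1 (μ := μ)
      have h3 := measure_inter_add_sdiff (D l) hC' (μ := μ)
      rw [Set.inter_comm, ← h1, ← h2] at h3
      rw [Set.inter_comm] at h3
      exact ((ENNReal.add_right_inj (measure_ne_top _ _)).1 h3).symm
    have hPP : Disjoint P P' := by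
      rw [Set.disjoint_left]
      exact fun x hx hx' => hx'.2 hx.1.1
    obtain ⟨η, hη1, hη2, hη3⟩ := exists_exchange_of_eq hP hP' hPP hμ
    refine ⟨η * θ, ?_⟩
    simp only [Finset.forall_mem_insert, coe_mul_apply]
    constructor
    · have key : ∀ᵐ y ∂μ, y ∈ C' ↔ (η : Equiv.Perm X) y ∈ D l := by
        filter_upwards [hη3, hC'Q] with y hy hyQ
        constructor
        · intro hyC
          by_cases hyD : y ∈ D l
          · rw [hη2 y (fun h => h.1.2 hyD) (fun h => h.2 hyC)]; exact hyD
          · exact (hy.1.1 ⟨⟨hyC, hyD⟩, hyQ hyC⟩).1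
        · intro hyD
          by_cases hyC : (η : Equiv.Perm X) y ∈ C'
          · have := hη2 _ (fun h : _ ∈ P => h.1.2 hyD) (fun h : _ ∈ P' => h.2 hyC)
            rw [hη1] at this
            rwa [← this] at hyC
          · exact (hy.1.2 ⟨hyD, hyC⟩).1.1
      filter_upwards [ae_apply θ key] with x hx
      rw [← hx]
      simp only [C', Set.mem_preimage, coe_inv_apply_self]
    · intro m hm
      have hfix : ∀ y ∈ D m, (η : Equiv.Perm X) y = y := by
        intro y hy
        refine hη2 y (fun h => h.2 ?_) (fun h => ?_)
        · simp only [Q, Set.mem_iUnion]; exact ⟨m, hm, hy⟩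
        · exact Set.disjoint_left.1 (hDd.1.2 m hm (by rintro rfl; exact hl hm)) h.1 hy
      filter_upwards [hθ m hm] with x hx
      rw [hx]
      constructor
      · intro h; rw [hfix _ h]; exact h
      · intro h
        have := hfix _ h
        rw [hη1] at this
        rwa [← this] at h

theorem measurableSet_fixSet (s : borelFullGroup) : MeasurableSet (fixSet s) :=
  measurableSet_eq (coe_measurable s) measurable_id

theorem fixMeasure_mk (s : borelFullGroup) : fixMeasure (s : FullGroup) = μ.real (fixSet s) := rfl

theorem exists_mk_eq (g : FullGroup) : ∃ s : borelFullGroup, (s : FullGroup) = g :=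
  QuotientGroup.mk_surjective g

/-- An involution of `[T]` has an involutive representative. -/
theorem exists_involutive_rep {g : FullGroup} (hg : g * g = 1) :
    ∃ s : borelFullGroup, (s : FullGroup) = g ∧
      ∀ x, (s : Equiv.Perm X) ((s : Equiv.Perm X) x) = x := by
  classical
  obtain ⟨s, rfl⟩ := exists_mk_eq g
  have h : ∀ᵐ x ∂μ, (s : Equiv.Perm X) ((s : Equiv.Perm X) x) = x := by
    have h1 : ((s * s : borelFullGroup) : FullGroup) = ((1 : borelFullGroup) : FullGroup) := hg
    exact mk_eq_iff_ae.1 h1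
  obtain ⟨Y, hYm, hYae, hYo, hY⟩ := exists_invariant_conull h
  let f : X → X := fun x => if x ∈ Y then (s : Equiv.Perm X) x else x
  have hfo : ∀ x, f x ∈ orbit x := by
    intro x
    by_cases hx : x ∈ Y
    · simp only [f, if_pos hx]; exact coe_mem_orbit s x
    · simp only [f, if_neg hx]; exact mem_orbit_self x
  have hfi : Function.Involutive f := by
    intro x
    by_cases hx : x ∈ Y
    · have : f x ∈ Y := hYo x hx _ (hfo x)
      simp only [f, if_pos hx] at this ⊢
      rw [if_pos this, hY x hx]
    · simp only [f, if_neg hx]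
  refine ⟨ofInvolutive f (Measurable.ite hYm (coe_measurable s) measurable_id) hfo hfi, ?_, hfi⟩
  rw [mk_eq_iff_ae]
  filter_upwards [hYae] with x hx
  exact if_pos hx

/-- A fundamental domain for an involution. -/
theorem exists_fundamental_domain (s : borelFullGroup)
    (hs : ∀ x, (s : Equiv.Perm X) ((s : Equiv.Perm X) x) = x) :
    ∃ D : Set X, MeasurableSet D ∧ (∀ x ∈ D, (s : Equiv.Perm X) x ∉ D) ∧
      (∀ x, x ∉ fixSet s ↔ x ∈ D ∨ (s : Equiv.Perm X) x ∈ D) ∧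
      2 * μ.real D = 1 - μ.real (fixSet s) := by
  let φ := embeddingReal X
  have hφ : MeasurableEmbedding φ := measurableEmbedding_embeddingReal X
  -- A Borel embedding in the line orders X; D takes the smaller point of every 2-cycle.
  let D : Set X := {x | φ x < φ ((s : Equiv.Perm X) x)}
  have hD : MeasurableSet D :=
    measurableSet_lt hφ.measurable (hφ.measurable.comp (coe_measurable s))
  have h1 : ∀ x ∈ D, (s : Equiv.Perm X) x ∉ D := by
    intro x hx h
    simp only [D, Set.mem_ofPred_eq, hs] at hx h
    exact lt_asymm hx h
  have h2 : ∀ x, x ∉ fixSet s ↔ x ∈ D ∨ (s : Equiv.Perm X) x ∈ D := by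
    intro x
    simp only [D, Set.mem_ofPred_eq, hs, fixSet]
    rw [← ne_iff_lt_or_gt, hφ.injective.ne_iff]
    exact ne_comm
  refine ⟨D, hD, h1, h2, ?_⟩
  have h3 : (fixSet s)ᶜ = D ∪ (s : Equiv.Perm X) ⁻¹' D := by
    ext x; exact h2 x
  have h4 : Disjoint D ((s : Equiv.Perm X) ⁻¹' D) := Set.disjoint_left.2 h1
  have h5 := measureReal_compl (measurableSet_fixSet s) (μ := μ)
  rw [h3, measureReal_union h4 (coe_measurable s hD), measureReal_def μ (_ ⁻¹' D),
    measure_preimage_coe s hD, ← measureReal_def] at h5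
  simp at h5
  linarith

/-- Involutions with supports of the same measure are conjugate in `[T]`. -/
theorem conj_of_involutive (s s' : borelFullGroup)
    (hs : ∀ x, (s : Equiv.Perm X) ((s : Equiv.Perm X) x) = x)
    (hs' : ∀ x, (s' : Equiv.Perm X) ((s' : Equiv.Perm X) x) = x)
    (he : μ.real (fixSet s) = μ.real (fixSet s')) :
    ∃ r : FullGroup, r * (s : FullGroup) * r⁻¹ = (s' : FullGroup) := by
  classical
  obtain ⟨D, hD, hD1, hD2, hD3⟩ := exists_fundamental_domain s hs
  obtain ⟨D', hD', hD1', hD2', hD3'⟩ := exists_fundamental_domain s' hs'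
  have hμ : μ D = μ D' := by
    rw [← measureReal_eq_measureReal_iff]; linarith
  obtain ⟨θ, hθ⟩ := exists_transport (ι := Bool) Finset.univ
    (fun b => if b then D else (s : Equiv.Perm X) ⁻¹' D)
    (fun b => if b then D' else (s' : Equiv.Perm X) ⁻¹' D')
    (by simp [hD, coe_measurable s hD]) (by simp [hD', coe_measurable s' hD'])
    (by
      have : Disjoint D ((s : Equiv.Perm X) ⁻¹' D) := Set.disjoint_left.2 hD1
      simp [this, this.symm])
    (by
      have : Disjoint D' ((s' : Equiv.Perm X) ⁻¹' D') := Set.disjoint_left.2 hD1'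
      simp [this, this.symm])
    (by simp [hμ, measure_preimage_coe s hD, measure_preimage_coe s' hD'])
  have hθ1 := hθ true (Finset.mem_univ _)
  have hθ2 := hθ false (Finset.mem_univ _)
  simp only [if_true, Bool.false_eq_true, if_false, Set.mem_preimage] at hθ1 hθ2
  -- θ matches the fundamental domains and their images as sets only. Keeping θ on D and redefining
  -- it on the other half as s' θ s makes it intertwine s with s'.
  let f : X → X := fun x => if (s : Equiv.Perm X) x ∈ D then
    (s' : Equiv.Perm X) ((θ : Equiv.Perm X) ((s : Equiv.Perm X) x)) else (θ : Equiv.Perm X) x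
  have hfm : Measurable f := Measurable.ite (coe_measurable s hD)
    ((coe_measurable s').comp ((coe_measurable θ).comp (coe_measurable s))) (coe_measurable θ)
  have hfo : ∀ x, f x ∈ orbit x := by
    intro x
    by_cases hx : (s : Equiv.Perm X) x ∈ D
    · simp only [f, if_pos hx]
      exact mem_orbit_trans (coe_mem_orbit s x)
        (mem_orbit_trans (coe_mem_orbit θ _) (coe_mem_orbit s' _))
    · simp only [f, if_neg hx]; exact coe_mem_orbit θ x
  have hae := (hθ1.and hθ2).and (ae_apply s (hθ1.and hθ2))
  obtain ⟨r, hr⟩ := exists_ae_eq hfm hfo (S := {x | _}) hae (by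
    intro x hx y hy hxy
    simp only [Set.mem_ofPred_eq, hs] at hx hy
    by_cases h1 : (s : Equiv.Perm X) x ∈ D <;> by_cases h2 : (s : Equiv.Perm X) y ∈ D
    · simp only [f, if_pos h1, if_pos h2] at hxy
      exact (s : Equiv.Perm X).injective ((θ : Equiv.Perm X).injective
        ((s' : Equiv.Perm X).injective hxy))
    · simp only [f, if_pos h1, if_neg h2] at hxy
      exfalso
      apply h2
      rw [hy.1.2, ← hxy, hs']
      exact hx.2.1.1 h1
    · simp only [f, if_neg h1, if_pos h2] at hxy
      exfalso
      apply h1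
      rw [hx.1.2, hxy, hs']
      exact hy.2.1.1 h2
    · simp only [f, if_neg h1, if_neg h2] at hxy
      exact (θ : Equiv.Perm X).injective hxy)
  refine ⟨r, ?_⟩
  rw [mul_inv_eq_iff_eq_mul, ← QuotientGroup.mk_mul, ← QuotientGroup.mk_mul, mk_eq_iff_ae]
  filter_upwards [hr, ae_apply s hr, hae] with x h1 h2 h3
  rw [coe_mul_apply, coe_mul_apply, h1, h2]
  simp only [f, hs] at h3 ⊢
  by_cases hx : x ∈ D
  · rw [if_pos hx, if_neg (hD1 x hx)]
  · rw [if_neg hx]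
    by_cases hsx : (s : Equiv.Perm X) x ∈ D
    · rw [if_pos hsx, hs']
    · rw [if_neg hsx]
      have h4 : x ∈ fixSet s := by
        by_contra h; rcases (hD2 x).1 h with h | h
        exacts [hx h, hsx h]
      have h5 : (θ : Equiv.Perm X) x ∈ fixSet s' := by
        by_contra h; rcases (hD2' _).1 h with h | h
        exacts [hx (h3.1.1.2 h), hsx (h3.1.2.2 h)]
      rw [show (s : Equiv.Perm X) x = x from h4]
      exact h5.symm

/-- The values of a central positive semidefinite function at involutions depend only on the
measure of the support. -/
theorem exists_involution_value {χ : FullGroup → ℂ} (hχ : IsCentralPD χ) :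
    ∃ F : ℝ → ℝ, ∀ s : FullGroup, s * s = 1 → χ s = (F (fixMeasure s) : ℂ) := by
  classical
  let F : ℝ → ℝ := fun t =>
    if h : ∃ s : FullGroup, s * s = 1 ∧ fixMeasure s = t then (χ h.choose).re else 0
  refine ⟨F, fun s hs => ?_⟩
  have h : ∃ s' : FullGroup, s' * s' = 1 ∧ fixMeasure s' = fixMeasure s := ⟨s, hs, rfl⟩
  have hF : F (fixMeasure s) = (χ h.choose).re := dif_pos h
  have hc : χ h.choose = χ s := by
    obtain ⟨a, ha, ha'⟩ := exists_involutive_rep h.choose_spec.1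
    obtain ⟨b, hb, hb'⟩ := exists_involutive_rep hs
    have hab := h.choose_spec.2
    rw [← ha, ← hb, fixMeasure_mk, fixMeasure_mk] at hab
    obtain ⟨r, hr⟩ := conj_of_involutive a b ha' hb' hab
    rw [← ha, ← hb, ← hr, hχ.central, ← mul_assoc, inv_mul_cancel, one_mul]
  -- An involution is its own inverse, so the value is real.
  have hreal : (starRingEnd ℂ) (χ s) = χ s := by
    rw [← hχ.map_inv, inv_eq_of_mul_eq_one_left hs]
  rw [hF, hc]
  exact ((Complex.conj_eq_iff_re).1 hreal).symm

/-- Every measurable set is the support of an involution. -/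
theorem exists_involution_support {R : Set X} (hR : MeasurableSet R) :
    ∃ r : borelFullGroup, (∀ x, (r : Equiv.Perm X) ((r : Equiv.Perm X) x) = x) ∧
      (∀ x ∉ R, (r : Equiv.Perm X) x = x) ∧ ∀ᵐ x ∂μ, x ∈ R → (r : Equiv.Perm X) x ≠ x := by
  obtain ⟨P, hPR, hP, hPm⟩ := exists_subset_measure_eq hR (r := μ.real R / 2)
    (by positivity) (by have : 0 ≤ μ.real R := measureReal_nonneg; linarith)
  have hd : Disjoint P (R \ P) := Set.disjoint_sdiff_right
  have hm : μ P = μ (R \ P) := by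
    rw [← measureReal_eq_measureReal_iff, measureReal_sdiff hPR hP]
    linarith
  obtain ⟨r, h1, h2, h3⟩ := exists_exchange_of_eq hP (hR.diff hP) hd hm
  refine ⟨r, h1, fun x hx => h2 x (fun h => hx (hPR h)) fun h => hx h.1, ?_⟩
  filter_upwards [h3] with x hx hxR h
  rw [h] at hx
  by_cases hxP : x ∈ P
  · exact (hx.1.1 hxP).2 hxP
  · exact hxP (hx.2.1 ⟨hxR, hxP⟩)

end Odometer

/-! ### Values at permutations from values at involutions -/

section Permutations

open Filter Topology

/-- The elementary abelian group `(ℤ/2)^M`. -/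
abbrev BinVec (M : ℕ) : Type := Fin M → ZMod 2

theorem card_binVec (M : ℕ) : Fintype.card (BinVec M) = 2 ^ M := by simp

variable {W : Type*} [Fintype W] [DecidableEq W]

/-- Two given coordinates agree with probability at most 1 / |V|: such a vector is recovered after
an arbitrary change of its coordinate a, since coordinate b still records it. -/
theorem card_eq_pair_le {V : Type*} [Fintype V] [DecidableEq V] {a b : W} (hab : a ≠ b) :
    (Finset.univ.filter fun u : W → V => u a = u b).card * Fintype.card V ≤
      Fintype.card (W → V) := by
  rw [← Finset.card_univ (α := V), ← Finset.card_product, ← Finset.card_univ]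
  refine Finset.card_le_card_of_injOn (fun p => Function.update p.1 a p.2) (by simp) ?_
  rintro ⟨u, t⟩ h ⟨u', t'⟩ h' he
  simp only [Finset.coe_product, Set.mem_prod, Finset.coe_filter, Finset.mem_univ, true_and,
    Set.mem_ofPred_eq, Finset.coe_univ, Set.mem_univ, and_true] at h h'
  have ht : t = t' := by simpa using congrFun he a
  have hu : ∀ w, w ≠ a → u w = u' w := fun w hw => by
    simpa [Function.update_of_ne hw] using congrFun he w
  refine Prod.ext ?_ ht
  funext w
  by_cases hw : w = a
  · subst hw
    change u w = u' w
    rw [h, h', hu b hab.symm]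
  · exact hu w hw

/-- Constant vectors on a subset. -/
def diagHom (V : Type*) [AddCommGroup V] (J : Finset W) :
    Multiplicative V →* Multiplicative (W → V) where
  toFun a := Multiplicative.ofAdd fun w => if w ∈ J then Multiplicative.toAdd a else 0
  map_one' := by
    rw [← ofAdd_zero]; congr 1; funext w; simp
  map_mul' a b := by
    rw [← ofAdd_add]; congr 1; funext w; by_cases h : w ∈ J <;> simp [h]

variable {G : Type*} [Group G] {φ : G → ℂ}

theorem tendsto_of_norm_sub_le_geometric {f : ℕ → ℂ} {c : ℂ} (B : ℝ)
    (h : ∀ M, 1 ≤ M → ‖f M - c‖ ≤ B * ((2 : ℝ) ^ M)⁻¹) : Tendsto f atTop (𝓝 c) := by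
  rw [tendsto_iff_norm_sub_tendsto_zero]
  have h2 : Tendsto (fun M : ℕ => B * ((2 : ℝ) ^ M)⁻¹) atTop (𝓝 0) := by
    have := (tendsto_pow_atTop_nhds_zero_of_lt_one (r := (2 : ℝ)⁻¹) (by norm_num)
      (by norm_num)).const_mul B
    simpa [inv_pow] using this
  exact squeeze_zero' (Eventually.of_forall fun _ => norm_nonneg _)
    (eventually_atTop.2 ⟨1, h⟩) h2

theorem IsCentralPD.tendsto_tr_of_nm (hφ : IsCentralPD φ) {x : ℕ → MonoidAlgebra ℂ G}
    (h : Tendsto (fun M => nm φ (x M)) atTop (𝓝 0)) : Tendsto (fun M => tr φ (x M)) atTop (𝓝 0) := by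
  rw [tendsto_zero_iff_norm_tendsto_zero]
  refine squeeze_zero (fun _ => norm_nonneg _) (fun M => hφ.norm_tr_le (x M)) ?_
  simpa using h.const_mul (nm φ 1)

theorem tendsto_nm_of_sq {x : ℕ → MonoidAlgebra ℂ G}
    (h : Tendsto (fun M => tr φ (gstar (x M) * x M)) atTop (𝓝 0)) :
    Tendsto (fun M => nm φ (x M)) atTop (𝓝 0) := by
  have h1 : Tendsto (fun M => (tr φ (gstar (x M) * x M)).re) atTop (𝓝 0) := by
    simpa [Function.comp_def] using (Complex.continuous_re.tendsto _).comp h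
  simpa [Function.comp_def, nm] using (Real.continuous_sqrt.tendsto _).comp h1

/-- Once M ≥ 1 there is a nonzero vector, so c |J| is itself a value of φ, and values are bounded by
φ(1). -/
theorem norm_value_sub_le (hφ : IsCentralPD φ)
    (R : ∀ M, Multiplicative (W → BinVec M) →* G) (c : ℕ → ℂ)
    (hval : ∀ M (v : W → BinVec M),
      φ (R M (.ofAdd v)) = c (Finset.univ.filter fun w => v w ≠ 0).card)
    {J : Finset W} {M : ℕ} (hM : 1 ≤ M) (g : G) :
    ‖φ g - c J.card‖ ≤ 2 * (φ 1).re := by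
  have : Nonempty (Fin M) := ⟨⟨0, hM⟩⟩
  obtain ⟨a, ha⟩ := exists_ne (0 : BinVec M)
  have h := hval M fun w => if w ∈ J then a else 0
  have h2 : (Finset.univ.filter fun w => (if w ∈ J then a else 0) ≠ 0) = J := by
    ext w; by_cases hw : w ∈ J <;> simp [hw, ha]
  rw [h2] at h
  rw [← h]
  refine (norm_sub_le _ _).trans ?_
  linarith [hφ.norm_apply_le g, hφ.norm_apply_le (R M (.ofAdd fun w => if w ∈ J then a else 0))]

/-- Multiplying s by a nontrivial constant flip on J gives an involution with support exactly J,
whatever s is inside J; only the trivial flip, of weight 2⁻ᴹ, is exceptional. -/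
theorem tendsto_tr_involution_mul_avg
    (hφ : IsCentralPD φ) (L : Equiv.Perm W →* G)
    (R : ∀ M, Multiplicative (W → BinVec M) →* G) (c : ℕ → ℂ)
    (hval : ∀ M (s : Equiv.Perm W) (v : W → BinVec M), s * s = 1 → v ∘ s = v →
      φ (L s * R M (.ofAdd v)) = c (Finset.univ.filter fun w => s w ≠ w ∨ v w ≠ 0).card)
    (J : Finset W) (s : Equiv.Perm W) (hs : s * s = 1)
    (hsJ : ∀ w ∉ J, s w = w) :
    Tendsto (fun M => tr φ (el (L s) * avg ((R M).comp (diagHom (BinVec M) J)))) atTop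
      (𝓝 (c J.card)) := by
  have hsJ' : ∀ w, s w ∈ J ↔ w ∈ J := by
    intro w
    by_cases hw : w ∈ J
    · simp only [hw, iff_true]
      by_contra h
      have := hsJ _ h
      rw [← Equiv.Perm.mul_apply, hs, Equiv.Perm.one_apply] at this
      exact h (this ▸ hw)
    · rw [hsJ w hw]
  refine tendsto_of_norm_sub_le_geometric (2 * (φ 1).re) fun M hM => ?_
  rw [tr_mul_avg]
  refine (norm_average_sub_le _ _ (2 * (φ 1).re) {1} (fun a => ?_) fun a ha => ?_).trans ?_
  · rw [← el_mul, tr_el]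
    exact norm_value_sub_le hφ R c
      (fun M v => by simpa using hval M 1 v (by simp) rfl) hM _
  · rw [Finset.mem_singleton] at ha
    rw [← el_mul, tr_el, MonoidHom.comp_apply]
    have h := hval M s (fun w => if w ∈ J then Multiplicative.toAdd a else 0) hs (by
      funext w; simp only [Function.comp, hsJ'])
    rw [show diagHom (BinVec M) J a = Multiplicative.ofAdd fun w =>
      if w ∈ J then Multiplicative.toAdd a else 0 from rfl, h]
    congr 2
    ext w
    have : Multiplicative.toAdd a ≠ 0 := by simpa using ha
    by_cases hw : w ∈ J
    · simp [hw, this]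
    · simp [hw, hsJ w hw]
  · simp

/-- For a transposition s and the projection p, ‖(s - 1)p‖² = 2 tr(p) - 2 tr(s p), and both traces
have the same limit. Products of transpositions follow by the triangle inequality. -/
theorem tendsto_nm_sub_one_mul_avg
    (hφ : IsCentralPD φ) (L : Equiv.Perm W →* G)
    (R : ∀ M, Multiplicative (W → BinVec M) →* G) (c : ℕ → ℂ)
    (hval : ∀ M (s : Equiv.Perm W) (v : W → BinVec M), s * s = 1 → v ∘ s = v →
      φ (L s * R M (.ofAdd v)) = c (Finset.univ.filter fun w => s w ≠ w ∨ v w ≠ 0).card)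
    (J : Finset W) (r : Equiv.Perm J) :
    Tendsto (fun M => nm φ ((el (L (Equiv.Perm.ofSubtype r)) - 1) *
      avg ((R M).comp (diagHom (BinVec M) J)))) atTop (𝓝 0) := by
  induction r using Equiv.Perm.swap_induction_on with
  | one =>
    have : nm φ (0 : MonoidAlgebra ℂ G) = 0 := by simp [nm]
    simp [this]
  | swap_mul f x y hxy ih =>
    set p : ℕ → MonoidAlgebra ℂ G := fun M => avg ((R M).comp (diagHom (BinVec M) J)) with hp
    set s := Equiv.Perm.ofSubtype (Equiv.swap x y) with hs_def
    have hs : s * s = 1 := by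
      rw [hs_def, ← map_mul, Equiv.swap_mul_self, map_one]
    have hsJ : ∀ w ∉ J, s w = w := fun w hw => Equiv.Perm.ofSubtype_apply_of_not_mem _ hw
    have h1 : Tendsto (fun M => nm φ ((el (L s) - 1) * p M)) atTop (𝓝 0) := by
      apply tendsto_nm_of_sq
      have hLs : L s * L s = 1 := by rw [← map_mul, hs, map_one]
      have e1 : ∀ M, tr φ (gstar ((el (L s) - 1) * p M) * ((el (L s) - 1) * p M)) =
          2 * tr φ (el (L 1) * p M) - 2 * tr φ (el (L s) * p M) := by
        intro M
        have a1 : gstar (el (L s) - 1) * (el (L s) - 1) = 1 - el (L s) - (el (L s) - 1) := by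
          rw [gstar_sub, gstar_el, gstar_one, inv_eq_of_mul_eq_one_left hLs, sub_mul, mul_sub,
            ← el_mul, hLs, el_one, mul_one, one_mul]
        have a2 : gstar ((el (L s) - 1) * p M) * ((el (L s) - 1) * p M) =
            p M * (gstar (el (L s) - 1) * (el (L s) - 1) * p M) := by
          rw [gstar_mul, show gstar (p M) = p M from gstar_avg _]
          simp only [mul_assoc]
        rw [a2, hφ.tr_mul_comm, mul_assoc, show p M * p M = p M from avg_mul_avg _, a1, sub_mul,
          sub_mul, sub_mul, tr_sub, tr_sub, tr_sub, map_one, el_one, one_mul]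
        ring
      simp only [e1]
      have := ((tendsto_tr_involution_mul_avg hφ L R c hval J 1 (by simp) (by simp)).const_mul
        2).sub ((tendsto_tr_involution_mul_avg hφ L R c hval J s hs hsJ).const_mul 2)
      simpa using this
    refine squeeze_zero (fun _ => hφ.nm_nonneg _) (fun M => ?_) (by simpa using ih.add h1)
    have e2 : (el (L (Equiv.Perm.ofSubtype (Equiv.swap x y * f))) - 1) * p M =
        el (L s) * ((el (L (Equiv.Perm.ofSubtype f)) - 1) * p M) + (el (L s) - 1) * p M := by
      rw [map_mul, map_mul, el_mul]
      noncomm_ring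
    rw [e2]
    refine (hφ.nm_add_le _ _).trans ?_
    rw [hφ.nm_el_mul]

/-- The value at a permutation of a finite set coincides with the value at the involutions with
the same support. -/
theorem value_of_perm
    (hφ : IsCentralPD φ) (L : Equiv.Perm W →* G)
    (R : ∀ M, Multiplicative (W → BinVec M) →* G) (c : ℕ → ℂ)
    (hconj : ∀ M (g : Equiv.Perm W) (v : W → BinVec M),
      L g * R M (.ofAdd v) * (L g)⁻¹ = R M (.ofAdd (v ∘ g.symm)))
    (hval : ∀ M (s : Equiv.Perm W) (v : W → BinVec M), s * s = 1 → v ∘ s = v →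
      φ (L s * R M (.ofAdd v)) = c (Finset.univ.filter fun w => s w ≠ w ∨ v w ≠ 0).card)
    (g : Equiv.Perm W) :
    φ (L g) = c (Finset.univ.filter fun w => g w ≠ w).card := by
  set J : Finset W := Finset.univ.filter fun w => g w ≠ w with hJ
  -- In the limit g acts trivially on p, since g is a product of transpositions of J.
  set p : ℕ → MonoidAlgebra ℂ G := fun M => avg ((R M).comp (diagHom (BinVec M) J)) with hp
  have htp : Tendsto (fun M => tr φ (p M)) atTop (𝓝 (c J.card)) := by
    simpa using tendsto_tr_involution_mul_avg hφ L R c hval J 1 (by simp) (by simp)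
  have htgp : Tendsto (fun M => tr φ (el (L g) * p M)) atTop (𝓝 (c J.card)) := by
    have hgJ : ∀ w, g w ≠ w ↔ w ∈ J := by simp [hJ]
    have hg : ∃ r : Equiv.Perm J, Equiv.Perm.ofSubtype r = g := by
      refine ⟨g.subtypePerm fun w => ?_, Equiv.Perm.ofSubtype_subtypePerm _ fun w hw => (hgJ w).1 hw⟩
      rw [← hgJ, ← hgJ, g.injective.ne_iff]
    obtain ⟨r, hr⟩ := hg
    have h1 := hφ.tendsto_tr_of_nm (tendsto_nm_sub_one_mul_avg hφ L R c hval J r)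
    rw [hr] at h1
    have := h1.add htp
    simp only [sub_mul, tr_sub, one_mul, zero_add] at this
    refine this.congr fun M => ?_
    simp [hp]
  -- The average of all conjugates of g by flips has the same trace as g. The aim is ‖x - p‖ → 0,
  -- which identifies this trace with lim tr(p).
  set x : ℕ → MonoidAlgebra ℂ G := fun M => ((Fintype.card (W → BinVec M) : ℂ)⁻¹) •
    ∑ v : W → BinVec M, el (R M (.ofAdd v) * L g * (R M (.ofAdd v))⁻¹) with hx
  have hcard : ∀ M, (Fintype.card (W → BinVec M) : ℂ) ≠ 0 := fun M => by
    exact_mod_cast Fintype.card_ne_zero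
  have htx : ∀ M, tr φ (x M) = φ (L g) := by
    intro M
    rw [hx, tr_smul, tr_sum]
    have : ∀ v : W → BinVec M, tr φ (el (R M (.ofAdd v) * L g * (R M (.ofAdd v))⁻¹)) = φ (L g) := by
      intro v
      rw [tr_el, hφ.central, ← mul_assoc, inv_mul_cancel, one_mul]
    simp only [this, Finset.sum_const, Finset.card_univ, nsmul_eq_mul]
    rw [← mul_assoc, inv_mul_cancel₀ (hcard M), one_mul]
  have hpx : ∀ M, tr φ (p M * x M) = tr φ (el (L g) * p M) := by
    intro M
    have h1 : ∀ v : W → BinVec M, tr φ (p M * el (R M (.ofAdd v) * L g * (R M (.ofAdd v))⁻¹)) =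
        tr φ (el (L g) * p M) := by
      intro v
      have hcomm : el (R M (.ofAdd v))⁻¹ * p M = p M * el (R M (.ofAdd v))⁻¹ := by
        rw [hp]
        simp only [avg, mul_smul_comm, smul_mul_assoc, Finset.mul_sum, Finset.sum_mul, ← el_mul,
          MonoidHom.comp_apply, ← map_inv, ← map_mul, mul_comm]
      rw [el_mul, el_mul, ← mul_assoc, hφ.tr_mul_comm, ← mul_assoc, ← mul_assoc, hcomm, mul_assoc (p M),
        ← el_mul, inv_mul_cancel, el_one, mul_one, hφ.tr_mul_comm]
    rw [hx, mul_smul_comm, tr_smul, Finset.mul_sum, tr_sum]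
    simp only [h1, Finset.sum_const, Finset.card_univ, nsmul_eq_mul]
    rw [← mul_assoc, inv_mul_cancel₀ (hcard M), one_mul]
  -- The square averages the values at commutators of g with flips, that is at the flips u - u ∘ g.
  have hxx : Tendsto (fun M => tr φ (gstar (x M) * x M)) atTop (𝓝 (c J.card)) := by
    have h1 : ∀ M, tr φ (gstar (x M) * x M) = (Fintype.card (W → BinVec M) : ℂ)⁻¹ *
        ∑ u : W → BinVec M, φ (R M (.ofAdd (u - u ∘ g))) := by
      intro M
      have a1 : ∀ v : W → BinVec M,
          el (R M (.ofAdd v))⁻¹ * gstar (x M) * el (R M (.ofAdd v)) = gstar (x M) := by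
        intro v
        have : gstar (x M) = ((Fintype.card (W → BinVec M) : ℂ)⁻¹) •
            ∑ v : W → BinVec M, el (R M (.ofAdd v) * (L g)⁻¹ * (R M (.ofAdd v))⁻¹) := by
          rw [hx, gstar_smul, gstar_sum]
          simp only [gstar_el, map_inv₀, Complex.conj_natCast, mul_inv_rev, inv_inv, mul_assoc]
        rw [this, mul_smul_comm, smul_mul_assoc, Finset.mul_sum, Finset.sum_mul]
        congr 1
        rw [← Equiv.sum_comp (Equiv.addLeft v)]
        refine Finset.sum_congr rfl fun u _ => ?_
        rw [← el_mul, ← el_mul]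
        congr 1
        simp only [Equiv.coe_addLeft, ofAdd_add, map_mul]
        group
      have a2 : ∀ v : W → BinVec M,
          tr φ (gstar (x M) * el (R M (.ofAdd v) * L g * (R M (.ofAdd v))⁻¹)) =
            tr φ (gstar (x M) * el (L g)) := by
        intro v
        rw [el_mul, el_mul, ← mul_assoc, hφ.tr_mul_comm, ← mul_assoc, ← mul_assoc, a1]
      have a3 : tr φ (gstar (x M) * x M) = tr φ (gstar (x M) * el (L g)) := by
        conv_lhs => enter [2, 2]; rw [hx]
        rw [mul_smul_comm, tr_smul, Finset.mul_sum, tr_sum]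
        simp only [a2, Finset.sum_const, Finset.card_univ, nsmul_eq_mul]
        rw [← mul_assoc, inv_mul_cancel₀ (hcard M), one_mul]
      rw [a3, hx, gstar_smul, gstar_sum, smul_mul_assoc, tr_smul, Finset.sum_mul, tr_sum]
      simp only [map_inv₀, Complex.conj_natCast, gstar_el, ← el_mul, tr_el]
      congr 1
      refine Finset.sum_congr rfl fun u _ => ?_
      congr 1
      have := hconj M g⁻¹ u
      rw [map_inv, inv_inv] at this
      have h3 : (L g)⁻¹ * (R M (.ofAdd u))⁻¹ * L g = (R M (.ofAdd (u ∘ g)))⁻¹ := by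
        rw [show u ∘ g = u ∘ (g⁻¹ : Equiv.Perm W).symm from rfl, ← this]; group
      rw [ofAdd_sub, map_div, div_eq_mul_inv, ← h3]
      group
    simp only [h1]
    refine tendsto_of_norm_sub_le_geometric (2 * (φ 1).re * Fintype.card W) fun M hM => ?_
    -- The exceptional u agree at j and g j for some j moved by g; otherwise u - u ∘ g has support
    -- exactly J.
    refine (norm_average_sub_le _ _ (2 * (φ 1).re)
      (J.biUnion fun j => Finset.univ.filter fun u : W → BinVec M => u (g j) = u j)
      (fun a => norm_value_sub_le hφ R c
      (fun M v => by simpa using hval M 1 v (by simp) rfl) hM _) fun u hu => ?_).trans ?_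
    · have h := hval M 1 (u - u ∘ g) (by simp) (by rfl)
      rw [map_one, one_mul] at h
      rw [h]
      congr 2
      ext w
      simp only [Finset.mem_biUnion, Finset.mem_filter, Finset.mem_univ, true_and, not_exists,
        not_and] at hu
      by_cases hw : w ∈ J
      · have := hu w hw
        simp [hw, sub_eq_zero, Ne.symm this]
      · have hgw : g w = w := by simpa [hJ] using hw
        simp [hw, hgw]
    · have hB : 0 ≤ (φ 1).re := (norm_nonneg _).trans (hφ.norm_apply_le 1)
      rw [mul_assoc (2 * (φ 1).re)]
      refine mul_le_mul_of_nonneg_left ?_ (by positivity)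
      rw [div_le_iff₀ (by exact_mod_cast Fintype.card_pos)]
      have h2 : ((J.biUnion fun j => Finset.univ.filter fun u : W → BinVec M => u (g j) = u j).card : ℝ)
          ≤ Fintype.card W * (((2 : ℝ) ^ M)⁻¹ * Fintype.card (W → BinVec M)) := by
        calc _ ≤ ((∑ j ∈ J, (Finset.univ.filter fun u : W → BinVec M => u (g j) = u j).card : ℕ) : ℝ) := by
              exact_mod_cast Finset.card_biUnion_le
          _ ≤ ∑ j ∈ J, ((2 : ℝ) ^ M)⁻¹ * Fintype.card (W → BinVec M) := by
              push_cast
              refine Finset.sum_le_sum fun j hj => ?_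
              rw [inv_mul_eq_div, le_div_iff₀ (by positivity)]
              have := card_eq_pair_le (V := BinVec M) (show g j ≠ j by simpa [hJ] using hj)
              rw [card_binVec] at this
              exact_mod_cast this
          _ ≤ _ := by
              rw [Finset.sum_const, nsmul_eq_mul]
              gcongr
              exact Finset.card_le_univ J
      rwa [mul_assoc]
  have hnm : Tendsto (fun M => nm φ (x M - p M)) atTop (𝓝 0) := by
    apply tendsto_nm_of_sq
    -- All four terms tend to c |J| or its conjugate, so the square tends to 0 once c |J| is known
    -- to be real.
    have e : ∀ M, tr φ (gstar (x M - p M) * (x M - p M)) = tr φ (gstar (x M) * x M) -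
        (starRingEnd ℂ) (tr φ (el (L g) * p M)) - tr φ (el (L g) * p M) + tr φ (p M) := by
      intro M
      have hpp : gstar (p M) = p M := gstar_avg _
      have h1 : tr φ (gstar (x M) * p M) = (starRingEnd ℂ) (tr φ (el (L g) * p M)) := by
        rw [← hpx, ← hφ.tr_gstar, gstar_mul, hpp]
      rw [gstar_sub, sub_mul, mul_sub, mul_sub, tr_sub, tr_sub, tr_sub, h1, hpp, hpx,
        show p M * p M = p M from avg_mul_avg _]
      ring
    have hc : (starRingEnd ℂ) (c J.card) = c J.card := by
      have h2 := hxx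
      have h3 : Tendsto (fun M => (tr φ (gstar (x M) * x M)).im) atTop (𝓝 (c J.card).im) :=
        (Complex.continuous_im.tendsto _).comp h2
      have h4 : ∀ M, (tr φ (gstar (x M) * x M)).im = 0 := fun M => by
        rw [hφ.tr_gstar_mul_self_eq, Complex.ofReal_im]
      simp only [h4] at h3
      exact Complex.conj_eq_iff_im.2 (tendsto_nhds_unique h3 tendsto_const_nhds)
    simp only [e]
    have h5 : Tendsto (fun M => (starRingEnd ℂ) (tr φ (el (L g) * p M))) atTop (𝓝 (c J.card)) := by
      have := (Complex.continuous_conj.tendsto _).comp htgp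
      rwa [hc] at this
    have := ((hxx.sub h5).sub htgp).add htp
    simpa using this
  have hfin := (hφ.tendsto_tr_of_nm hnm).add htp
  simp only [tr_sub, htx, sub_add_cancel, zero_add] at hfin
  exact tendsto_nhds_unique tendsto_const_nhds hfin

end Permutations

/-! ### Word permutations and flips inside the full group -/

namespace Odometer

/-- The word formed by the first `n` coordinates. -/
def pre (n : ℕ) (x : X) : Fin n → Bool := fun i => x i

theorem measurable_pre (n : ℕ) : Measurable (pre n) := by
  unfold pre
  exact measurable_pi_lambda _ fun i => measurable_pi_apply _

/-- The point obtained by replacing the first `n` coordinates by the word `w`. -/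
def putPre (n : ℕ) (w : Fin n → Bool) (x : X) : X := fun i => if h : i < n then w ⟨i, h⟩ else x i

theorem pre_putPre (n : ℕ) (w : Fin n → Bool) (x : X) : pre n (putPre n w x) = w := by
  funext i; simp [pre, putPre]

theorem putPre_putPre (n : ℕ) (w w' : Fin n → Bool) (x : X) :
    putPre n w (putPre n w' x) = putPre n w x := by
  funext i; by_cases h : i < n <;> simp [putPre, h]

theorem putPre_pre (n : ℕ) (x : X) : putPre n (pre n x) x = x := by
  funext i; by_cases h : i < n <;> simp [pre, putPre, h]

theorem measurable_of_pre_coord {n : ℕ} {f : X → X}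
    (h : ∀ i, ∃ (k : ℕ) (u : (Fin n → Bool) → Bool → Bool), ∀ x, f x i = u (pre n x) (x k)) :
    Measurable f := by
  refine measurable_pi_lambda _ fun i => ?_
  obtain ⟨k, u, hu⟩ := h i
  have : (fun x => f x i) = (fun p : (Fin n → Bool) × Bool => u p.1 p.2) ∘
      fun x : X => (pre n x, x k) := funext hu
  rw [this]
  exact (measurable_of_finite _).comp ((measurable_pre n).prodMk (measurable_pi_apply k))

theorem measurable_putPre (n : ℕ) (σ : (Fin n → Bool) → Fin n → Bool) :
    Measurable fun x => putPre n (σ (pre n x)) x := by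
  refine measurable_of_pre_coord (n := n) fun i => ?_
  by_cases h : i < n
  · exact ⟨0, fun w _ => σ w ⟨i, h⟩, fun x => by simp [putPre, h]⟩
  · exact ⟨i, fun _ b => b, fun x => by simp [putPre, h]⟩

theorem putPre_mem_orbit (n : ℕ) (w : Fin n → Bool) (x : X) : putPre n w x ∈ orbit x :=
  mem_orbit_of_tail n fun i hi => by simp [putPre, Nat.not_lt.2 hi]

/-- Permutations of words of length `n` act on `X` through the first `n` coordinates. -/
def liftBorel (n : ℕ) : Equiv.Perm (Fin n → Bool) →* borelFullGroup where
  toFun σ := ⟨⟨fun x => putPre n (σ (pre n x)) x, fun x => putPre n (σ.symm (pre n x)) x,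
      fun x => by simp [pre_putPre, putPre_putPre, putPre_pre],
      fun x => by simp [pre_putPre, putPre_putPre, putPre_pre]⟩,
    measurable_putPre n σ, measurable_putPre n σ.symm, fun x => putPre_mem_orbit n _ x⟩
  map_one' := by
    ext1; refine Equiv.ext fun x => ?_
    exact putPre_pre n x
  map_mul' σ τ := by
    ext1; refine Equiv.ext fun x => ?_
    change putPre n (σ (τ (pre n x))) x =
      putPre n (σ (pre n (putPre n (τ (pre n x)) x))) (putPre n (τ (pre n x)) x)
    rw [pre_putPre, putPre_putPre]

theorem liftBorel_apply (n : ℕ) (σ : Equiv.Perm (Fin n → Bool)) (x : X) :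
    (liftBorel n σ : Equiv.Perm X) x = putPre n (σ (pre n x)) x := rfl

/-- Flip the coordinates in `[n, n + M)` according to a vector. -/
def flipTail (n M : ℕ) (a : BinVec M) (x : X) : X := fun i =>
  if h : n ≤ i ∧ i < n + M then xor (x i) (decide (a ⟨i - n, by omega⟩ ≠ 0)) else x i

theorem pre_flipTail (n M : ℕ) (a : BinVec M) (x : X) : pre n (flipTail n M a x) = pre n x := by
  funext i
  have : ¬ (n ≤ (i : ℕ) ∧ (i : ℕ) < n + M) := by omega
  simp only [pre, flipTail, dif_neg this]

theorem flipTail_flipTail (n M : ℕ) (a b : BinVec M) (x : X) :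
    flipTail n M a (flipTail n M b x) = flipTail n M (a + b) x := by
  have key : ∀ (u : Bool) (p q : ZMod 2), xor (xor u (decide (q ≠ 0))) (decide (p ≠ 0)) =
      xor u (decide (p + q ≠ 0)) := by decide
  funext i
  by_cases h : n ≤ i ∧ i < n + M
  · simp only [flipTail, dif_pos h, Pi.add_apply, key]
  · simp only [flipTail, dif_neg h]

theorem flipTail_zero (n M : ℕ) (x : X) : flipTail n M 0 x = x := by
  funext i; simp [flipTail]

theorem flipTail_eq_iff (n M : ℕ) (a : BinVec M) (x : X) : flipTail n M a x = x ↔ a = 0 := by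
  refine ⟨fun h => ?_, fun h => by rw [h, flipTail_zero]⟩
  funext j
  have h1 := congrFun h (n + j)
  have h2 : n ≤ n + (j : ℕ) ∧ n + (j : ℕ) < n + M := by omega
  simp only [flipTail, dif_pos h2] at h1
  have key : ∀ (u : Bool) (p : ZMod 2), xor u (decide (p ≠ 0)) = u → p = 0 := by decide
  have h3 := key _ _ h1
  simpa using h3

theorem flipTail_putPre (n M : ℕ) (a : BinVec M) (w : Fin n → Bool) (x : X) :
    flipTail n M a (putPre n w x) = putPre n w (flipTail n M a x) := by
  funext i
  by_cases h : i < n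
  · have : ¬ (n ≤ i ∧ i < n + M) := by omega
    simp [flipTail, putPre, h, this]
  · simp [flipTail, putPre, h]

theorem measurable_flipTail (n M : ℕ) (v : (Fin n → Bool) → BinVec M) :
    Measurable fun x => flipTail n M (v (pre n x)) x := by
  refine measurable_of_pre_coord (n := n) fun i => ?_
  by_cases h : n ≤ i ∧ i < n + M
  · exact ⟨i, fun w b => xor b (decide (v w ⟨i - n, by omega⟩ ≠ 0)), fun x => by
      simp only [flipTail, dif_pos h]⟩
  · exact ⟨i, fun _ b => b, fun x => by simp only [flipTail, dif_neg h]⟩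

theorem flipTail_mem_orbit (n M : ℕ) (a : BinVec M) (x : X) : flipTail n M a x ∈ orbit x :=
  mem_orbit_of_tail (n + M) fun i hi => by
    have : ¬ (n ≤ i ∧ i < n + M) := by omega
    simp only [flipTail, dif_neg this]

theorem binVec_add_self {M : ℕ} (a : BinVec M) : a + a = 0 := by
  funext i; exact CharTwo.add_self_eq_zero _

/-- Flips of the coordinates in `[n, n + M)`, depending on the first `n` coordinates. -/
def flipBorel (n M : ℕ) : Multiplicative ((Fin n → Bool) → BinVec M) →* borelFullGroup where
  toFun v := ofInvolutive (fun x => flipTail n M (v.toAdd (pre n x)) x)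
    (measurable_flipTail n M _) (fun x => flipTail_mem_orbit n M _ x) fun x => by
      simp only [pre_flipTail, flipTail_flipTail, binVec_add_self, flipTail_zero]
  map_one' := by
    ext1; refine Equiv.ext fun x => ?_
    exact flipTail_zero n M x
  map_mul' v v' := by
    ext1; refine Equiv.ext fun x => ?_
    change flipTail n M (v.toAdd (pre n x) + v'.toAdd (pre n x)) x =
      flipTail n M (v.toAdd (pre n (flipTail n M (v'.toAdd (pre n x)) x)))
        (flipTail n M (v'.toAdd (pre n x)) x)
    rw [pre_flipTail, flipTail_flipTail]

theorem flipBorel_apply (n M : ℕ) (v : (Fin n → Bool) → BinVec M) (x : X) :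
    (flipBorel n M (.ofAdd v) : Equiv.Perm X) x = flipTail n M (v (pre n x)) x := rfl

/-- Permutations of words of length `n`, in the full group. -/
def lift (n : ℕ) : Equiv.Perm (Fin n → Bool) →* FullGroup :=
  (QuotientGroup.mk' nullSubgroup).comp (liftBorel n)

/-- Flips of the coordinates in `[n, n + M)`, in the full group. -/
def flip (n M : ℕ) : Multiplicative ((Fin n → Bool) → BinVec M) →* FullGroup :=
  (QuotientGroup.mk' nullSubgroup).comp (flipBorel n M)

theorem lift_eq_mk (n : ℕ) (σ : Equiv.Perm (Fin n → Bool)) :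
    lift n σ = (liftBorel n σ : FullGroup) := rfl

theorem flip_eq_mk (n M : ℕ) (v : Multiplicative ((Fin n → Bool) → BinVec M)) :
    flip n M v = (flipBorel n M v : FullGroup) := rfl

theorem lift_conj_flip (n M : ℕ) (σ : Equiv.Perm (Fin n → Bool))
    (v : (Fin n → Bool) → BinVec M) :
    lift n σ * flip n M (.ofAdd v) * (lift n σ)⁻¹ = flip n M (.ofAdd (v ∘ σ.symm)) := by
  rw [mul_inv_eq_iff_eq_mul, lift_eq_mk, flip_eq_mk, flip_eq_mk, ← QuotientGroup.mk_mul,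
    ← QuotientGroup.mk_mul]
  congr 1
  ext1; refine Equiv.ext fun x => ?_
  rw [coe_mul_apply, coe_mul_apply, liftBorel_apply, liftBorel_apply, flipBorel_apply,
    flipBorel_apply, pre_flipTail, pre_putPre, Function.comp_apply, Equiv.symm_apply_apply,
    flipTail_putPre]

theorem measure_pre_eq (n : ℕ) (w : Fin n → Bool) :
    μ.real {x | pre n x = w} = ((2 : ℝ) ^ n)⁻¹ := by
  have : {x | pre n x = w} = cyl n (putPre n w fun _ => false) := by
    ext x
    simp only [Set.mem_ofPred_eq, cyl]
    constructor
    · rintro rfl i hi; simp [pre, putPre, hi]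
    · intro h; funext i; simpa [pre, putPre] using h i i.2
  rw [this, Measure.real, μ_cyl]
  simp

theorem measurableSet_pre (n : ℕ) (S : Set (Fin n → Bool)) : MeasurableSet {x | pre n x ∈ S} :=
  measurable_pre n (Set.toFinite S).measurableSet

theorem measure_pre_mem (n : ℕ) (S : Finset (Fin n → Bool)) :
    μ.real {x | pre n x ∈ S} = S.card / (2 : ℝ) ^ n := by
  have : {x | pre n x ∈ S} = ⋃ w ∈ S, {x | pre n x = w} := by ext x; simp
  rw [this, measureReal_biUnion_finset]
  · simp [measure_pre_eq, div_eq_mul_inv]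
  · intro a _ b _ hab
    rw [Function.onFun, Set.disjoint_left]
    intro x h1 h2
    exact hab (h1.symm.trans h2)
  · exact fun w _ => measurableSet_pre n {w}

/-- Whether a point is fixed depends only on its initial word w: a nonzero flip moves every point
and does not touch the word. This supplies the counting hypothesis of `value_of_perm`. -/
theorem fixMeasure_lift_mul_flip (n M : ℕ) (σ : Equiv.Perm (Fin n → Bool))
    (v : (Fin n → Bool) → BinVec M) :
    fixMeasure (lift n σ * flip n M (.ofAdd v)) =
      1 - (Finset.univ.filter fun w => σ w ≠ w ∨ v w ≠ 0).card / (2 : ℝ) ^ n := by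
  rw [lift_eq_mk, flip_eq_mk, ← QuotientGroup.mk_mul, fixMeasure_mk]
  have : fixSet (liftBorel n σ * flipBorel n M (.ofAdd v)) =
      {x | pre n x ∈ Finset.univ.filter fun w => σ w ≠ w ∨ v w ≠ 0}ᶜ := by
    ext x
    simp only [fixSet, Set.mem_ofPred_eq, Finset.mem_filter, Finset.mem_univ, true_and,
      Set.mem_compl_iff, not_or, not_not]
    rw [coe_mul_apply, liftBorel_apply, flipBorel_apply, pre_flipTail]
    constructor
    · intro h
      have h1 : σ (pre n x) = pre n x := by
        have := congrArg (pre n) h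
        rwa [pre_putPre] at this
      refine ⟨h1, ?_⟩
      rw [h1, ← flipTail_putPre, putPre_pre] at h
      exact (flipTail_eq_iff _ _ _ _).1 h
    · rintro ⟨h1, h2⟩
      rw [h1, h2, flipTail_zero, putPre_pre]
  rw [this, ← measure_pre_mem]
  exact probReal_compl_eq_one_sub (measurableSet_pre n _)

theorem fixMeasure_lift (n : ℕ) (σ : Equiv.Perm (Fin n → Bool)) :
    fixMeasure (lift n σ) = 1 - (Finset.univ.filter fun w => σ w ≠ w).card / (2 : ℝ) ^ n := by
  have := fixMeasure_lift_mul_flip n 0 σ 0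
  simpa [show Multiplicative.ofAdd (0 : (Fin n → Bool) → BinVec 0) = 1 from rfl] using this

theorem fixMeasure_flip (n M : ℕ) (v : (Fin n → Bool) → BinVec M) :
    fixMeasure (flip n M (.ofAdd v)) =
      1 - (Finset.univ.filter fun w => v w ≠ 0).card / (2 : ℝ) ^ n := by
  have := fixMeasure_lift_mul_flip n M 1 v
  simpa using this

theorem flip_mul_self (n M : ℕ) (v : Multiplicative ((Fin n → Bool) → BinVec M)) :
    flip n M v * flip n M v = 1 := by
  rw [← map_mul, ← map_one (flip n M)]
  congr 1
  funext w
  exact binVec_add_self _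

theorem value_flip {χ : FullGroup → ℂ} {F : ℝ → ℝ}
    (hF : ∀ s : FullGroup, s * s = 1 → χ s = (F (fixMeasure s) : ℂ)) (n M : ℕ)
    (v : (Fin n → Bool) → BinVec M) :
    χ (flip n M (.ofAdd v)) =
      (F (1 - (Finset.univ.filter fun w => v w ≠ 0).card / (2 : ℝ) ^ n) : ℂ) := by
  rw [hF _ (flip_mul_self n M _), fixMeasure_flip]

/-- On the locally finite group of all permutations of initial words the value depends only on the
measure of the fixed point set. -/
theorem value_lift {χ : FullGroup → ℂ} (hχ : IsCentralPD χ) {F : ℝ → ℝ}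
    (hF : ∀ s : FullGroup, s * s = 1 → χ s = (F (fixMeasure s) : ℂ)) (n : ℕ)
    (σ : Equiv.Perm (Fin n → Bool)) : χ (lift n σ) = (F (fixMeasure (lift n σ)) : ℂ) := by
  rw [fixMeasure_lift]
  refine value_of_perm hχ (lift n) (flip n) (fun k => (F (1 - k / (2 : ℝ) ^ n) : ℂ))
    (lift_conj_flip n) (fun M s v hs hv => ?_) σ
  have h : lift n s * flip n M (.ofAdd v) * (lift n s * flip n M (.ofAdd v)) = 1 := by
    have h1 := lift_conj_flip n M s v
    have h2 : (lift n s)⁻¹ = lift n s := inv_eq_of_mul_eq_one_left (by rw [← map_mul, hs, map_one])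
    have h3 : v ∘ s.symm = v := by
      conv_lhs => rw [← hv]
      funext w; simp
    rw [h3, h2] at h1
    rw [← mul_assoc, h1, flip_mul_self]
  rw [hF _ h, fixMeasure_lift_mul_flip]

end Odometer

/-! ### Cutoff projections -/

section Cutoff

open Filter Topology

open scoped ComplexOrder

variable {ι : Type*} [Fintype ι] [DecidableEq ι] {V : Type*} [AddCommGroup V] [Fintype V]

/-- Restriction of vectors to a subset. -/
def restrictHom (V : Type*) [AddCommGroup V] (A : Finset ι) :
    Multiplicative (ι → V) →* Multiplicative (ι → V) where
  toFun v := .ofAdd fun w => if w ∈ A then v.toAdd w else 0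
  map_one' := by
    rw [← ofAdd_zero]; congr 1; funext w; simp
  map_mul' a b := by
    rw [← ofAdd_add]; congr 1; funext w; by_cases h : w ∈ A <;> simp [h]

/-- Independent uniform coordinates make a uniform vector: expanding the product runs over all
vectors supported in A. Coordinates outside A are summed as well and contribute only the identity.
-/
theorem prod_avg_diagHom (A : Finset ι) :
    ∏ j ∈ A, avg (diagHom V {j}) = avg (restrictHom V A) := by
  have h1 : ∏ j ∈ A, avg (diagHom V {j}) =
      ∏ j : ι, ((Fintype.card V : ℂ)⁻¹) •
        ∑ a : V, el (Multiplicative.ofAdd (Pi.single j (if j ∈ A then a else 0) : ι → V)) := by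
    rw [← Finset.prod_subset (Finset.subset_univ A)]
    · refine Finset.prod_congr rfl fun j hj => ?_
      rw [avg, Fintype.card_multiplicative]
      congr 1
      refine Fintype.sum_equiv Multiplicative.toAdd _ _ fun a => ?_
      congr 1
      change Multiplicative.ofAdd _ = Multiplicative.ofAdd _
      congr 1
      funext w
      by_cases hw : w = j
      · subst hw; simp [hj]
      · simp [hw]
    · intro j _ hj
      have : (Fintype.card V : ℂ) ≠ 0 := by exact_mod_cast Fintype.card_ne_zero
      simp only [hj, if_false, Pi.single_zero, ofAdd_zero, el_one, Finset.sum_const,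
        Finset.card_univ]
      rw [← Nat.cast_smul_eq_nsmul ℂ, smul_smul, inv_mul_cancel₀ this, one_smul]
  rw [h1, Finset.prod_smul, Fintype.prod_sum, avg]
  congr 1
  · simp
  · refine Fintype.sum_equiv Multiplicative.ofAdd _ _ fun p => ?_
    have h2 : ∀ f : ι → Multiplicative (ι → V), ∏ i, el (f i) = el (∏ i, f i) := fun f =>
      (map_prod (MonoidAlgebra.of ℂ (Multiplicative (ι → V))) f Finset.univ).symm
    rw [h2]
    congr 1
    rw [← ofAdd_sum]
    change Multiplicative.ofAdd _ = Multiplicative.ofAdd _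
    congr 1
    funext w
    rw [Finset.sum_apply, Finset.sum_eq_single w]
    · simp
    · intro b _ hb; simp [Ne.symm hb]
    · simp

theorem gstar_prod {κ K : Type*} [CommGroup K] (s : Finset κ) (f : κ → MonoidAlgebra ℂ K) :
    gstar (∏ i ∈ s, f i) = ∏ i ∈ s, gstar (f i) := by
  classical
  induction s using Finset.induction with
  | empty => simp
  | insert a s ha ih => rw [Finset.prod_insert ha, gstar_mul, ih, Finset.prod_insert ha, mul_comm]

/-- The projection to the vectors which are invariant under the coordinates outside `S` and have no
invariant part along the coordinates in `S`. -/
noncomputable def cutoff (V : Type*) [AddCommGroup V] [Fintype V] (S : Finset ι) :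
    MonoidAlgebra ℂ (Multiplicative (ι → V)) :=
  (∏ j ∈ S, (1 - avg (diagHom V {j}))) * ∏ j ∈ Sᶜ, avg (diagHom V {j})

theorem gstar_cutoff (S : Finset ι) : gstar (cutoff V S) = cutoff V S := by
  rw [cutoff, gstar_mul, gstar_prod, gstar_prod, mul_comm]
  simp only [gstar_sub, gstar_one, gstar_avg]

theorem cutoff_mul_cutoff (S : Finset ι) : cutoff V S * cutoff V S = cutoff V S := by
  rw [cutoff, mul_mul_mul_comm, ← Finset.prod_mul_distrib, ← Finset.prod_mul_distrib]
  simp only [avg_mul_avg, mul_sub, sub_mul, mul_one, one_mul, sub_self, sub_zero]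

/-- Inclusion-exclusion, from expanding the factors 1 - avg. -/
theorem cutoff_eq_sum (S : Finset ι) :
    cutoff V S = ∑ B ∈ S.powerset, (-1 : ℂ) ^ B.card • avg (restrictHom V (B ∪ Sᶜ)) := by
  have h : ∀ j : ι, 1 - avg (diagHom V {j}) = -avg (diagHom V {j}) + 1 := fun j => by ring
  simp only [cutoff, h]
  rw [Finset.prod_add, Finset.sum_mul]
  refine Finset.sum_congr rfl fun B hB => ?_
  have hd : Disjoint B Sᶜ := by
    rw [Finset.mem_powerset] at hB
    exact Finset.disjoint_left.2 fun x hx h => Finset.mem_compl.1 h (hB hx)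
  rw [Finset.prod_const_one, mul_one, Finset.prod_neg, mul_assoc, ← Finset.prod_union hd,
    prod_avg_diagHom, ← smul_eq_mul]
  rcases Nat.even_or_odd B.card with he | he <;> simp [he.neg_one_pow]

theorem card_apply_eq_zero_le (M : ℕ) (j : ι) :
    (Finset.univ.filter fun u : ι → BinVec M => u j = 0).card * 2 ^ M ≤
      Fintype.card (ι → BinVec M) := by
  rw [← card_binVec, ← Finset.card_univ (α := BinVec M), ← Finset.card_product, ← Finset.card_univ]
  refine Finset.card_le_card_of_injOn (fun p => Function.update p.1 j p.2) (by simp) ?_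
  rintro ⟨u, t⟩ h ⟨u', t'⟩ h' he
  simp only [Finset.coe_product, Set.mem_prod, Finset.coe_filter, Finset.mem_univ, true_and,
    Set.mem_ofPred_eq, Finset.coe_univ, Set.mem_univ, and_true] at h h'
  refine Prod.ext ?_ (by simpa using congrFun he j)
  funext w
  by_cases hw : w = j
  · subst hw; exact h.trans h'.symm
  · simpa [Function.update_of_ne hw] using congrFun he w

variable {G : Type*} [Group G] {φ : G → ℂ}

/-- A uniform vector on A has a vanishing coordinate there with probability at most |A| 2⁻ᴹ; all
others have support A. -/
theorem tendsto_tr_avg_restrictHom (hφ : IsCentralPD φ)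
    (R : ∀ M, Multiplicative (ι → BinVec M) →* G) (c : ℕ → ℂ)
    (hval : ∀ M (v : ι → BinVec M),
      φ (R M (.ofAdd v)) = c (Finset.univ.filter fun w => v w ≠ 0).card) (A : Finset ι) :
    Tendsto (fun M => tr (fun k => φ (R M k)) (avg (restrictHom (BinVec M) A))) atTop
      (𝓝 (c A.card)) := by
  refine tendsto_of_norm_sub_le_geometric (2 * (φ 1).re * Fintype.card ι) fun M hM => ?_
  have e : avg (restrictHom (BinVec M) A) = 1 * avg (restrictHom (BinVec M) A) := (one_mul _).symm
  rw [e, tr_mul_avg]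
  simp only [one_mul, tr_el]
  refine (norm_average_sub_le _ _ (2 * (φ 1).re)
    ((A.biUnion fun j => Finset.univ.filter fun u : ι → BinVec M => u j = 0).map
      Multiplicative.ofAdd.toEmbedding)
    (fun a => norm_value_sub_le hφ R c hval hM _) fun u hu => ?_).trans ?_
  · change φ (R M (.ofAdd _)) = _
    rw [hval]
    congr 2
    ext w
    simp only [Finset.mem_map_equiv, Finset.mem_biUnion, Finset.mem_filter, Finset.mem_univ,
      true_and, not_exists, not_and] at hu
    by_cases hw : w ∈ A
    · have := hu w hw
      simp only [Finset.mem_filter, Finset.mem_univ, true_and, hw, if_true, iff_true]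
      exact this
    · simp [hw]
  · have hB : 0 ≤ (φ 1).re := (norm_nonneg _).trans (hφ.norm_apply_le 1)
    rw [mul_assoc (2 * (φ 1).re), Finset.card_map, Fintype.card_multiplicative]
    refine mul_le_mul_of_nonneg_left ?_ (by positivity)
    rw [div_le_iff₀ (by exact_mod_cast Fintype.card_pos), mul_assoc]
    calc ((A.biUnion fun j => Finset.univ.filter fun u : ι → BinVec M => u j = 0).card : ℝ)
        ≤ ((∑ j ∈ A, (Finset.univ.filter fun u : ι → BinVec M => u j = 0).card : ℕ) : ℝ) := by
          exact_mod_cast Finset.card_biUnion_le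
      _ ≤ ∑ j ∈ A, ((2 : ℝ) ^ M)⁻¹ * Fintype.card (ι → BinVec M) := by
          push_cast
          refine Finset.sum_le_sum fun j hj => ?_
          rw [inv_mul_eq_div, le_div_iff₀ (by positivity)]
          exact_mod_cast card_apply_eq_zero_le M j
      _ ≤ _ := by
          rw [Finset.sum_const, nsmul_eq_mul]
          gcongr
          exact Finset.card_le_univ A

theorem tendsto_tr_cutoff (hφ : IsCentralPD φ)
    (R : ∀ M, Multiplicative (ι → BinVec M) →* G) (c : ℕ → ℂ)
    (hval : ∀ M (v : ι → BinVec M),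
      φ (R M (.ofAdd v)) = c (Finset.univ.filter fun w => v w ≠ 0).card) (S : Finset ι) :
    Tendsto (fun M => tr (fun k => φ (R M k)) (cutoff (BinVec M) S)) atTop
      (𝓝 (∑ B ∈ S.powerset, (-1 : ℂ) ^ B.card * c (B ∪ Sᶜ).card)) := by
  simp only [cutoff_eq_sum, tr_sum, tr_smul]
  exact tendsto_finsetSum _ fun B _ => (tendsto_tr_avg_restrictHom hφ R c hval _).const_mul _

/-- The sum is the limit of the traces of projections. -/
theorem sum_powerset_value_nonneg (hφ : IsCentralPD φ)
    (R : ∀ M, Multiplicative (ι → BinVec M) →* G) (c : ℕ → ℂ)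
    (hval : ∀ M (v : ι → BinVec M),
      φ (R M (.ofAdd v)) = c (Finset.univ.filter fun w => v w ≠ 0).card) (S : Finset ι) :
    0 ≤ ∑ B ∈ S.powerset, (-1 : ℂ) ^ B.card * c (B ∪ Sᶜ).card :=
  ge_of_tendsto' (tendsto_tr_cutoff hφ R c hval S) fun M =>
    (hφ.comp_hom (R M)).tr_proj_nonneg (gstar_cutoff S) (cutoff_mul_cutoff S)

end Cutoff

/-! ### Absolutely monotone functions on dyadic rationals -/

section AbsolutelyMonotone

open Filter Topology

/-- Each factor (J - i) / (N - i) is at most J / N. -/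
theorem descFactorial_mul_pow_le {J N : ℕ} (h : J ≤ N) (k : ℕ) :
    J.descFactorial k * N ^ k ≤ N.descFactorial k * J ^ k := by
  induction k with
  | zero => simp
  | succ k ih =>
    rw [Nat.descFactorial_succ, Nat.descFactorial_succ, pow_succ, pow_succ]
    have h2 : (J - k) * N ≤ (N - k) * J := by
      rw [Nat.sub_mul, Nat.sub_mul, Nat.mul_comm J N]
      have := Nat.mul_le_mul_left k h
      omega
    calc _ = ((J - k) * N) * (J.descFactorial k * N ^ k) := by ring
      _ ≤ ((N - k) * J) * (N.descFactorial k * J ^ k) := Nat.mul_le_mul h2 ih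
      _ = _ := by ring

theorem choose_div_choose_le {J N : ℕ} (h : J ≤ N) (hN : 0 < N) (k : ℕ) :
    ((J.choose k : ℝ) / N.choose k) ≤ ((J : ℝ) / N) ^ k := by
  rcases lt_or_ge N k with hk | hk
  · rw [Nat.choose_eq_zero_of_lt hk]; simp; positivity
  have hc : (0 : ℝ) < N.choose k := by exact_mod_cast Nat.choose_pos hk
  rw [div_pow, div_le_div_iff₀ hc (by positivity)]
  have h1 := descFactorial_mul_pow_le h k
  rw [Nat.descFactorial_eq_factorial_mul_choose, Nat.descFactorial_eq_factorial_mul_choose,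
    mul_assoc, mul_assoc] at h1
  have h2 := Nat.le_of_mul_le_mul_left h1 (Nat.factorial_pos k)
  rw [mul_comm ((J : ℝ) ^ k)]
  exact_mod_cast h2

theorem tendsto_choose_div_choose (j n k : ℕ) :
    Tendsto (fun m => ((j * 2 ^ m).choose k : ℝ) / ((2 ^ n * 2 ^ m).choose k : ℝ)) atTop
      (𝓝 (((j : ℝ) / 2 ^ n) ^ k)) := by
  rcases Nat.eq_zero_or_pos j with rfl | hj
  · rcases Nat.eq_zero_or_pos k with rfl | hk
    · simp
    · obtain ⟨k, rfl⟩ := Nat.exists_eq_succ_of_ne_zero hk.ne'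
      simp
  have key : ∀ a : ℕ, 0 < a →
      Tendsto (fun m : ℕ => ((a * 2 ^ m).choose k : ℝ) / ((a * 2 ^ m : ℕ) : ℝ) ^ k) atTop
        (𝓝 ((k.factorial : ℝ)⁻¹)) := by
    intro a ha
    have h1 : Tendsto (fun m : ℕ => a * 2 ^ m) atTop atTop :=
      (tendsto_pow_atTop_atTop_of_one_lt (by norm_num : 1 < 2)).const_mul_atTop' ha
    have h2 : Tendsto (fun N : ℕ => (N.choose k : ℝ) / (N : ℝ) ^ k) atTop
        (𝓝 ((k.factorial : ℝ)⁻¹)) := by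
      have h3 := isEquivalent_choose k
      rw [Asymptotics.isEquivalent_iff_tendsto_one] at h3
      · have := h3.mul_const ((k.factorial : ℝ)⁻¹)
        rw [one_mul] at this
        refine this.congr fun N => ?_
        simp only [Pi.div_apply]
        have : (k.factorial : ℝ) ≠ 0 := by positivity
        field_simp
      · filter_upwards [eventually_gt_atTop 0] with N hN
        positivity
    exact h2.comp h1
  have hk : ((k.factorial : ℝ)⁻¹) ≠ 0 := by positivity
  have := ((key j hj).div (key (2 ^ n) (by positivity)) hk).mul_const (((j : ℝ) / 2 ^ n) ^ k)
  rw [div_self hk, one_mul] at this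
  refine this.congr fun m => ?_
  simp only [Pi.div_apply]
  push_cast
  have hj' : (j : ℝ) ≠ 0 := by positivity
  rw [mul_pow, mul_pow, div_pow]
  field_simp

/-- A function on the dyadic rationals of the unit interval, all of whose iterated differences are
nonnegative, is a power series with nonnegative coefficients on `[0, 1)`. -/
theorem exists_power_series_of_fwdDiff_nonneg {F : ℝ → ℝ} (h1 : F 1 = 1)
    (hF : ∀ n k : ℕ, k ≤ 2 ^ n → 0 ≤ (fwdDiff 1)^[k] (fun j : ℕ => F (j / 2 ^ n)) 0) :
    ∃ c : ℕ → ℝ, (∀ k, 0 ≤ c k) ∧ Summable c ∧ ∑' k, c k ≤ 1 ∧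
      ∀ n j : ℕ, j < 2 ^ n → F (j / 2 ^ n) = ∑' k, c k * ((j : ℝ) / 2 ^ n) ^ k := by
  set a : ℕ → ℕ → ℝ := fun n k => (fwdDiff 1)^[k] (fun j : ℕ => F (j / 2 ^ n)) 0 with ha
  -- With these weights the Newton expansion at j = 2ⁿ reads Σ w n k = F(1) = 1: a probability
  -- distribution in k for each n.
  set w : ℕ → ℕ → ℝ := fun n k => ((2 ^ n).choose k : ℝ) * a n k with hw
  have hnewton : ∀ n j : ℕ, F (j / 2 ^ n) = ∑ k ∈ Finset.range (j + 1), (j.choose k : ℝ) * a n k := by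
    intro n j
    have := shift_eq_sum_fwdDiff_iter 1 (fun j : ℕ => F (j / 2 ^ n)) j 0
    simpa using this
  have hw0 : ∀ n k, 0 ≤ w n k := by
    intro n k
    rcases le_or_gt k (2 ^ n) with hk | hk
    · exact mul_nonneg (Nat.cast_nonneg _) (hF n k hk)
    · simp only [hw]; rw [Nat.choose_eq_zero_of_lt hk]; simp
  have hwsum : ∀ n, ∑ k ∈ Finset.range (2 ^ n + 1), w n k = 1 := by
    intro n
    have := hnewton n (2 ^ n)
    rw [← this]
    simp [h1]
  have hwK : ∀ n K, ∑ k ∈ Finset.range K, w n k ≤ 1 := by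
    intro n K
    have h2 : ∀ k ∉ Finset.range (2 ^ n + 1), w n k = 0 := by
      intro k hk
      rw [Finset.mem_range, not_lt] at hk
      simp only [hw]
      rw [Nat.choose_eq_zero_of_lt (by omega)]; simp
    calc ∑ k ∈ Finset.range K, w n k ≤ ∑ k ∈ Finset.range K ∪ Finset.range (2 ^ n + 1), w n k :=
          Finset.sum_le_sum_of_subset_of_nonneg Finset.subset_union_left fun k _ _ => hw0 n k
      _ = ∑ k ∈ Finset.range (2 ^ n + 1), w n k :=
          (Finset.sum_subset Finset.subset_union_right fun k _ hk => h2 k hk).symm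
      _ = 1 := hwsum n
      _ ≤ 1 := le_rfl
  have hw1 : ∀ n k, w n k ≤ 1 := fun n k =>
    (Finset.single_le_sum (fun i _ => hw0 n i) (Finset.self_mem_range_succ k)).trans (hwK n (k + 1))
  -- A coordinatewise limit exists along a subsequence, but mass may escape to k = ∞; hence only Σ c
  -- ≤ 1.
  obtain ⟨c, hc, ψ, hψ, hlim⟩ := (isCompact_univ_pi fun _ : ℕ => isCompact_Icc (a := (0 : ℝ))
    (b := 1)).tendsto_subseq (x := w) fun n k _ => ⟨hw0 n k, hw1 n k⟩
  rw [tendsto_pi_nhds] at hlim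
  have hc0 : ∀ k, 0 ≤ c k := fun k => (hc k trivial).1
  have hcK : ∀ K, ∑ k ∈ Finset.range K, c k ≤ 1 := fun K =>
    le_of_tendsto' (tendsto_finsetSum _ fun k _ => hlim k) fun m => hwK (ψ m) K
  refine ⟨c, hc0, summable_of_sum_range_le hc0 hcK, Real.tsum_le_of_sum_range_le hc0 hcK, ?_⟩
  intro n j hj
  set t : ℝ := (j : ℝ) / 2 ^ n with ht
  have ht0 : 0 ≤ t := by positivity
  have ht1 : t < 1 := by
    rw [ht, div_lt_one (by positivity)]; exact_mod_cast hj
  -- Rewriting t with denominator 2ᵐ, the Newton expansion becomes Σ w r, with r a ratio of binomial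
  -- coefficients that is at most tᵏ and tends to tᵏ.
  set r : ℕ → ℕ → ℝ := fun m k =>
    ((j * 2 ^ (m - n)).choose k : ℝ) / ((2 ^ n * 2 ^ (m - n)).choose k : ℝ) with hr
  have hval : ∀ m, n ≤ m → F t = ∑' k, w m k * r m k := by
    intro m hm
    have e1 : 2 ^ n * 2 ^ (m - n) = 2 ^ m := by rw [← pow_add, Nat.add_sub_cancel' hm]
    have e2 : t = ((j * 2 ^ (m - n) : ℕ) : ℝ) / 2 ^ m := by
      rw [ht, show (2 : ℝ) ^ m = 2 ^ n * 2 ^ (m - n) by exact_mod_cast e1.symm]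
      push_cast
      rw [mul_div_mul_right _ _ (by positivity)]
    have hJ : j * 2 ^ (m - n) ≤ 2 ^ m := by
      rw [← e1]; exact Nat.mul_le_mul_right _ hj.le
    rw [e2, hnewton, tsum_eq_sum (s := Finset.range (j * 2 ^ (m - n) + 1))]
    · refine Finset.sum_congr rfl fun k hk => ?_
      have hk' : k ≤ 2 ^ m := by rw [Finset.mem_range] at hk; omega
      have : ((2 ^ m).choose k : ℝ) ≠ 0 := by
        exact_mod_cast (Nat.choose_pos hk').ne'
      simp only [hw, hr, e1]
      field_simp
    · intro k hk
      rw [Finset.mem_range, not_lt] at hk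
      simp only [hr]
      rw [Nat.choose_eq_zero_of_lt (by omega : j * 2 ^ (m - n) < k)]
      simp
  have hr0 : ∀ m k, 0 ≤ r m k := fun m k => by positivity
  have hrt : ∀ m k, r m k ≤ t ^ k := by
    intro m k
    refine (choose_div_choose_le (Nat.mul_le_mul_right _ hj.le) (by positivity) k).trans ?_
    rw [ht]
    push_cast
    rw [mul_div_mul_right _ _ (by positivity)]
  -- The dominating series Σ tᵏ converges because t < 1; the escaped mass is invisible here.
  have hlim2 : Tendsto (fun m => ∑' k, w (ψ m) k * r (ψ m) k) atTop (𝓝 (∑' k, c k * t ^ k)) := by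
    refine tendsto_tsum_of_dominated_convergence (bound := fun k => t ^ k)
      (summable_geometric_of_lt_one ht0 ht1) (fun k => ?_) (Eventually.of_forall fun m k => ?_)
    · refine (hlim k).mul ?_
      have h3 : Tendsto (fun m => r m k) atTop (𝓝 (t ^ k)) :=
        (tendsto_choose_div_choose j n k).comp (tendsto_sub_atTop_nat n)
      exact h3.comp hψ.tendsto_atTop
    · rw [Real.norm_of_nonneg (mul_nonneg (hw0 _ _) (hr0 _ _))]
      calc w (ψ m) k * r (ψ m) k ≤ 1 * t ^ k :=
            mul_le_mul (hw1 _ _) (hrt _ _) (hr0 _ _) zero_le_one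
        _ = t ^ k := one_mul _
  have hev : ∀ᶠ m in atTop, F t = ∑' k, w (ψ m) k * r (ψ m) k := by
    filter_upwards [hψ.tendsto_atTop.eventually_ge_atTop n] with m hm
    exact hval _ hm
  exact tendsto_nhds_unique (tendsto_const_nhds.congr' hev) hlim2

end AbsolutelyMonotone

/-! ### The power series of a character on involutions -/

namespace Odometer

theorem fwdDiff_value_nonneg {χ : FullGroup → ℂ} (hχ : IsCentralPD χ) {F : ℝ → ℝ}
    (hF : ∀ s : FullGroup, s * s = 1 → χ s = (F (fixMeasure s) : ℂ)) (n k : ℕ) (hk : k ≤ 2 ^ n) :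
    0 ≤ (fwdDiff 1)^[k] (fun j : ℕ => F (j / 2 ^ n)) 0 := by
  obtain ⟨S, -, hS⟩ := Finset.exists_subset_card_eq
    (s := (Finset.univ : Finset (Fin n → Bool))) (n := k) (by simpa using hk)
  have h := sum_powerset_value_nonneg hχ (flip n) (fun m => (F (1 - m / (2 : ℝ) ^ n) : ℂ))
    (fun M v => value_flip hF n M v) S
  -- A flip with support B ∪ Sᶜ moves |B| + 2ⁿ - k words, so it fixes measure (k - |B|) / 2ⁿ; the
  -- cutoff sum is the k-th difference at 0.
  have h2 : ∀ B ∈ S.powerset, (-1 : ℂ) ^ B.card * (F (1 - (B ∪ Sᶜ).card / (2 : ℝ) ^ n) : ℂ) =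
      (((-1 : ℝ) ^ B.card * F ((k - B.card : ℕ) / 2 ^ n) : ℝ) : ℂ) := by
    intro B hB
    rw [Finset.mem_powerset] at hB
    have hd : Disjoint B Sᶜ := Finset.disjoint_left.2 fun x hx h => Finset.mem_compl.1 h (hB hx)
    have hBk : B.card ≤ k := hS ▸ Finset.card_le_card hB
    rw [Finset.card_union_of_disjoint hd, Finset.card_compl, hS]
    push_cast
    congr 3
    rw [Nat.cast_sub (by simpa using hk), Nat.cast_sub hBk]
    have : (Fintype.card (Fin n → Bool) : ℝ) = 2 ^ n := by simp
    rw [this]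
    field_simp
    ring
  rw [Finset.sum_congr rfl h2, ← Complex.ofReal_sum, Complex.zero_le_real] at h
  rw [Finset.sum_powerset_apply_card (fun m => (-1 : ℝ) ^ m * F ((k - m : ℕ) / 2 ^ n)), hS] at h
  rw [fwdDiff_iter_eq_sum_shift, ← Finset.sum_range_reflect]
  refine h.trans_eq (Finset.sum_congr rfl fun m hm => ?_)
  have hm' : m ≤ k := by rw [Finset.mem_range] at hm; omega
  have e : k + 1 - 1 - m = k - m := by omega
  rw [e, Nat.sub_sub_self hm', Nat.choose_symm hm']
  simp
  ring

/-- The values at involutions with dyadic fixed point measure less than `1` form a power series. -/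
theorem exists_power_series {χ : FullGroup → ℂ} (hχ : IsCentralPD χ) (h1 : χ 1 = 1) {F : ℝ → ℝ}
    (hF : ∀ s : FullGroup, s * s = 1 → χ s = (F (fixMeasure s) : ℂ)) :
    ∃ c : ℕ → ℝ, (∀ k, 0 ≤ c k) ∧ Summable c ∧ ∑' k, c k ≤ 1 ∧
      ∀ n j : ℕ, j < 2 ^ n → F (j / 2 ^ n) = ∑' k, c k * ((j : ℝ) / 2 ^ n) ^ k := by
  refine exists_power_series_of_fwdDiff_nonneg ?_ fun n k hk => fwdDiff_value_nonneg hχ hF n k hk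
  have h2 := hF 1 (by simp)
  have h3 : fixMeasure 1 = 1 := by
    have := fixMeasure_lift 0 1
    simpa using this
  rw [h1, h3] at h2
  exact_mod_cast h2.symm

end Odometer

/-! ### Averaged conjugates of displacing elements -/

section Displacement

open Filter Topology

variable {G : Type*} [Group G] {φ : G → ℂ}

/-- The average of the conjugates of an element under a finite group. -/
noncomputable def conjAvg {K : Type*} [Group K] [Fintype K] (κ : K →* G) (g : G) :
    MonoidAlgebra ℂ G :=
  ((Fintype.card K : ℂ)⁻¹) • ∑ k, el (κ k * g * (κ k)⁻¹)

section Finite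

variable {K : Type*} [Group K] [Fintype K] (κ : K →* G) (g : G)

theorem conjAvg_comm (k : K) : conjAvg κ g * el (κ k) = el (κ k) * conjAvg κ g := by
  rw [conjAvg, mul_smul_comm, smul_mul_assoc, Finset.mul_sum, Finset.sum_mul]
  congr 1
  rw [← Equiv.sum_comp (Equiv.mulLeft k)]
  refine Finset.sum_congr rfl fun u _ => ?_
  rw [← el_mul, ← el_mul]
  congr 1
  simp only [Equiv.coe_mulLeft, map_mul]
  group

theorem gstar_conjAvg : gstar (conjAvg κ g) = conjAvg κ g⁻¹ := by
  rw [conjAvg, gstar_smul, gstar_sum, conjAvg]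
  simp only [gstar_el, map_inv₀, Complex.conj_natCast, mul_inv_rev, inv_inv, mul_assoc]

/-- If y commutes with the subgroup, all conjugates of g have the same trace against y. -/
theorem IsCentralPD.tr_mul_conjAvg (hφ : IsCentralPD φ) {y : MonoidAlgebra ℂ G}
    (hy : ∀ k, y * el (κ k) = el (κ k) * y) : tr φ (y * conjAvg κ g) = tr φ (y * el g) := by
  have h : ∀ k, tr φ (y * el (κ k * g * (κ k)⁻¹)) = tr φ (y * el g) := by
    intro k
    rw [el_mul, el_mul, ← mul_assoc, hφ.tr_mul_comm, ← mul_assoc, ← mul_assoc, mul_assoc _ y, hy,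
      ← mul_assoc (el _), ← el_mul, inv_mul_cancel, el_one, one_mul]
  have hc : (Fintype.card K : ℂ) ≠ 0 := by exact_mod_cast Fintype.card_ne_zero
  rw [conjAvg, mul_smul_comm, tr_smul, Finset.mul_sum, tr_sum]
  simp only [h, Finset.sum_const, Finset.card_univ, nsmul_eq_mul]
  rw [← mul_assoc, inv_mul_cancel₀ hc, one_mul]

theorem avg_mul_conjAvg : avg κ * conjAvg κ g = avg κ * el g * avg κ := by
  rw [conjAvg, mul_smul_comm, Finset.mul_sum]
  have h : ∀ k, avg κ * el (κ k * g * (κ k)⁻¹) = avg κ * el g * el (κ k⁻¹) := by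
    intro k
    rw [el_mul, el_mul, ← mul_assoc, ← mul_assoc, avg_mul_el, map_inv]
  simp only [h]
  conv_rhs => enter [2]; rw [avg]
  rw [mul_smul_comm, Finset.mul_sum]
  congr 1
  exact Equiv.sum_comp (Equiv.inv K) fun k => avg κ * el g * el (κ k)

/-- The averaged conjugate commutes with the projection avg, so the square is a difference of two
traces. The first pairs an element with its own inverse, the second, through avg g avg, runs over
independent pairs. -/
theorem IsCentralPD.tr_sq_sub_avg_mul_conjAvg (hφ : IsCentralPD φ) :
    tr φ (gstar ((1 - avg κ) * conjAvg κ g) * ((1 - avg κ) * conjAvg κ g)) =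
      (Fintype.card K : ℂ)⁻¹ * ∑ k, φ (κ k⁻¹ * (g * κ k * g⁻¹)) -
      (Fintype.card (K × K) : ℂ)⁻¹ * ∑ p : K × K, φ (κ p.1 * (g * κ p.2 * g⁻¹)) := by
  have hcomm : avg κ * conjAvg κ g = conjAvg κ g * avg κ := by
    rw [avg, mul_smul_comm, smul_mul_assoc, Finset.mul_sum, Finset.sum_mul]
    simp only [conjAvg_comm]
  have h1 : gstar ((1 - avg κ) * conjAvg κ g) * ((1 - avg κ) * conjAvg κ g) =
      conjAvg κ g⁻¹ * conjAvg κ g - conjAvg κ g⁻¹ * (avg κ * conjAvg κ g) := by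
    have h2 : (1 - avg κ) * (1 - avg κ) = 1 - avg κ := by
      simp only [avg_mul_avg, mul_sub, sub_mul, mul_one, one_mul, sub_self, sub_zero]
    rw [gstar_mul, gstar_sub, gstar_one, gstar_avg, gstar_conjAvg, mul_assoc, ← mul_assoc (1 - _),
      h2, sub_mul, one_mul, mul_sub]
  have h3 : tr φ (conjAvg κ g⁻¹ * conjAvg κ g) =
      (Fintype.card K : ℂ)⁻¹ * ∑ k, φ (κ k⁻¹ * (g * κ k * g⁻¹)) := by
    rw [hφ.tr_mul_conjAvg κ g (conjAvg_comm κ g⁻¹), hφ.tr_mul_comm, conjAvg, mul_smul_comm, tr_smul,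
      Finset.mul_sum, tr_sum]
    congr 1
    refine Finset.sum_congr rfl fun k _ => ?_
    rw [← el_mul, tr_el, show g * (κ k * g⁻¹ * (κ k)⁻¹) = g * κ k * g⁻¹ * (κ k)⁻¹ by group,
      hφ.central, _root_.map_inv]
  have h4 : tr φ (conjAvg κ g⁻¹ * (avg κ * conjAvg κ g)) =
      (Fintype.card (K × K) : ℂ)⁻¹ * ∑ p : K × K, φ (κ p.1 * (g * κ p.2 * g⁻¹)) := by
    have a1 : tr φ (conjAvg κ g⁻¹ * (avg κ * conjAvg κ g)) =
        tr φ (avg κ * el g * avg κ * el g⁻¹) := by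
      rw [hφ.tr_mul_comm, hφ.tr_mul_conjAvg κ g⁻¹, avg_mul_conjAvg]
      intro k
      rw [mul_assoc, conjAvg_comm, ← mul_assoc, avg_mul_el, ← mul_assoc, el_mul_avg]
    rw [a1]
    simp only [avg, smul_mul_assoc, mul_smul_comm, Finset.sum_mul, Finset.mul_sum, tr_smul, tr_sum,
      ← el_mul, tr_el]
    rw [Fintype.sum_prod_type, Fintype.card_prod]
    push_cast
    rw [mul_inv, Finset.sum_comm]
    simp only [mul_assoc]
  rw [h1, tr_sub, h3, h4]

end Finite

/-- Away from trivial elements of the subgroup all values in both averages are b, and trivial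
elements have vanishing weight, so the two averages cancel in the limit. -/
theorem tendsto_nm_sub_avg_mul_conjAvg (hφ : IsCentralPD φ)
    (κ : ∀ M, Multiplicative (BinVec M) →* G) (g : G) (b : ℂ)
    (h : ∀ M k k', k ≠ 1 → k' ≠ 1 → φ (κ M k * (g * κ M k' * g⁻¹)) = b) :
    Tendsto (fun M => nm φ ((1 - avg (κ M)) * conjAvg (κ M) g)) atTop (𝓝 0) := by
  apply tendsto_nm_of_sq
  simp only [hφ.tr_sq_sub_avg_mul_conjAvg]
  have hb : ∀ M, 1 ≤ M → ∀ x, ‖φ x - b‖ ≤ 2 * (φ 1).re := by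
    intro M hM x
    have : Nonempty (Fin M) := ⟨⟨0, hM⟩⟩
    obtain ⟨a, ha⟩ := exists_ne (1 : Multiplicative (BinVec M))
    rw [← h M a a ha ha]
    refine (norm_sub_le _ _).trans ?_
    linarith [hφ.norm_apply_le x, hφ.norm_apply_le (κ M a * (g * κ M a * g⁻¹))]
  have hB : 0 ≤ (φ 1).re := (norm_nonneg _).trans (hφ.norm_apply_le 1)
  have t1 : Tendsto (fun M => (Fintype.card (Multiplicative (BinVec M)) : ℂ)⁻¹ *
      ∑ k, φ (κ M k⁻¹ * (g * κ M k * g⁻¹))) atTop (𝓝 b) := by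
    refine tendsto_of_norm_sub_le_geometric (2 * (φ 1).re) fun M hM => ?_
    refine (norm_average_sub_le _ _ (2 * (φ 1).re) {1} (fun k => hb M hM _) fun k hk => ?_).trans ?_
    · rw [Finset.mem_singleton] at hk
      exact h M _ k (by simpa using hk) hk
    · simp
  have t2 : Tendsto (fun M => (Fintype.card (Multiplicative (BinVec M) × Multiplicative (BinVec M)) : ℂ)⁻¹ *
      ∑ p : Multiplicative (BinVec M) × Multiplicative (BinVec M),
        φ (κ M p.1 * (g * κ M p.2 * g⁻¹))) atTop (𝓝 b) := by
    -- Of the 4ᴹ pairs, at most 2 · 2ᴹ have a trivial entry.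
    refine tendsto_of_norm_sub_le_geometric (2 * (φ 1).re * 2) fun M hM => ?_
    refine (norm_average_sub_le _ _ (2 * (φ 1).re) ({1} ×ˢ Finset.univ ∪ Finset.univ ×ˢ {1})
      (fun k => hb M hM _) fun k hk => ?_).trans ?_
    · simp only [Finset.mem_union, Finset.mem_product, Finset.mem_singleton, Finset.mem_univ,
        and_true, true_and, not_or] at hk
      exact h M _ _ hk.1 hk.2
    · rw [mul_assoc (2 * (φ 1).re)]
      refine mul_le_mul_of_nonneg_left ?_ (by positivity)
      have h5 : ((({1} ×ˢ Finset.univ ∪ Finset.univ ×ˢ {1} :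
          Finset (Multiplicative (BinVec M) × Multiplicative (BinVec M))).card : ℕ) : ℝ) ≤ 2 * 2 ^ M := by
        have := Finset.card_union_le ({1} ×ˢ Finset.univ :
          Finset (Multiplicative (BinVec M) × Multiplicative (BinVec M))) (Finset.univ ×ˢ {1})
        simp only [Finset.card_product, Finset.card_singleton, Finset.card_univ, one_mul, mul_one,
          Fintype.card_multiplicative, card_binVec] at this
        have h6 : ((({1} ×ˢ Finset.univ ∪ Finset.univ ×ˢ {1} :
          Finset (Multiplicative (BinVec M) × Multiplicative (BinVec M))).card : ℕ) : ℝ) ≤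
            ((2 ^ M + 2 ^ M : ℕ) : ℝ) := by exact_mod_cast this
        push_cast at h6
        linarith
      rw [Fintype.card_prod, Fintype.card_multiplicative, card_binVec]
      push_cast
      rw [div_le_iff₀ (by positivity)]
      refine h5.trans_eq ?_
      field_simp
  simpa using t1.sub t2

end Displacement

section Displacement

open Filter Topology MonoidAlgebra

variable {ι : Type*} [Fintype ι] [DecidableEq ι] {G : Type*} [Group G] {φ : G → ℂ}

theorem map_avg {K K' : Type*} [Group K] [Fintype K] [Group K'] (R : K' →* G) (κ : K →* K') :
    mapDomainRingHom ℂ R (avg κ) = avg (R.comp κ) := by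
  rw [avg, avg, mapDomainRingHom_apply, mapDomain_smul]
  congr 1
  rw [← mapDomainRingHom_apply, map_sum]
  simp only [map_el, MonoidHom.comp_apply]

/-- The full cutoff contains the factor 1 - avg at l, which asymptotically annihilates the average
of the conjugates of g under the flips at l. -/
theorem tendsto_tr_cutoff_mul_el (hφ : IsCentralPD φ)
    (R : ∀ M, Multiplicative (ι → BinVec M) →* G) (l : ι) (g : G) (b : ℂ)
    (h : ∀ M k k', k ≠ 1 → k' ≠ 1 →
      φ (R M (diagHom (BinVec M) {l} k) * (g * R M (diagHom (BinVec M) {l} k') * g⁻¹)) = b) :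
    Tendsto (fun M => tr φ (mapDomainRingHom ℂ (R M) (cutoff (BinVec M) Finset.univ) * el g)) atTop
      (𝓝 0) := by
  have ht := tendsto_nm_sub_avg_mul_conjAvg hφ
    (fun M => (R M).comp (diagHom (BinVec M) {l})) g b h
  rw [tendsto_zero_iff_norm_tendsto_zero]
  refine squeeze_zero (fun _ => norm_nonneg _) (fun M => ?_) (by simpa using ht.const_mul (nm φ 1))
  set κ := (R M).comp (diagHom (BinVec M) {l}) with hκ
  set z : MonoidAlgebra ℂ (Multiplicative (ι → BinVec M)) :=
    ∏ j ∈ Finset.univ.erase l, (1 - avg (diagHom (BinVec M) {j})) with hz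
  have hz1 : gstar z = z := by
    rw [hz, gstar_prod]; simp only [gstar_sub, gstar_one, gstar_avg]
  have hz2 : z * z = z := by
    rw [hz, ← Finset.prod_mul_distrib]
    simp only [avg_mul_avg, mul_sub, sub_mul, mul_one, one_mul, sub_self, sub_zero]
  have hc : cutoff (BinVec M) (Finset.univ : Finset ι) = z * (1 - avg (diagHom (BinVec M) {l})) := by
    rw [cutoff, Finset.compl_univ, Finset.prod_empty, mul_one, hz,
      Finset.prod_erase_mul _ _ (Finset.mem_univ l)]
  set Z := mapDomainRingHom ℂ (R M) z with hZ
  have hZ1 : gstar Z = Z := by rw [hZ, gstar_map, hz1]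
  have hZ2 : Z * Z = Z := by rw [hZ, ← map_mul, hz2]
  -- The cutoff lies in a commutative algebra containing these flips, so g may be replaced by its
  -- averaged conjugate.
  rw [← hφ.tr_mul_conjAvg κ g]
  · rw [hc, map_mul, map_sub, map_one, map_avg, mul_assoc, ← hZ]
    nth_rw 1 [← hZ1]
    refine (hφ.norm_tr_gstar_mul_le _ _).trans ?_
    refine mul_le_mul_of_nonneg_right ?_ (hφ.nm_nonneg _)
    simpa using hφ.nm_mul_le_of_proj hZ1 hZ2 1
  · intro k
    rw [hκ, MonoidHom.comp_apply, ← map_el, ← map_mul, mul_comm, map_mul]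

end Displacement

/-! ### Flips over displaced sets -/

namespace Odometer

theorem fixMeasure_conj (g s : FullGroup) : fixMeasure (g * s * g⁻¹) = fixMeasure s := by
  obtain ⟨g, rfl⟩ := exists_mk_eq g
  obtain ⟨s, rfl⟩ := exists_mk_eq s
  rw [← QuotientGroup.mk_inv, ← QuotientGroup.mk_mul, ← QuotientGroup.mk_mul, fixMeasure_mk,
    fixMeasure_mk, Measure.real, Measure.real, ← measure_preimage_coe g (measurableSet_fixSet _)]
  congr 2
  ext x
  simp only [fixSet, Set.mem_preimage, Set.mem_ofPred_eq, coe_mul_apply, coe_inv_apply_self,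
    EmbeddingLike.apply_eq_iff_eq]

theorem commute_of_disjoint {s t : borelFullGroup}
    (hd : ∀ᵐ x ∂μ, (s : Equiv.Perm X) x = x ∨ (t : Equiv.Perm X) x = x) :
    (s : FullGroup) * t = t * s := by
  rw [← QuotientGroup.mk_mul, ← QuotientGroup.mk_mul, mk_eq_iff_ae]
  filter_upwards [hd, ae_apply s hd, ae_apply t hd] with x h1 h2 h3
  rw [coe_mul_apply, coe_mul_apply]
  rcases h1 with h1 | h1
  · rw [h1]
    rcases h3 with h3 | h3
    · exact h3
    · rw [EmbeddingLike.apply_eq_iff_eq] at h3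
      rw [h3, h1]
  · rw [h1]
    rcases h2 with h2 | h2
    · rw [EmbeddingLike.apply_eq_iff_eq] at h2
      rw [h2, h1]
    · exact h2.symm

theorem fixMeasure_mul_of_disjoint {s t : borelFullGroup}
    (hd : ∀ᵐ x ∂μ, (s : Equiv.Perm X) x = x ∨ (t : Equiv.Perm X) x = x) :
    fixMeasure ((s : FullGroup) * t) = fixMeasure (s : FullGroup) + fixMeasure (t : FullGroup) - 1 := by
  rw [← QuotientGroup.mk_mul, fixMeasure_mk, fixMeasure_mk, fixMeasure_mk]
  have h1 : fixSet (s * t) =ᵐ[μ] (fixSet s ∩ fixSet t : Set X) := by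
    filter_upwards [hd, ae_apply t hd] with x h1 h3
    refine propext ?_
    change (s : Equiv.Perm X) ((t : Equiv.Perm X) x) = x ↔
      (s : Equiv.Perm X) x = x ∧ (t : Equiv.Perm X) x = x
    constructor
    · intro h
      have ht : (t : Equiv.Perm X) x = x := by
        rcases h3 with h3 | h3
        · rwa [h3] at h
        · rwa [EmbeddingLike.apply_eq_iff_eq] at h3
      rw [ht] at h
      exact ⟨h, ht⟩
    · rintro ⟨h, h'⟩
      rw [h', h]
  have h2 : μ.real (fixSet s ∪ fixSet t) = 1 := by
    have : (fixSet s ∪ fixSet t : Set X) =ᵐ[μ] Set.univ := by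
      rw [ae_eq_univ_iff_measure_eq]
      · rw [measure_univ]
        exact (prob_compl_eq_zero_iff ((measurableSet_fixSet s).union (measurableSet_fixSet t))).1 hd
      · exact ((measurableSet_fixSet s).union (measurableSet_fixSet t)).nullMeasurableSet
    rw [measureReal_congr this, probReal_univ]
  rw [measureReal_congr h1]
  have := measureReal_union_add_inter (μ := μ) (s := fixSet s) (measurableSet_fixSet t)
  linarith

/-- Flips attached to finitely many disjoint sets of equal dyadic measure. -/
theorem exists_flips {ι : Type*} [Fintype ι] [DecidableEq ι] (m : ℕ) (e : ι ↪ (Fin m → Bool))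
    (D : ι → Set X) (hD : ∀ l, MeasurableSet (D l)) (hDd : ∀ l l', l ≠ l' → Disjoint (D l) (D l'))
    (hμ : ∀ l, μ.real (D l) = ((2 : ℝ) ^ m)⁻¹) :
    ∃ R : ∀ M, Multiplicative (ι → BinVec M) →* FullGroup,
      (∀ M (v : ι → BinVec M), fixMeasure (R M (.ofAdd v)) =
        1 - (Finset.univ.filter fun l => v l ≠ 0).card / (2 : ℝ) ^ m) ∧
      (∀ M v, R M v * R M v = 1) ∧
      ∀ M (v : ι → BinVec M), ∃ s : borelFullGroup, (s : FullGroup) = R M (.ofAdd v) ∧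
        ∀ᵐ x ∂μ, (∀ l, v l ≠ 0 → x ∉ D l) → (s : Equiv.Perm X) x = x := by
  -- Carry chosen cylinders of length m onto the sets D l; the required flips are the standard ones
  -- conjugated by θ.
  obtain ⟨θ, hθ⟩ := exists_transport Finset.univ (fun l => {x | pre m x = e l}) D
    (fun l _ => measurableSet_pre m {e l}) (fun l _ => hD l)
    (fun l _ l' _ h => Set.disjoint_left.2 fun x hx hx' => h (e.injective (hx.symm.trans hx')))
    (fun l _ l' _ h => hDd l l' h) (fun l _ => by
      rw [← measureReal_eq_measureReal_iff, measure_pre_eq, hμ])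
  let ext : ∀ M, Multiplicative (ι → BinVec M) →* Multiplicative ((Fin m → Bool) → BinVec M) :=
    fun M => AddMonoidHom.toMultiplicative (Function.ExtendByZero.hom (BinVec M) e)
  let R : ∀ M, Multiplicative (ι → BinVec M) →* FullGroup := fun M =>
    (MulAut.conj (θ : FullGroup)).toMonoidHom.comp ((flip m M).comp (ext M))
  have hR : ∀ M (v : ι → BinVec M), R M (.ofAdd v) = (θ : FullGroup) *
      flip m M (.ofAdd (Function.extend e v 0)) * (θ : FullGroup)⁻¹ := fun M v => rfl
  refine ⟨R, fun M v => ?_, fun M v => ?_, fun M v => ?_⟩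
  · rw [hR, fixMeasure_conj, fixMeasure_flip]
    congr 3
    rw [← Finset.card_map e]
    congr 1
    ext w
    simp only [Finset.mem_filter, Finset.mem_univ, true_and, Finset.mem_map]
    by_cases hw : ∃ l, e l = w
    · obtain ⟨l, rfl⟩ := hw
      rw [e.injective.extend_apply]
      simp
    · rw [Function.extend_apply' _ _ _ hw]
      simp only [Pi.zero_apply, ne_eq, not_true_eq_false, false_iff]
      rintro ⟨l, -, h⟩
      exact hw ⟨l, h⟩
  · rw [← map_mul, ← map_one (R M)]
    congr 1
    funext w
    exact binVec_add_self _
  · refine ⟨θ * flipBorel m M (.ofAdd (Function.extend e v 0)) * θ⁻¹, rfl, ?_⟩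
    have h1 : ∀ᵐ x ∂μ, ∀ l, (pre m x = e l ↔ (θ : Equiv.Perm X) x ∈ D l) :=
      ae_all_iff.2 fun l => hθ l (Finset.mem_univ l)
    filter_upwards [ae_apply θ⁻¹ h1] with x hx hv
    rw [coe_mul_apply, coe_mul_apply, flipBorel_apply]
    have h2 : Function.extend e v 0 (pre m (((θ⁻¹ : borelFullGroup) : Equiv.Perm X) x)) = 0 := by
      by_cases hw : ∃ l, e l = pre m (((θ⁻¹ : borelFullGroup) : Equiv.Perm X) x)
      · obtain ⟨l, hl⟩ := hw
        rw [← hl, e.injective.extend_apply]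
        by_contra h
        refine hv l h ?_
        have := (hx l).1 hl.symm
        rwa [coe_apply_inv_self] at this
      · rw [Function.extend_apply' _ _ _ hw]; rfl
    rw [h2, flipTail_zero, coe_apply_inv_self]

/-- Choose greedily: the sets already chosen cannot use up so much of the next U l that less than δ
remains. -/
theorem exists_disjoint_subsets {ι : Type*} [DecidableEq ι] (Λ : Finset ι) (U : ι → Set X)
    (hU : ∀ l ∈ Λ, MeasurableSet (U l)) {δ : ℝ} (hδ : 0 ≤ δ)
    (h : ∀ l ∈ Λ, Λ.card * δ ≤ μ.real (U l)) :
    ∃ D : ι → Set X, (∀ l ∈ Λ, MeasurableSet (D l) ∧ D l ⊆ U l ∧ μ.real (D l) = δ) ∧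
      ∀ l ∈ Λ, ∀ l' ∈ Λ, l ≠ l' → Disjoint (D l) (D l') := by
  induction Λ using Finset.induction_on with
  | empty => exact ⟨U, by simp⟩
  | insert a Λ ha ih =>
    rw [Finset.card_insert_of_notMem ha] at h
    push_cast at h
    simp only [Finset.forall_mem_insert] at hU h
    obtain ⟨D, hD1, hD2⟩ := ih hU.2 fun l hl => by linarith [h.2 l hl]
    set Q : Set X := ⋃ l ∈ Λ, D l with hQ
    have hQm : MeasurableSet Q := Finset.measurableSet_biUnion _ fun l hl => (hD1 l hl).1
    have hQμ : μ.real Q ≤ Λ.card * δ := by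
      refine (measureReal_biUnion_finset_le Λ D).trans_eq ?_
      rw [Finset.sum_congr rfl fun l hl => (hD1 l hl).2.2, Finset.sum_const, nsmul_eq_mul]
    have h3 : δ ≤ μ.real (U a \ Q) := by
      have := le_measureReal_sdiff (μ := μ) (s₁ := U a) (s₂ := Q) (h := measure_ne_top _ _)
      linarith [h.1]
    obtain ⟨B, hB1, hB2, hB3⟩ := exists_subset_measure_eq (hU.1.diff hQm) hδ h3
    have hBQ : ∀ l ∈ Λ, Disjoint B (D l) := fun l hl =>
      Set.disjoint_left.2 fun x hx hx' => (hB1 hx).2 (Set.mem_biUnion hl hx')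
    have hne : ∀ l ∈ Λ, l ≠ a := fun l hl h => ha (h ▸ hl)
    refine ⟨Function.update D a B, ?_, ?_⟩
    · simp only [Finset.forall_mem_insert, Function.update_self]
      refine ⟨⟨hB2, hB1.trans Set.sdiff_subset, hB3⟩, fun l hl => ?_⟩
      rw [Function.update_of_ne (hne l hl)]
      exact hD1 l hl
    · simp only [Finset.forall_mem_insert, Function.update_self]
      refine ⟨⟨fun h => absurd rfl h, fun l hl _ => ?_⟩, fun l hl => ⟨fun _ => ?_, fun l' hl' h => ?_⟩⟩
      · rw [Function.update_of_ne (hne l hl)]; exact hBQ l hl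
      · rw [Function.update_of_ne (hne l hl)]; exact (hBQ l hl).symm
      · rw [Function.update_of_ne (hne l hl), Function.update_of_ne (hne l' hl')]
        exact hD2 l hl l' hl' h

/-- A nontrivial element displaces a set of positive measure. -/
theorem exists_displaced {g : borelFullGroup} (hg : (g : FullGroup) ≠ 1) :
    ∃ U : Set X, MeasurableSet U ∧ 0 < μ.real U ∧ ∀ x ∈ U, (g : Equiv.Perm X) x ∉ U := by
  by_contra! h
  apply hg
  change (g : FullGroup) = ((1 : borelFullGroup) : FullGroup)
  rw [mk_eq_iff_ae]
  -- The set where the i-th digit is b before and not after applying g is disjoint from its image.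
  -- If no displaced set has positive measure, g preserves every digit almost everywhere.
  have h1 : ∀ (i : ℕ) (b : Bool), ∀ᵐ x ∂μ, ¬ (x i = b ∧ (g : Equiv.Perm X) x i ≠ b) := by
    intro i b
    set U : Set X := {x | x i = b ∧ (g : Equiv.Perm X) x i ≠ b} with hU
    have hUm : MeasurableSet U := by
      have e1 : MeasurableSet {x : X | x i = b} :=
        (measurable_pi_apply (X := fun _ : ℕ => Bool) i) (measurableSet_singleton b)
      have e2 : MeasurableSet {x : X | (g : Equiv.Perm X) x i = b} :=
        ((measurable_pi_apply (X := fun _ : ℕ => Bool) i).comp (coe_measurable g)) (measurableSet_singleton b)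
      exact e1.inter e2.compl
    have h2 : ¬ 0 < μ.real U := by
      intro h3
      obtain ⟨x, hx, hx'⟩ := h U hUm h3
      exact hx.2 hx'.1
    have h3 : μ U = 0 := by
      rw [← measureReal_eq_zero_iff]
      exact le_antisymm (not_lt.1 h2) measureReal_nonneg
    exact measure_eq_zero_iff_ae_notMem.1 h3
  have h2 : ∀ᵐ x ∂μ, ∀ i, ∀ b, ¬ (x i = b ∧ (g : Equiv.Perm X) x i ≠ b) :=
    ae_all_iff.2 fun i => ae_all_iff.2 fun b => h1 i b
  filter_upwards [h2] with x hx
  funext i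
  have := hx i (x i)
  simpa using this

end Odometer

/-! ### The delta function at the identity -/

section Delta

open Filter Topology MonoidAlgebra
open scoped ComplexOrder

variable {G : Type*} [Group G] {φ : G → ℂ}

theorem tr_mul_eq_tr (φ : G → ℂ) (y E : MonoidAlgebra ℂ G) :
    tr φ (E * y) = tr (fun g => tr φ (E * el g)) y := by
  induction y using alg_induction with
  | h0 => simp
  | ha x y hx hy => rw [mul_add, tr_add, tr_add, hx, hy]
  | hs g a =>
    have : single g a = a • el g := by simp [el, smul_single]
    rw [tr_single, this, mul_smul_comm, tr_smul]

theorem tr_sub_left (φ ψ : G → ℂ) (y : MonoidAlgebra ℂ G) :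
    tr (fun g => φ g - ψ g) y = tr φ y - tr ψ y := by
  induction y using alg_induction with
  | h0 => simp
  | ha x y hx hy => rw [tr_add, tr_add, tr_add, hx, hy]; ring
  | hs g a => simp only [tr_single]; ring

theorem tr_delta (b : ℂ) [DecidableEq G] (y : MonoidAlgebra ℂ G) :
    tr (fun g => b * if g = 1 then 1 else 0) y = b * y.coeff 1 := by
  induction y using alg_induction with
  | h0 => simp
  | ha x y hx hy => rw [tr_add, hx, hy, coeff_add, Finsupp.add_apply]; ring
  | hs g a =>
    rw [tr_single, coeff_single, Finsupp.single_apply]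
    split_ifs <;> ring

/-- The coefficient is Σ |x_g|². -/
theorem coeff_gstar_mul_self_one_nonneg (x : MonoidAlgebra ℂ G) : 0 ≤ (gstar x * x).coeff 1 := by
  classical
  have h1 : ∀ x y : MonoidAlgebra ℂ G,
      (gstar x * y).coeff 1 = y.coeff.sum fun g a => (starRingEnd ℂ) (x.coeff g) * a := by
    intro x y
    induction y using alg_induction with
    | h0 => simp
    | ha y z hy hz =>
      rw [mul_add, coeff_add, Finsupp.add_apply, hy, hz, coeff_add, Finsupp.sum_add_index'] <;>
        simp [mul_add]
    | hs g a =>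
      rw [coeff_single, Finsupp.sum_single_index (by simp)]
      induction x using alg_induction with
      | h0 => simp
      | ha x y hx hy =>
        rw [gstar_add, add_mul, coeff_add, Finsupp.add_apply, hx, hy, coeff_add, Finsupp.add_apply,
          map_add, add_mul]
      | hs h b =>
        rw [gstar_single, single_mul_single, coeff_single, coeff_single, Finsupp.single_apply,
          Finsupp.single_apply]
        by_cases hgh : h = g
        · simp [hgh]
        · rw [if_neg (by rwa [inv_mul_eq_one]), if_neg hgh]; simp
  rw [h1]
  refine Finset.sum_nonneg fun g _ => ?_
  beta_reduce
  rw [← Complex.normSq_eq_conj_mul_self, Complex.zero_le_real]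
  exact Complex.normSq_nonneg _

theorem tendsto_tr_of_pointwise {ψ : ℕ → G → ℂ} {ψ' : G → ℂ} (y : MonoidAlgebra ℂ G)
    (h : ∀ g ∈ y.coeff.support, Tendsto (fun M => ψ M g) atTop (𝓝 (ψ' g))) :
    Tendsto (fun M => tr (ψ M) y) atTop (𝓝 (tr ψ' y)) :=
  tendsto_finsetSum _ fun g hg => (h g hg).const_mul _

/-- The left side is the squared seminorm of x e, by the trace property. -/
theorem IsCentralPD.tr_proj_mul_le (hφ : IsCentralPD φ) {e : MonoidAlgebra ℂ G} (he : gstar e = e)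
    (hee : e * e = e) (x : MonoidAlgebra ℂ G) :
    tr φ (e * (gstar x * x)) ≤ tr φ (gstar x * x) := by
  have h : tr φ (e * (gstar x * x)) = tr φ (gstar (x * e) * (x * e)) := by
    rw [gstar_mul, he, ← mul_assoc (e * gstar x), hφ.tr_mul_comm _ e, mul_assoc e (gstar x),
      ← mul_assoc e e, hee]
  rw [h, hφ.tr_gstar_mul_self_eq, hφ.tr_gstar_mul_self_eq, Complex.real_le_real]
  have := hφ.nm_mul_le_of_proj he hee x
  have := hφ.nm_nonneg (x * e)
  gcongr

end Delta

/-! ### Splitting off the mass at the identity -/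

namespace Odometer

open Filter Topology MonoidAlgebra
open scoped ComplexOrder

theorem tendsto_power_series {c : ℕ → ℝ} (hc : ∀ k, 0 ≤ c k) (hs : Summable c) {t : ℕ → ℝ}
    (h0 : ∀ᶠ m in atTop, 0 ≤ t m) (h1 : ∀ᶠ m in atTop, t m ≤ 1) (ht : Tendsto t atTop (𝓝 1)) :
    Tendsto (fun m => ∑' k, c k * t m ^ k) atTop (𝓝 (∑' k, c k)) := by
  refine tendsto_tsum_of_dominated_convergence (bound := c) hs (fun k => ?_) ?_
  · simpa using (ht.pow k).const_mul (c k)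
  · filter_upwards [h0, h1] with m hm0 hm1 k
    rw [Real.norm_of_nonneg (mul_nonneg (hc k) (pow_nonneg hm0 k))]
    exact mul_le_of_le_one_right (hc k) (pow_le_one₀ hm0 hm1)

/-- The conjugate of t lives on gD, away from D, so it commutes with s. The product is again an
involution, whose support is the disjoint union of the two supports. -/
theorem value_conj_disjoint {χ : FullGroup → ℂ} {F : ℝ → ℝ}
    (hF : ∀ s : FullGroup, s * s = 1 → χ s = (F (fixMeasure s) : ℂ)) {s t : borelFullGroup}
    (hs : (s : FullGroup) * s = 1) (ht : (t : FullGroup) * t = 1) (g : borelFullGroup) {D : Set X}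
    (hgD : ∀ x ∈ D, (g : Equiv.Perm X) x ∉ D)
    (hsD : ∀ᵐ x ∂μ, x ∉ D → (s : Equiv.Perm X) x = x)
    (htD : ∀ᵐ x ∂μ, x ∉ D → (t : Equiv.Perm X) x = x) :
    χ ((s : FullGroup) * ((g : FullGroup) * t * (g : FullGroup)⁻¹)) =
      (F (fixMeasure (s : FullGroup) + fixMeasure (t : FullGroup) - 1) : ℂ) := by
  have hd : ∀ᵐ x ∂μ, (s : Equiv.Perm X) x = x ∨
      ((g * t * g⁻¹ : borelFullGroup) : Equiv.Perm X) x = x := by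
    filter_upwards [hsD, ae_apply g⁻¹ htD] with x h1 h2
    by_cases hx : x ∈ D
    · right
      rw [coe_mul_apply, coe_mul_apply, h2, coe_apply_inv_self]
      intro h
      apply hgD _ h
      rwa [coe_apply_inv_self]
    · exact Or.inl (h1 hx)
  have e : (g : FullGroup) * t * (g : FullGroup)⁻¹ = ((g * t * g⁻¹ : borelFullGroup) : FullGroup) := rfl
  have ht' : ((g * t * g⁻¹ : borelFullGroup) : FullGroup) * ((g * t * g⁻¹ : borelFullGroup) : FullGroup) = 1 := by
    rw [← e, show (g : FullGroup) * t * (g : FullGroup)⁻¹ * (g * t * (g : FullGroup)⁻¹) =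
      g * (t * t) * (g : FullGroup)⁻¹ by group, ht]
    group
  rw [← fixMeasure_conj (g : FullGroup) (t : FullGroup), e, hF _, fixMeasure_mul_of_disjoint hd]
  have hc := commute_of_disjoint hd
  calc (s : FullGroup) * ((g * t * g⁻¹ : borelFullGroup) : FullGroup) *
        ((s : FullGroup) * ((g * t * g⁻¹ : borelFullGroup) : FullGroup))
      = (s : FullGroup) * (((g * t * g⁻¹ : borelFullGroup) : FullGroup) * s) *
          ((g * t * g⁻¹ : borelFullGroup) : FullGroup) := by simp only [mul_assoc]
    _ = (s * s) * (((g * t * g⁻¹ : borelFullGroup) : FullGroup) *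
          ((g * t * g⁻¹ : borelFullGroup) : FullGroup)) := by rw [← hc]; simp only [mul_assoc]
    _ = 1 := by rw [hs, ht', one_mul]

/-- A lower bound for the trace of a square at scale `2⁻ᵐ`. -/
theorem coeff_one_mul_le {χ : FullGroup → ℂ} (hχ : IsCentralPD χ) {F : ℝ → ℝ}
    (hF : ∀ s : FullGroup, s * s = 1 → χ s = (F (fixMeasure s) : ℂ)) (x : MonoidAlgebra ℂ FullGroup)
    (Λ : Finset FullGroup) (hΛ : ∀ g ∈ (gstar x * x).coeff.support, g ≠ 1 → g ∈ Λ)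
    (h1 : 1 ∉ Λ) :
    ∀ᶠ m : ℕ in atTop, (gstar x * x).coeff 1 *
      ∑ B ∈ (Finset.univ : Finset Λ).powerset,
        (-1 : ℂ) ^ B.card * (F (1 - B.card / (2 : ℝ) ^ m) : ℂ) ≤ tr χ (gstar x * x) := by
  classical
  have hrep : ∀ g : Λ, ∃ s : borelFullGroup, (s : FullGroup) = g := fun g => exists_mk_eq _
  choose rep hrep using hrep
  have hU : ∀ g : Λ, ∃ U : Set X, MeasurableSet U ∧ 0 < μ.real U ∧
      ∀ x ∈ U, (rep g : Equiv.Perm X) x ∉ U := fun g => exists_displaced (by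
        rw [hrep]; exact fun h => h1 (h ▸ g.2))
  choose U hUm hUpos hUd using hU
  have hsmall : ∀ᶠ m : ℕ in atTop, ∀ g : Λ, (Finset.univ : Finset Λ).card * ((2 : ℝ) ^ m)⁻¹ ≤
      μ.real (U g) := by
    rw [eventually_all]
    intro g
    have : Tendsto (fun m : ℕ => (Finset.univ : Finset Λ).card * ((2 : ℝ) ^ m)⁻¹) atTop (𝓝 0) := by
      have := (tendsto_pow_atTop_nhds_zero_of_lt_one (r := (2 : ℝ)⁻¹) (by norm_num)
        (by norm_num)).const_mul ((Finset.univ : Finset Λ).card : ℝ)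
      simpa [inv_pow] using this
    exact (this.eventually_lt_const (hUpos g)).mono fun m h => h.le
  have hcard : ∀ᶠ m : ℕ in atTop, Fintype.card Λ ≤ 2 ^ m :=
    (tendsto_pow_atTop_atTop_of_one_lt (by norm_num : 1 < 2)).eventually_ge_atTop _
  filter_upwards [hsmall, hcard] with m hm hm2
  obtain ⟨D, hD1, hD2⟩ := exists_disjoint_subsets Finset.univ U (fun g _ => hUm g)
    (δ := ((2 : ℝ) ^ m)⁻¹) (by positivity) fun g _ => hm g
  obtain ⟨e⟩ : Nonempty (Λ ↪ (Fin m → Bool)) :=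
    Function.Embedding.nonempty_of_card_le (by simpa using hm2)
  obtain ⟨R, hR1, hR2, hR3⟩ := exists_flips m e D (fun l => (hD1 l (Finset.mem_univ l)).1)
    (fun l l' h => hD2 l (Finset.mem_univ l) l' (Finset.mem_univ l') h)
    (fun l => (hD1 l (Finset.mem_univ l)).2.2)
  -- These projections separate 1 from Λ: the trace against 1 tends to A and against each g in Λ to
  -- 0. The trace against x* x therefore tends to A times its coefficient at 1, and never exceeds
  -- the trace of x* x.
  set E : ℕ → MonoidAlgebra ℂ FullGroup := fun M =>
    mapDomainRingHom ℂ (R M) (cutoff (BinVec M) Finset.univ) with hE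
  have hE1 : ∀ M, gstar (E M) = E M := fun M => by rw [hE]; simp only [gstar_map, gstar_cutoff]
  have hE2 : ∀ M, E M * E M = E M := fun M => by
    rw [hE]; simp only [← map_mul, cutoff_mul_cutoff]
  set A : ℂ := ∑ B ∈ (Finset.univ : Finset Λ).powerset,
        (-1 : ℂ) ^ B.card * (F (1 - B.card / (2 : ℝ) ^ m) : ℂ) with hA
  have hone : Tendsto (fun M => tr χ (E M * el 1)) atTop (𝓝 A) := by
    have := tendsto_tr_cutoff hχ R (fun k => (F (1 - k / (2 : ℝ) ^ m) : ℂ))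
      (fun M v => by rw [hF _ (hR2 M _), hR1]) Finset.univ
    simp only [Finset.compl_univ, Finset.union_empty] at this
    simpa only [hE, el_one, mul_one, tr_map] using this
  have hother : ∀ g : Λ, Tendsto (fun M => tr χ (E M * el (g : FullGroup))) atTop (𝓝 0) := by
    intro g
    refine tendsto_tr_cutoff_mul_el hχ R g g
      -- The constant value at a product of two disjoint flips of support 2⁻ᵐ each.
      (F ((1 - 1 / (2 : ℝ) ^ m) + (1 - 1 / (2 : ℝ) ^ m) - 1) : ℂ) fun M k k' hk hk' => ?_
    have key : ∀ k : Multiplicative (BinVec M), k ≠ 1 → ∃ s : borelFullGroup,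
        (s : FullGroup) = R M (diagHom (BinVec M) {g} k) ∧ (s : FullGroup) * s = 1 ∧
        fixMeasure (s : FullGroup) = 1 - 1 / (2 : ℝ) ^ m ∧
        ∀ᵐ x ∂μ, x ∉ D g → (s : Equiv.Perm X) x = x := by
      intro k hk
      obtain ⟨s, hs1, hs2⟩ := hR3 M fun w => if w ∈ ({g} : Finset Λ) then k.toAdd else 0
      refine ⟨s, hs1, by rw [hs1, hR2], ?_, ?_⟩
      · rw [hs1, hR1]
        have hk2 : k.toAdd ≠ 0 := by simpa using hk
        have : (Finset.univ.filter fun l : Λ => (if l ∈ ({g} : Finset Λ) then k.toAdd else 0) ≠ 0) =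
            {g} := by
          ext l; simp [hk2]
        rw [this]; simp
      · filter_upwards [hs2] with x hx hxD
        refine hx fun l hl => ?_
        have : l = g := by
          by_contra h
          simp [h] at hl
        rwa [this]
    obtain ⟨s, hs1, hs2, hs3, hs4⟩ := key k hk
    obtain ⟨t, ht1, ht2, ht3, ht4⟩ := key k' hk'
    have := value_conj_disjoint hF hs2 ht2 (rep g) (D := D g) (fun x hx h =>
      hUd g x ((hD1 g (Finset.mem_univ g)).2.1 hx) ((hD1 g (Finset.mem_univ g)).2.1 h)) hs4 ht4
    rwa [hs1, ht1, hrep, ← hs1, ← ht1, hs3, ht3, hs1, ht1] at this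
  have hlim : Tendsto (fun M => tr χ (E M * (gstar x * x))) atTop
      (𝓝 (tr (fun g => A * if g = 1 then 1 else 0) (gstar x * x))) := by
    simp only [tr_mul_eq_tr χ (gstar x * x)]
    refine tendsto_tr_of_pointwise _ fun g hg => ?_
    by_cases hg1 : g = 1
    · subst hg1; simpa using hone
    · simpa [hg1] using hother ⟨g, hΛ g hg hg1⟩
  rw [tr_delta, mul_comm] at hlim
  exact le_of_tendsto' hlim fun M => hχ.tr_proj_mul_le (hE1 M) (hE2 M) x

open scoped Classical in
/-- The discontinuous part of a character can be split off. -/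
theorem isCentralPD_sub_delta {χ : FullGroup → ℂ} (hχ : IsCentralPD χ) {F : ℝ → ℝ}
    (hF : ∀ s : FullGroup, s * s = 1 → χ s = (F (fixMeasure s) : ℂ)) (hF1 : F 1 = 1) {c : ℕ → ℝ}
    (hc : ∀ k, 0 ≤ c k) (hs : Summable c)
    (hFc : ∀ n j : ℕ, j < 2 ^ n → F (j / 2 ^ n) = ∑' k, c k * ((j : ℝ) / 2 ^ n) ^ k) :
    IsCentralPD fun g => χ g - ((1 - ∑' k, c k : ℝ) : ℂ) * if g = 1 then 1 else 0 := by
  refine ⟨fun g h => by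
    simp only [hχ.central g h, mul_eq_one_comm (a := g) (b := h)], fun x => ?_⟩
  rw [tr_sub_left, tr_delta, sub_nonneg]
  set Λ := (gstar x * x).coeff.support.erase 1 with hΛ
  have hev := coeff_one_mul_le hχ hF x Λ (fun g hg h1 => Finset.mem_erase.2 ⟨h1, hg⟩) (by simp [hΛ])
  set C := ∑' k, c k with hC
  -- As the scale shrinks, F tends to C from below 1, while B = ∅ keeps contributing F(1) = 1: the
  -- jump of F at 1 is 1 - C.
  have hlimF : ∀ B : Finset Λ, Tendsto (fun m : ℕ => (F (1 - B.card / (2 : ℝ) ^ m) : ℂ)) atTop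
      (𝓝 ((C : ℂ) + if B.card = 0 then (1 - C : ℂ) else 0)) := by
    intro B
    by_cases hB : B.card = 0
    · simp [hB, hF1]
    · rw [if_neg hB, add_zero]
      refine (Complex.continuous_ofReal.tendsto C).comp ?_
      have ht : Tendsto (fun m : ℕ => (1 : ℝ) - B.card / (2 : ℝ) ^ m) atTop (𝓝 1) := by
        have := ((tendsto_pow_atTop_nhds_zero_of_lt_one (r := (2 : ℝ)⁻¹) (by norm_num)
          (by norm_num)).const_mul (B.card : ℝ)).const_sub 1
        simpa [inv_pow, div_eq_mul_inv] using this
      have h0 := ht.eventually (lt_mem_nhds (zero_lt_one' ℝ))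
      have := tendsto_power_series hc hs (h0.mono fun m h => h.le)
        (Eventually.of_forall fun m => sub_le_self _ (by positivity)) ht
      refine this.congr' ?_
      filter_upwards [h0] with m hm
      have hle : B.card ≤ 2 ^ m := by
        have : (B.card : ℝ) / 2 ^ m < 1 := by linarith
        rw [div_lt_one (by positivity)] at this
        exact_mod_cast this.le
      have e : (1 : ℝ) - B.card / (2 : ℝ) ^ m = ((2 ^ m - B.card : ℕ) : ℝ) / 2 ^ m := by
        rw [Nat.cast_sub hle]; push_cast; field_simp
      rw [e, hFc m _ (by have := Nat.pos_of_ne_zero hB; omega)]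
  have hlim := tendsto_finsetSum (Finset.univ : Finset Λ).powerset fun B _ =>
    (hlimF B).const_mul ((-1 : ℂ) ^ B.card)
  -- The alternating sum of the constant C vanishes for nonempty Λ, leaving 1 - C; for empty Λ the
  -- sum is 1, which is enough since C ≥ 0.
  have hval : (((1 - C : ℝ) : ℂ)) ≤ ∑ B ∈ (Finset.univ : Finset Λ).powerset, (-1 : ℂ) ^ B.card *
      ((C : ℂ) + if B.card = 0 then (1 - C : ℂ) else 0) := by
    have e1 : ∑ B ∈ (Finset.univ : Finset Λ).powerset, (-1 : ℂ) ^ B.card *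
        ((C : ℂ) + if B.card = 0 then (1 - C : ℂ) else 0) =
        (∑ B ∈ (Finset.univ : Finset Λ).powerset, (-1 : ℂ) ^ B.card) * C + (1 - C) := by
      simp only [mul_add, Finset.sum_add_distrib, Finset.sum_mul]
      congr 1
      rw [Finset.sum_eq_single ∅] <;> simp +contextual
    have e2 : ∑ B ∈ (Finset.univ : Finset Λ).powerset, (-1 : ℂ) ^ B.card =
        if (Finset.univ : Finset Λ) = ∅ then 1 else 0 := by
      exact_mod_cast congrArg (Int.cast : ℤ → ℂ)
        (Finset.sum_powerset_neg_one_pow_card (x := (Finset.univ : Finset Λ)))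
    have hC0 : (0 : ℂ) ≤ (C : ℂ) := by
      rw [Complex.zero_le_real]; exact tsum_nonneg hc
    rw [e1, e2]
    push_cast
    split_ifs
    · rw [one_mul]; exact le_add_of_nonneg_left hC0
    · simp
  rw [mul_comm]
  exact (mul_le_mul_of_nonneg_left hval (coeff_gstar_mul_self_one_nonneg x)).trans
    (le_of_tendsto (hlim.const_mul _) hev)

end Odometer

/-! ### The length function and continuity along involutions -/

theorem IsCentralPD.nm_el_sub_one_sq {G : Type*} [Group G] {φ : G → ℂ} (hφ : IsCentralPD φ) (g : G) :
    nm φ (el g - 1) ^ 2 = 2 * ((φ 1).re - (φ g).re) := by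
  have := hφ.nm_el_sub_sq g 1
  rw [el_one, mul_one, hφ.map_inv, Complex.conj_re] at this
  exact this

/-- A commutator is a conjugate of h times h⁻¹, so its length is controlled by h alone; g may be
arbitrary. -/
theorem IsCentralPD.nm_el_mul_conj_le {G : Type*} [Group G] {φ : G → ℂ} (hφ : IsCentralPD φ)
    (g h : G) : nm φ (el (g * (h * g⁻¹ * h⁻¹)) - 1) ≤ 2 * nm φ (el h - 1) := by
  have h1 : g * (h * g⁻¹ * h⁻¹) = (g * h * g⁻¹) * h⁻¹ := by group
  have h2 : nm φ (el h⁻¹ - 1) = nm φ (el h - 1) := by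
    have e1 := hφ.nm_el_sub_one_sq h
    have e2 := hφ.nm_el_sub_one_sq h⁻¹
    rw [hφ.map_inv, Complex.conj_re, ← e1] at e2
    exact (pow_left_inj₀ (hφ.nm_nonneg _) (hφ.nm_nonneg _) two_ne_zero).1 e2
  rw [h1]
  refine (hφ.nm_el_mul_sub_one_le _ _).trans ?_
  rw [hφ.nm_el_conj_sub_one, h2]
  linarith

namespace Odometer

open Filter Topology

theorem fixMeasure_le_one (g : FullGroup) : fixMeasure g ≤ 1 := by
  obtain ⟨s, rfl⟩ := exists_mk_eq g
  exact measureReal_le_one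

theorem fixMeasure_nonneg (g : FullGroup) : 0 ≤ fixMeasure g := by
  obtain ⟨s, rfl⟩ := exists_mk_eq g
  exact measureReal_nonneg

/-- An involution supported on a given set. -/
theorem exists_involution_of_set {R : Set X} (hR : MeasurableSet R) :
    ∃ r : borelFullGroup, (r : FullGroup) * r = 1 ∧ (∀ x ∉ R, (r : Equiv.Perm X) x = x) ∧
      fixMeasure (r : FullGroup) = 1 - μ.real R := by
  obtain ⟨r, h1, h2, h3⟩ := exists_involution_support hR
  refine ⟨r, ?_, h2, ?_⟩
  · change ((r * r : borelFullGroup) : FullGroup) = ((1 : borelFullGroup) : FullGroup)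
    congr 1
    ext1; exact Equiv.ext h1
  · rw [fixMeasure_mk, ← probReal_compl_eq_one_sub hR]
    refine measureReal_congr ?_
    filter_upwards [h3] with x hx
    exact propext ⟨fun h h' => hx h' h, fun h => h2 x h⟩

theorem mul_self_of_disjoint {s t : borelFullGroup} (hs : (s : FullGroup) * s = 1)
    (ht : (t : FullGroup) * t = 1)
    (hd : ∀ᵐ x ∂μ, (s : Equiv.Perm X) x = x ∨ (t : Equiv.Perm X) x = x) :
    (s : FullGroup) * t * (s * t) = 1 := by
  have hc := commute_of_disjoint hd
  calc (s : FullGroup) * t * (s * t) = s * (t * s) * t := by simp only [mul_assoc]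
    _ = (s * s) * (t * t) := by rw [← hc]; simp only [mul_assoc]
    _ = 1 := by rw [hs, ht, one_mul]

/-- Continuity at the identity along involutions, from continuity along a sequence of supports. -/
theorem involution_continuity {ψ : FullGroup → ℂ} (hψ : IsCentralPD ψ) {F : ℝ → ℝ}
    (hF : ∀ s : FullGroup, s * s = 1 → ψ s = (F (fixMeasure s) : ℂ))
    (hlim : Tendsto (fun m : ℕ => F (1 - 1 / (2 : ℝ) ^ m)) atTop (𝓝 (ψ 1).re)) {ε : ℝ}
    (hε : 0 < ε) :
    ∃ δ > 0, ∀ s : FullGroup, s * s = 1 → 1 - fixMeasure s ≤ δ → nm ψ (el s - 1) ≤ ε := by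
  have hev : ∀ᶠ m : ℕ in atTop, 2 * ((ψ 1).re - F (1 - 1 / (2 : ℝ) ^ m)) ≤ (ε / 2) ^ 2 := by
    have h1 : Tendsto (fun m : ℕ => 2 * ((ψ 1).re - F (1 - 1 / (2 : ℝ) ^ m))) atTop (𝓝 0) := by
      simpa using (hlim.const_sub (ψ 1).re).const_mul 2
    exact (h1.eventually_lt_const (by positivity)).mono fun m h => h.le
  obtain ⟨m, hm, hm1⟩ := (hev.and (eventually_ge_atTop 1)).exists
  have hm2 : 1 / (2 : ℝ) ^ m ≤ 1 / 2 := by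
    have : (2 : ℝ) ^ 1 ≤ 2 ^ m := pow_le_pow_right₀ (by norm_num) hm1
    exact one_div_le_one_div_of_le (by norm_num) (by simpa using this)
  set q : ℝ := 1 / (2 : ℝ) ^ m with hq
  have hq0 : 0 < q := by positivity
  have hexact : ∀ s : FullGroup, s * s = 1 → fixMeasure s = 1 - q → nm ψ (el s - 1) ≤ ε / 2 := by
    intro s hs hfix
    have h2 := hψ.nm_el_sub_one_sq s
    rw [hF s hs, hfix, Complex.ofReal_re] at h2
    exact le_of_sq_le_sq (by rw [h2]; exact hm) (by positivity)
  refine ⟨q, hq0, fun s hs hfix => ?_⟩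
  set a : ℝ := 1 - fixMeasure s with ha
  have ha0 : 0 ≤ a := sub_nonneg.2 (fixMeasure_le_one s)
  -- Continuity is known only at supports of measure exactly q. An involution of support a ≤ q has
  -- the value of u₁ u₂ = (u₁ u₃)(u₃ u₂) with supports a/2, a/2 and q - a/2, and both factors have
  -- support exactly q.
  obtain ⟨R₁, -, hR₁, hμ₁⟩ := exists_subset_measure_eq (A := Set.univ) MeasurableSet.univ
    (r := a / 2) (by positivity) (by simp; linarith)
  obtain ⟨R₂, hs₂, hR₂, hμ₂⟩ := exists_subset_measure_eq hR₁.compl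
    (r := a / 2) (by positivity) (by rw [probReal_compl_eq_one_sub hR₁]; linarith)
  have hd₂ : Disjoint R₁ R₂ := Set.disjoint_left.2 fun x h h' => hs₂ h' h
  have hμ₁₂ : μ.real (R₁ ∪ R₂) = a := by
    rw [measureReal_union hd₂ hR₂, hμ₁, hμ₂]; ring
  obtain ⟨R₃, hs₃, hR₃, hμ₃⟩ := exists_subset_measure_eq (hR₁.union hR₂).compl
    (r := q - a / 2) (by linarith)
    (by rw [probReal_compl_eq_one_sub (hR₁.union hR₂), hμ₁₂]; linarith)
  obtain ⟨u₁, i₁, f₁, m₁⟩ := exists_involution_of_set hR₁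
  obtain ⟨u₂, i₂, f₂, m₂⟩ := exists_involution_of_set hR₂
  obtain ⟨u₃, i₃, f₃, m₃⟩ := exists_involution_of_set hR₃
  have d₁₂ : ∀ᵐ x ∂μ, (u₁ : Equiv.Perm X) x = x ∨ (u₂ : Equiv.Perm X) x = x :=
    Eventually.of_forall fun x => by
      by_cases hx : x ∈ R₁
      · exact Or.inr (f₂ x fun h => hs₂ h hx)
      · exact Or.inl (f₁ x hx)
  have d₁₃ : ∀ᵐ x ∂μ, (u₁ : Equiv.Perm X) x = x ∨ (u₃ : Equiv.Perm X) x = x :=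
    Eventually.of_forall fun x => by
      by_cases hx : x ∈ R₁
      · exact Or.inr (f₃ x fun h => hs₃ h (Or.inl hx))
      · exact Or.inl (f₁ x hx)
  have d₃₂ : ∀ᵐ x ∂μ, (u₃ : Equiv.Perm X) x = x ∨ (u₂ : Equiv.Perm X) x = x :=
    Eventually.of_forall fun x => by
      by_cases hx : x ∈ R₂
      · exact Or.inl (f₃ x fun h => hs₃ h (Or.inr hx))
      · exact Or.inr (f₂ x hx)
  have hval : ψ s = ψ ((u₁ : FullGroup) * u₂) := by
    rw [hF s hs, hF _ (mul_self_of_disjoint i₁ i₂ d₁₂), fixMeasure_mul_of_disjoint d₁₂, m₁, m₂, hμ₁,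
      hμ₂]
    congr 2
    rw [ha]; ring
  have hnm : nm ψ (el s - 1) = nm ψ (el ((u₁ : FullGroup) * u₂) - 1) := by
    rw [← pow_left_inj₀ (hψ.nm_nonneg _) (hψ.nm_nonneg _) two_ne_zero, hψ.nm_el_sub_one_sq,
      hψ.nm_el_sub_one_sq, hval]
  have hsplit : (u₁ : FullGroup) * u₂ = (u₁ * u₃) * (u₃ * u₂) := by
    rw [mul_assoc, ← mul_assoc (u₃ : FullGroup), i₃, one_mul]
  rw [hnm, hsplit]
  refine (hψ.nm_el_mul_sub_one_le _ _).trans ?_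
  have h1 := hexact _ (mul_self_of_disjoint i₁ i₃ d₁₃) (by
    rw [fixMeasure_mul_of_disjoint d₁₃, m₁, m₃, hμ₁, hμ₃]; ring)
  have h2 := hexact _ (mul_self_of_disjoint i₃ i₂ d₃₂) (by
    rw [fixMeasure_mul_of_disjoint d₃₂, m₃, m₂, hμ₂, hμ₃]; ring)
  linarith

/-! ### Shrinking a support by an involution -/

section Greedy

variable (w : borelFullGroup)

/-- Greedy construction of a set disjoint from its image and meeting every nontrivial orbit. -/
def greedy : ℕ → Set X
  | 0 => ∅
  | n + 1 => greedy n ∪ {x | (x n.div2 = n.bodd ∧ (w : Equiv.Perm X) x n.div2 ≠ n.bodd) ∧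
      x ∉ greedy n ∧ (w : Equiv.Perm X) x ∉ greedy n ∧
        ((w⁻¹ : borelFullGroup) : Equiv.Perm X) x ∉ greedy n}

theorem measurableSet_greedy (n : ℕ) : MeasurableSet (greedy w n) := by
  induction n with
  | zero => exact MeasurableSet.empty
  | succ n ih =>
    refine ih.union ?_
    have e1 : MeasurableSet {x : X | x n.div2 = n.bodd} :=
      (measurable_pi_apply (X := fun _ : ℕ => Bool) n.div2) (measurableSet_singleton _)
    have e2 : MeasurableSet {x : X | (w : Equiv.Perm X) x n.div2 = n.bodd} :=
      ((measurable_pi_apply (X := fun _ : ℕ => Bool) n.div2).comp (coe_measurable w))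
        (measurableSet_singleton _)
    exact (e1.inter e2.compl).inter (ih.compl.inter
      (((coe_measurable w) ih).compl.inter ((coe_measurable w⁻¹) ih).compl))

theorem greedy_mono {m n : ℕ} (h : m ≤ n) : greedy w m ⊆ greedy w n := by
  induction n, h using Nat.le_induction with
  | base => exact subset_rfl
  | succ n _ ih => exact ih.trans Set.subset_union_left

theorem greedy_disjoint (n : ℕ) : ∀ x ∈ greedy w n, (w : Equiv.Perm X) x ∉ greedy w n := by
  induction n with
  | zero => exact fun x hx => hx.elim
  | succ n ih =>
    rintro x (hx | ⟨⟨hx1, hx2⟩, hx3, hx4, hx5⟩) (h | ⟨⟨h1, h2⟩, h3, h4, h5⟩)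
    · exact ih x hx h
    · rw [coe_inv_apply_self] at h5
      exact h5 hx
    · exact hx4 h
    · exact hx2 h1

/-- Every element is, up to an involution inside its support, an element whose support is smaller by
a fixed factor. -/
theorem exists_reduction : ∃ s : borelFullGroup,
    (∀ x, (s : Equiv.Perm X) ((s : Equiv.Perm X) x) = x) ∧
    (∀ x, (w : Equiv.Perm X) x = x → (s : Equiv.Perm X) x = x) ∧
    μ.real (fixSet (s * w))ᶜ ≤ 2 / 3 * μ.real (fixSet w)ᶜ := by
  classical
  set B : Set X := ⋃ n, greedy w n with hB
  have hBm : MeasurableSet B := MeasurableSet.iUnion (measurableSet_greedy w)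
  have hBd : ∀ x ∈ B, (w : Equiv.Perm X) x ∉ B := by
    intro x hx hx'
    obtain ⟨m, hm⟩ := Set.mem_iUnion.1 hx
    obtain ⟨n, hn⟩ := Set.mem_iUnion.1 hx'
    exact greedy_disjoint w (max m n) x (greedy_mono w (le_max_left m n) hm)
      (greedy_mono w (le_max_right m n) hn)
  have hcover : ∀ x, (w : Equiv.Perm X) x ≠ x →
      x ∈ B ∨ (w : Equiv.Perm X) x ∈ B ∨ ((w⁻¹ : borelFullGroup) : Equiv.Perm X) x ∈ B := by
    intro x hx
    obtain ⟨i, hi⟩ := Function.ne_iff.1 hx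
    by_contra! h
    have hn : ∀ n, x ∉ greedy w n ∧ (w : Equiv.Perm X) x ∉ greedy w n ∧
        ((w⁻¹ : borelFullGroup) : Equiv.Perm X) x ∉ greedy w n := fun n =>
      ⟨fun h' => h.1 (Set.mem_iUnion.2 ⟨n, h'⟩), fun h' => h.2.1 (Set.mem_iUnion.2 ⟨n, h'⟩),
        fun h' => h.2.2 (Set.mem_iUnion.2 ⟨n, h'⟩)⟩
    -- The stage that encodes digit position i and digit value x i: nothing blocks x there, so it
    -- would have been added.
    refine (hn (Nat.bit (x i) i + 1)).1 (Or.inr ⟨?_, hn _⟩)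
    rw [Nat.div2_bit, Nat.bodd_bit]
    exact ⟨rfl, hi⟩
  -- The involution exchanging x with w x for x in B; composed after w it fixes B.
  let f : X → X := fun x => if x ∈ B then (w : Equiv.Perm X) x else
    if ((w⁻¹ : borelFullGroup) : Equiv.Perm X) x ∈ B then
      ((w⁻¹ : borelFullGroup) : Equiv.Perm X) x else x
  have hfm : Measurable f := Measurable.ite hBm (coe_measurable w)
    (Measurable.ite ((coe_measurable w⁻¹) hBm) (coe_measurable w⁻¹) measurable_id)
  have hfo : ∀ x, f x ∈ orbit x := by
    intro x
    simp only [f]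
    split_ifs
    · exact coe_mem_orbit w x
    · exact coe_mem_orbit w⁻¹ x
    · exact mem_orbit_self x
  have hf1 : ∀ x ∈ B, f x = (w : Equiv.Perm X) x := fun x hx => if_pos hx
  have hf2 : ∀ x ∈ B, f ((w : Equiv.Perm X) x) = x := fun x hx => by
    simp only [f, if_neg (hBd x hx), coe_inv_apply_self, if_pos hx]
  have hfi : Function.Involutive f := by
    intro x
    by_cases hx : x ∈ B
    · rw [hf1 x hx, hf2 x hx]
    · by_cases hx' : ((w⁻¹ : borelFullGroup) : Equiv.Perm X) x ∈ B
      · have := hf2 _ hx'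
        rw [coe_apply_inv_self] at this
        rw [this, hf1 _ hx', coe_apply_inv_self]
      · have : f x = x := by simp only [f, if_neg hx, if_neg hx']
        rw [this, this]
  have hBmoved : ∀ x ∈ B, (w : Equiv.Perm X) x ≠ x := fun x hx h => hBd x hx (h.symm ▸ hx)
  have hffix : ∀ x, (w : Equiv.Perm X) x = x → f x = x := by
    intro x hx
    have h1 : x ∉ B := fun h => hBmoved x h hx
    have h2 : ((w⁻¹ : borelFullGroup) : Equiv.Perm X) x = x := by
      conv_lhs => rw [← hx]
      exact coe_inv_apply_self w x
    simp only [f, if_neg h1, h2]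
  refine ⟨ofInvolutive f hfm hfo hfi, hfi, hffix, ?_⟩
  have hE : (fixSet w)ᶜ ⊆ B ∪ (((w : Equiv.Perm X) ⁻¹' B) ∪
      ((w⁻¹ : borelFullGroup) : Equiv.Perm X) ⁻¹' B) := fun x hx => hcover x hx
  -- Three translates of B cover the support, so B carries at least a third of it.
  have h3 : μ.real (fixSet w)ᶜ ≤ 3 * μ.real B := by
    have h1 : μ.real ((w : Equiv.Perm X) ⁻¹' B) = μ.real B := by
      rw [Measure.real, measure_preimage_coe w hBm, Measure.real]
    have h2 : μ.real (((w⁻¹ : borelFullGroup) : Equiv.Perm X) ⁻¹' B) = μ.real B := by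
      rw [Measure.real, measure_preimage_coe w⁻¹ hBm, Measure.real]
    have := (measureReal_mono (μ := μ) hE).trans ((measureReal_union_le _ _).trans
      (add_le_add le_rfl (measureReal_union_le _ _)))
    linarith
  have h4 : (fixSet (ofInvolutive f hfm hfo hfi * w))ᶜ ⊆ (fixSet w)ᶜ \ B := by
    intro x hx
    refine ⟨fun h => hx ?_, fun h => hx ?_⟩
    · change f ((w : Equiv.Perm X) x) = x
      rw [show (w : Equiv.Perm X) x = x from h, hffix x h]
    · exact hf2 x h
  have h5 := measureReal_mono (μ := μ) h4
  rw [measureReal_sdiff (show B ⊆ (fixSet w)ᶜ from fun x hx => hBmoved x hx) hBm] at h5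
  linarith

end Greedy

/-- Disjoint measurable sets with prescribed measures. -/
theorem exists_disjoint_sequence {a : ℕ → ℝ} (ha : ∀ n, 0 ≤ a n)
    (hsum : ∀ n, ∑ i ∈ Finset.range n, a i ≤ 1) :
    ∃ D : ℕ → Set X, (∀ n, MeasurableSet (D n)) ∧ (∀ n, μ.real (D n) = a n) ∧
      ∀ m n, m ≠ n → Disjoint (D m) (D n) := by
  have step : ∀ (n : ℕ) (U : {U : Set X // MeasurableSet U ∧ μ.real U = ∑ i ∈ Finset.range n, a i}),
      ∃ U' : {U : Set X // MeasurableSet U ∧ μ.real U = ∑ i ∈ Finset.range (n + 1), a i},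
        U.1 ⊆ U'.1 := by
    rintro n ⟨U, hU, hUμ⟩
    obtain ⟨B, hB1, hB2, hB3⟩ := exists_subset_measure_eq hU.compl (ha n) (by
      rw [probReal_compl_eq_one_sub hU, hUμ]
      have := hsum (n + 1)
      rw [Finset.sum_range_succ] at this
      linarith)
    refine ⟨⟨U ∪ B, hU.union hB2, ?_⟩, Set.subset_union_left⟩
    rw [measureReal_union (Set.disjoint_left.2 fun x h h' => hB1 h' h) hB2, hUμ, hB3,
      Finset.sum_range_succ]
  choose next hnext using step
  let U : ∀ n, {U : Set X // MeasurableSet U ∧ μ.real U = ∑ i ∈ Finset.range n, a i} := fun n =>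
    Nat.rec ⟨∅, MeasurableSet.empty, by simp⟩ next n
  have hmono : Monotone fun n => (U n).1 := monotone_nat_of_le_succ fun n => hnext n (U n)
  refine ⟨fun n => (U (n + 1)).1 \ (U n).1, fun n => (U (n + 1)).2.1.diff (U n).2.1, fun n => ?_, ?_⟩
  · rw [measureReal_sdiff (hmono (Nat.le_succ n)) (U n).2.1, (U (n + 1)).2.2, (U n).2.2,
      Finset.sum_range_succ]
    ring
  · have key : ∀ m n, m < n → Disjoint ((U (m + 1)).1 \ (U m).1) ((U (n + 1)).1 \ (U n).1) :=
      fun m n h => Set.disjoint_left.2 fun x hx hx' => hx'.2 (hmono h hx.1)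
    intro m n h
    rcases lt_or_gt_of_ne h with h | h
    · exact key m n h
    · exact (key n m h).symm

end Odometer

/-! ### Rooms and the swindle identity -/

namespace Odometer

section Rooms

variable (E : ℕ → Set X)

/-- Two copies of each of the sets `E k`. -/
abbrev RoomSpace : Type := {z : (Bool × ℕ) × X // z.2 ∈ E z.1.2}

/-- The measurable permutations of the room space that move points inside their orbits. -/
def roomGroup : Subgroup (Equiv.Perm (RoomSpace E)) where
  carrier := {p | Measurable p ∧ Measurable p.symm ∧ ∀ z, (p z).1.2 ∈ orbit z.1.2}
  mul_mem' := by
    rintro a b ⟨ha, ha', hao⟩ ⟨hb, hb', hbo⟩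
    exact ⟨ha.comp hb, hb'.comp ha', fun z => mem_orbit_trans (hbo z) (hao (b z))⟩
  one_mem' := ⟨measurable_id, measurable_id, fun z => mem_orbit_self _⟩
  inv_mem' := by
    rintro a ⟨ha, ha', hao⟩
    refine ⟨ha', ha, fun z => ?_⟩
    have := hao (a⁻¹ z)
    rw [show a (a⁻¹ z) = z from a.apply_symm_apply z] at this
    exact mem_orbit_symm this

variable {E}

/-- The map of the room space to `X` given by a transformation for each room. -/
def roomMap (θ : Bool × ℕ → borelFullGroup) (z : RoomSpace E) : X := (θ z.1.1 : Equiv.Perm X) z.1.2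

theorem measurable_roomMap (θ : Bool × ℕ → borelFullGroup) :
    Measurable (roomMap (E := E) θ) := by
  have : Measurable fun z : (Bool × ℕ) × X => (θ z.1 : Equiv.Perm X) z.2 :=
    measurable_from_prod_countable_right fun r => coe_measurable (θ r)
  exact this.comp measurable_subtype_coe

theorem measurableSet_rooms (hE : ∀ k, MeasurableSet (E k)) :
    MeasurableSet {z : (Bool × ℕ) × X | z.2 ∈ E z.1.2} := by
  have : {z : (Bool × ℕ) × X | z.2 ∈ E z.1.2} = ⋃ r : Bool × ℕ, ({r} ×ˢ E r.2) := by
    ext ⟨r, x⟩; simp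
  rw [this]
  exact MeasurableSet.iUnion fun r => (measurableSet_singleton r).prod (hE r.2)

theorem measurableEmbedding_roomMap (hE : ∀ k, MeasurableSet (E k)) {θ : Bool × ℕ → borelFullGroup}
    (hinj : Function.Injective (roomMap (E := E) θ)) : MeasurableEmbedding (roomMap (E := E) θ) := by
  have : StandardBorelSpace (RoomSpace E) := (measurableSet_rooms hE).standardBorel
  exact (measurable_roomMap θ).measurableEmbedding hinj

/-- Permutations of the room space act on `X`. -/
noncomputable def roomHom (hE : ∀ k, MeasurableSet (E k)) {θ : Bool × ℕ → borelFullGroup}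
    (hinj : Function.Injective (roomMap (E := E) θ)) : roomGroup E →* borelFullGroup :=
  ((Equiv.Perm.viaEmbeddingHom ⟨roomMap θ, hinj⟩).comp (roomGroup E).subtype).codRestrict
    borelFullGroup (by
      have hmeas : ∀ p : roomGroup E, Measurable ((p : Equiv.Perm (RoomSpace E)).viaEmbedding
          ⟨roomMap θ, hinj⟩) := by
        intro p
        have h1 : ⇑((p : Equiv.Perm (RoomSpace E)).viaEmbedding ⟨roomMap θ, hinj⟩) =
            Function.extend (roomMap θ) (fun z => roomMap θ ((p : Equiv.Perm (RoomSpace E)) z)) id := by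
          funext x
          by_cases hx : ∃ z, roomMap (E := E) θ z = x
          · obtain ⟨z, rfl⟩ := hx
            rw [hinj.extend_apply]
            exact Equiv.Perm.viaEmbedding_apply _ ⟨roomMap θ, hinj⟩ z
          · rw [Function.extend_apply' _ _ _ hx]
            exact Equiv.Perm.viaEmbedding_apply_of_notMem _ ⟨roomMap θ, hinj⟩ x hx
        rw [h1]
        exact (measurableEmbedding_roomMap hE hinj).measurable_extend
          ((measurable_roomMap θ).comp p.2.1) measurable_id
      intro p
      refine ⟨hmeas p, ?_, fun x => ?_⟩
      · have := hmeas p⁻¹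
        rw [← Equiv.Perm.viaEmbeddingHom_apply, Subgroup.coe_inv, map_inv] at this
        exact this
      · change (p : Equiv.Perm (RoomSpace E)).viaEmbedding ⟨roomMap θ, hinj⟩ x ∈ orbit x
        by_cases hx : ∃ z, roomMap (E := E) θ z = x
        · obtain ⟨z, rfl⟩ := hx
          have := Equiv.Perm.viaEmbedding_apply (p : Equiv.Perm (RoomSpace E)) ⟨roomMap θ, hinj⟩ z
          change _ = roomMap θ _ at this
          rw [show roomMap θ z = (⟨roomMap θ, hinj⟩ : RoomSpace E ↪ X) z from rfl, this]
          exact mem_orbit_trans (mem_orbit_symm (coe_mem_orbit _ _))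
            (mem_orbit_trans (p.2.2.2 z) (coe_mem_orbit _ _))
        · rw [Equiv.Perm.viaEmbedding_apply_of_notMem _ ⟨roomMap θ, hinj⟩ x hx]
          exact mem_orbit_self x)

theorem roomHom_apply (hE : ∀ k, MeasurableSet (E k)) {θ : Bool × ℕ → borelFullGroup}
    (hinj : Function.Injective (roomMap (E := E) θ)) (p : roomGroup E) (z : RoomSpace E) :
    (roomHom hE hinj p : Equiv.Perm X) (roomMap θ z) =
      roomMap θ ((p : Equiv.Perm (RoomSpace E)) z) :=
  Equiv.Perm.viaEmbedding_apply _ ⟨roomMap θ, hinj⟩ z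

theorem roomHom_apply_of_notMem (hE : ∀ k, MeasurableSet (E k)) {θ : Bool × ℕ → borelFullGroup}
    (hinj : Function.Injective (roomMap (E := E) θ)) (p : roomGroup E) {x : X}
    (hx : x ∉ Set.range (roomMap (E := E) θ)) : (roomHom hE hinj p : Equiv.Perm X) x = x :=
  Equiv.Perm.viaEmbedding_apply_of_notMem _ ⟨roomMap θ, hinj⟩ x hx

theorem fixMeasure_roomHom (hE : ∀ k, MeasurableSet (E k)) {θ : Bool × ℕ → borelFullGroup}
    (hinj : Function.Injective (roomMap (E := E) θ)) (p : roomGroup E) {δ : ℝ} (hδ : 0 ≤ δ)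
    (h : ∑' r : Bool × ℕ, μ (E r.2) ≤ ENNReal.ofReal δ) :
    1 - fixMeasure (roomHom hE hinj p : FullGroup) ≤ δ := by
  rw [fixMeasure_mk, ← probReal_compl_eq_one_sub (measurableSet_fixSet _), Measure.real]
  refine ENNReal.toReal_le_of_le_ofReal hδ (le_trans ?_ h)
  have h1 : (fixSet (roomHom hE hinj p))ᶜ ⊆
      ⋃ r : Bool × ℕ, (((θ r)⁻¹ : borelFullGroup) : Equiv.Perm X) ⁻¹' E r.2 := by
    intro x hx
    by_contra h2
    apply hx
    refine roomHom_apply_of_notMem hE hinj p ?_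
    rintro ⟨z, rfl⟩
    refine h2 (Set.mem_iUnion.2 ⟨z.1.1, ?_⟩)
    rw [Set.mem_preimage, roomMap, coe_inv_apply_self]
    exact z.2
  refine (measure_mono h1).trans ((measure_iUnion_le _).trans ?_)
  refine ENNReal.tsum_le_tsum fun r => ?_
  rw [measure_preimage_coe _ (hE r.2)]

/-- Permutations acting inside each room. -/
def fiberPerm (g : Bool × ℕ → borelFullGroup)
    (h : ∀ r, ∀ x ∈ E r.2, (g r : Equiv.Perm X) x ∈ E r.2)
    (h' : ∀ r, ∀ x ∈ E r.2, (((g r)⁻¹ : borelFullGroup) : Equiv.Perm X) x ∈ E r.2) : roomGroup E :=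
  ⟨⟨fun z => ⟨(z.1.1, (g z.1.1 : Equiv.Perm X) z.1.2), h _ _ z.2⟩,
    fun z => ⟨(z.1.1, (((g z.1.1)⁻¹ : borelFullGroup) : Equiv.Perm X) z.1.2), h' _ _ z.2⟩,
    fun z => Subtype.ext (Prod.ext rfl (coe_inv_apply_self _ _)),
    fun z => Subtype.ext (Prod.ext rfl (coe_apply_inv_self _ _))⟩, by
    refine ⟨?_, ?_, fun z => coe_mem_orbit _ _⟩
    · exact Measurable.subtype_mk ((measurable_fst.comp measurable_subtype_coe).prodMk
        (measurable_roomMap g))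
    · exact Measurable.subtype_mk ((measurable_fst.comp measurable_subtype_coe).prodMk
        (measurable_roomMap fun r => (g r)⁻¹))⟩

theorem fiberPerm_apply (g : Bool × ℕ → borelFullGroup)
    (h : ∀ r, ∀ x ∈ E r.2, (g r : Equiv.Perm X) x ∈ E r.2)
    (h' : ∀ r, ∀ x ∈ E r.2, (((g r)⁻¹ : borelFullGroup) : Equiv.Perm X) x ∈ E r.2)
    (z : RoomSpace E) :
    (((fiberPerm g h h' : roomGroup E) : Equiv.Perm (RoomSpace E)) z).1 =
      (z.1.1, (g z.1.1 : Equiv.Perm X) z.1.2) := rfl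

/-- Involutive maps of the rooms that keep the points. -/
def movePerm (f : (Bool × ℕ) × X → Bool × ℕ) (hm : ∀ r, Measurable fun x => f (r, x))
    (hE : ∀ z : RoomSpace E, z.1.2 ∈ E (f z.1).2)
    (hi : ∀ z : RoomSpace E, f (f z.1, z.1.2) = z.1.1) : roomGroup E :=
  ⟨Function.Involutive.toPerm (fun z => ⟨(f z.1, z.1.2), hE z⟩) fun z =>
      Subtype.ext (Prod.ext (hi z) rfl), by
    have : Measurable fun z : RoomSpace E => (⟨(f z.1, z.1.2), hE z⟩ : RoomSpace E) :=
      Measurable.subtype_mk (((measurable_from_prod_countable_right hm).comp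
        measurable_subtype_coe).prodMk (measurable_snd.comp measurable_subtype_coe))
    exact ⟨this, this, fun z => mem_orbit_self _⟩⟩

theorem movePerm_mul_self (f : (Bool × ℕ) × X → Bool × ℕ) (hm : ∀ r, Measurable fun x => f (r, x))
    (hE : ∀ z : RoomSpace E, z.1.2 ∈ E (f z.1).2)
    (hi : ∀ z : RoomSpace E, f (f z.1, z.1.2) = z.1.1) :
    movePerm f hm hE hi * movePerm f hm hE hi = 1 :=
  Subtype.ext (Equiv.ext fun z => Subtype.ext (Prod.ext (hi z) rfl))

open scoped Classical in
/-- Exchange `E (k + 1)` in the first copy of room `k + 1` with `E (k + 1)` in the second copy of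
room `k`. -/
noncomputable def shiftRoom (E : ℕ → Set X) : (Bool × ℕ) × X → Bool × ℕ
  | ((false, 0), _) => (false, 0)
  | ((false, k + 1), _) => (true, k)
  | ((true, k), x) => if x ∈ E (k + 1) then (false, k + 1) else (true, k)

theorem measurable_shiftRoom (hE : ∀ k, MeasurableSet (E k)) (r : Bool × ℕ) :
    Measurable fun x => shiftRoom E (r, x) := by
  rcases r with ⟨_ | _, _ | k⟩
  · exact measurable_const
  · exact measurable_const
  · exact Measurable.ite (hE _) measurable_const measurable_const
  · exact Measurable.ite (hE _) measurable_const measurable_const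

/-- The identity behind the factorization of an arbitrary element into conjugates of few
involutions. -/
theorem room_identity (hE : ∀ k, MeasurableSet (E k)) (hmono : ∀ k, E (k + 1) ⊆ E k)
    (w s : ℕ → borelFullGroup) (hws : ∀ k x, (s k : Equiv.Perm X) ((w (k + 1) : Equiv.Perm X) x) =
      (w k : Equiv.Perm X) x)
    (hsi : ∀ k x, (s k : Equiv.Perm X) ((s k : Equiv.Perm X) x) = x)
    (hfix : ∀ k, ∀ x ∈ E k, x ∉ E (k + 1) → (w (k + 1) : Equiv.Perm X) x = x)
    (hw : ∀ k, ∀ x ∈ E k, (w k : Equiv.Perm X) x ∈ E k ∧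
      (((w k)⁻¹ : borelFullGroup) : Equiv.Perm X) x ∈ E k)
    (hs : ∀ k, ∀ x ∈ E k, (s k : Equiv.Perm X) x ∈ E k) :
    ∃ ω σ y u b : roomGroup E, σ * σ = 1 ∧ y * y = 1 ∧ u * u = 1 ∧ ω * (u * b * u) = σ * (y * b * y) ∧
      (∀ z : RoomSpace E, ((ω : Equiv.Perm (RoomSpace E)) z).1 =
        (z.1.1, ((if z.1.1 = (false, 0) then w 0 else 1 : borelFullGroup) : Equiv.Perm X) z.1.2)) := by
  classical
  have hs' : ∀ k, ∀ x ∈ E k, (((s k)⁻¹ : borelFullGroup) : Equiv.Perm X) x ∈ E k := by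
    intro k x hx
    have : (((s k)⁻¹ : borelFullGroup) : Equiv.Perm X) x = (s k : Equiv.Perm X) x := by
      conv_lhs => rw [← hsi k x]
      exact coe_inv_apply_self _ _
    rw [this]
    exact hs k x hx
  have hw2 : ∀ k, ∀ x ∈ E k, (w (k + 1) : Equiv.Perm X) x ∈ E k ∧
      (((w (k + 1))⁻¹ : borelFullGroup) : Equiv.Perm X) x ∈ E k := by
    intro k x hx
    by_cases hx' : x ∈ E (k + 1)
    · exact ⟨hmono k (hw _ x hx').1, hmono k (hw _ x hx').2⟩
    · have h1 := hfix k x hx hx'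
      refine ⟨by rwa [h1], ?_⟩
      conv => rw [← h1]
      rwa [coe_inv_apply_self]
  -- ω is w 0 in one room. σ acts as s k in the first copy of room k, b as w (k + 1) in the second
  -- copy; y swaps the copies and u shifts the second copy of room k to the first copy of room k +
  -- 1, as far as E (k + 1) reaches.
  let ω : roomGroup E := fiberPerm (fun r => if r = (false, 0) then w 0 else 1)
    (fun r x hx => by
      split_ifs with hr
      · subst hr; exact (hw 0 x hx).1
      · exact hx)
    (fun r x hx => by
      split_ifs with hr
      · subst hr; exact (hw 0 x hx).2
      · simpa using hx)
  let σ : roomGroup E := fiberPerm (fun r => if r.1 = false then s r.2 else 1)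
    (fun r x hx => by
      split_ifs
      · exact hs _ x hx
      · exact hx)
    (fun r x hx => by
      split_ifs
      · exact hs' _ x hx
      · simpa using hx)
  let b : roomGroup E := fiberPerm (fun r => if r.1 = true then w (r.2 + 1) else 1)
    (fun r x hx => by
      split_ifs
      · exact (hw2 _ x hx).1
      · exact hx)
    (fun r x hx => by
      split_ifs
      · exact (hw2 _ x hx).2
      · simpa using hx)
  let y : roomGroup E := movePerm (fun z => (!z.1.1, z.1.2)) (fun r =>
    measurable_const (a := (!r.1, r.2))) (fun z => z.2) (fun z => by simp)
  let u : roomGroup E := movePerm (shiftRoom E) (measurable_shiftRoom hE)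
    (by
      rintro ⟨⟨⟨_ | _, _ | k⟩, x⟩, hx⟩
      · exact hx
      · exact hmono k hx
      all_goals
        simp only [shiftRoom]
        split_ifs with h
        · exact h
        · exact hx)
    (by
      rintro ⟨⟨⟨_ | _, _ | k⟩, x⟩, hx⟩
      · rfl
      · simp only [shiftRoom]
        exact if_pos hx
      all_goals
        simp only [shiftRoom]
        split_ifs with h
        · rfl
        · exact if_neg h)
  refine ⟨ω, σ, y, u, b, ?_, movePerm_mul_self _ _ _ _, movePerm_mul_self _ _ _ _, ?_, fun z => rfl⟩
  · refine Subtype.ext (Equiv.ext fun z => Subtype.ext (Prod.ext rfl ?_))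
    rcases z with ⟨⟨⟨_ | _, k⟩, x⟩, hx⟩
    · exact hsi k x
    · rfl
  -- Both sides act as w k in the first copy of every room and trivially in the second. On the left,
  -- u puts w (k + 1) into room k + 1 and ω supplies the missing w 0; on the right, y puts w (k + 1)
  -- into room k and s k turns it into w k.
  · have hu1 : ∀ k x (hx : x ∈ E (k + 1)), (u : Equiv.Perm (RoomSpace E)) ⟨((false, k + 1), x), hx⟩ =
        ⟨((true, k), x), hmono k hx⟩ := fun k x hx => rfl
    have hu2 : ∀ k x (hx : x ∈ E k) (hx' : x ∈ E (k + 1)),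
        (u : Equiv.Perm (RoomSpace E)) ⟨((true, k), x), hx⟩ = ⟨((false, k + 1), x), hx'⟩ :=
      fun k x hx hx' => Subtype.ext (Prod.ext (if_pos hx') rfl)
    have hu3 : ∀ k x (hx : x ∈ E k), x ∉ E (k + 1) →
        (u : Equiv.Perm (RoomSpace E)) ⟨((true, k), x), hx⟩ = ⟨((true, k), x), hx⟩ :=
      fun k x hx hx' => Subtype.ext (Prod.ext (if_neg hx') rfl)
    have hb1 : ∀ k x (hx : x ∈ E k), (b : Equiv.Perm (RoomSpace E)) ⟨((true, k), x), hx⟩ =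
        ⟨((true, k), (w (k + 1) : Equiv.Perm X) x), (hw2 k x hx).1⟩ := fun k x hx => rfl
    have hb2 : ∀ k x (hx : x ∈ E k), (b : Equiv.Perm (RoomSpace E)) ⟨((false, k), x), hx⟩ =
        ⟨((false, k), x), hx⟩ := fun k x hx => rfl
    have hω1 : ∀ k x (hx : x ∈ E (k + 1)),
        (ω : Equiv.Perm (RoomSpace E)) ⟨((false, k + 1), x), hx⟩ = ⟨((false, k + 1), x), hx⟩ :=
      fun k x hx => Subtype.ext (by simp [ω, fiberPerm_apply])
    have hω2 : ∀ k x (hx : x ∈ E k),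
        (ω : Equiv.Perm (RoomSpace E)) ⟨((true, k), x), hx⟩ = ⟨((true, k), x), hx⟩ :=
      fun k x hx => Subtype.ext (by simp [ω, fiberPerm_apply])
    refine Subtype.ext (Equiv.ext fun z => ?_)
    change (ω : Equiv.Perm (RoomSpace E)) ((u : Equiv.Perm (RoomSpace E))
      ((b : Equiv.Perm (RoomSpace E)) ((u : Equiv.Perm (RoomSpace E)) z))) =
        (σ : Equiv.Perm (RoomSpace E)) ((y : Equiv.Perm (RoomSpace E))
      ((b : Equiv.Perm (RoomSpace E)) ((y : Equiv.Perm (RoomSpace E)) z)))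
    rcases z with ⟨⟨⟨_ | _, k⟩, x⟩, hx⟩
    · rcases k with _ | k
      · exact Subtype.ext (Prod.ext rfl (hws 0 x).symm)
      · rw [hu1, hb1, hu2 _ _ _ (hw (k + 1) x hx).1, hω1]
        exact Subtype.ext (Prod.ext rfl (hws (k + 1) x).symm)
    · have hr : (σ : Equiv.Perm (RoomSpace E)) ((y : Equiv.Perm (RoomSpace E))
          ((b : Equiv.Perm (RoomSpace E)) ((y : Equiv.Perm (RoomSpace E)) ⟨((true, k), x), hx⟩))) =
          ⟨((true, k), x), hx⟩ := rfl
      rw [hr]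
      by_cases hx' : x ∈ E (k + 1)
      · rw [hu2 k x hx hx', hb2, hu1, hω2]
      · rw [hu3 k x hx hx', hb1]
        simp only [hfix k x hx hx']
        rw [hu3 k x hx hx', hω2]

end Rooms

end Odometer

/-! ### Continuity from involutions to all elements -/

namespace Odometer

theorem mem_of_fixes_compl {g : borelFullGroup} {A : Set X}
    (h : ∀ x ∉ A, (g : Equiv.Perm X) x = x) {x : X} (hx : x ∈ A) : (g : Equiv.Perm X) x ∈ A := by
  by_contra h'
  have := h _ h'
  rw [EmbeddingLike.apply_eq_iff_eq] at this
  exact h' (this.symm ▸ hx)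

theorem inv_fixes {g : borelFullGroup} {x : X} (h : (g : Equiv.Perm X) x = x) :
    ((g⁻¹ : borelFullGroup) : Equiv.Perm X) x = x := by
  conv_lhs => rw [← h]
  exact coe_inv_apply_self g x

/-- A sequence of successive reductions. -/
theorem exists_reduction_sequence (w₀ : borelFullGroup) : ∃ w s : ℕ → borelFullGroup, w 0 = w₀ ∧
    (∀ k, w (k + 1) = s k * w k) ∧ (∀ k x, (s k : Equiv.Perm X) ((s k : Equiv.Perm X) x) = x) ∧
    (∀ k x, (w k : Equiv.Perm X) x = x → (s k : Equiv.Perm X) x = x) ∧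
    ∀ k, μ.real (fixSet (w k))ᶜ ≤ μ.real (fixSet w₀)ᶜ * (2 / 3) ^ k := by
  choose red h1 h2 h3 using exists_reduction
  let w : ℕ → borelFullGroup := fun k => Nat.rec w₀ (fun _ v => red v * v) k
  refine ⟨w, fun k => red (w k), rfl, fun k => rfl, fun k => h1 _, fun k => h2 _, fun k => ?_⟩
  induction k with
  | zero => simp [w]
  | succ k ih =>
    have := h3 (w k)
    change μ.real (fixSet (red (w k) * w k))ᶜ ≤ _
    rw [pow_succ]
    linarith

theorem tsum_rooms_le {E : ℕ → Set X} {a : ℝ} (ha : 0 ≤ a)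
    (h : ∀ k, μ.real (E k) ≤ a * (2 / 3) ^ k) :
    ∑' r : Bool × ℕ, μ (E r.2) ≤ ENNReal.ofReal (6 * a) := by
  have h1 : ∑' k, μ (E k) ≤ ENNReal.ofReal (3 * a) := by
    have hg : HasSum (fun k : ℕ => a * (2 / 3 : ℝ) ^ k) (3 * a) := by
      have := (hasSum_geometric_of_lt_one (r := (2 / 3 : ℝ)) (by norm_num) (by norm_num)).mul_left a
      rwa [show (1 - 2 / 3 : ℝ)⁻¹ = 3 by norm_num, mul_comm] at this
    rw [← hg.tsum_eq, ENNReal.ofReal_tsum_of_nonneg (fun k => by positivity) hg.summable]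
    refine ENNReal.tsum_le_tsum fun k => ?_
    rw [← ofReal_measureReal]
    exact ENNReal.ofReal_le_ofReal (h k)
  rw [ENNReal.tsum_prod', tsum_bool]
  calc ∑' k, μ (E k) + ∑' k, μ (E k) ≤ ENNReal.ofReal (3 * a) + ENNReal.ofReal (3 * a) :=
        add_le_add h1 h1
    _ = ENNReal.ofReal (6 * a) := by
        rw [← ENNReal.ofReal_add (by positivity) (by positivity)]; congr 1; ring

/-- Pairwise disjoint exact copies of countably many sets of small total measure, after restriction
to an invariant conull set. -/
theorem exists_rooms {E : ℕ → Set X} (hE : ∀ k, MeasurableSet (E k))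
    (h : ∑' r : Bool × ℕ, μ (E r.2) ≤ 1) :
    ∃ (θ : Bool × ℕ → borelFullGroup) (Y : Set X), MeasurableSet Y ∧ (∀ᵐ x ∂μ, x ∈ Y) ∧
      (∀ x ∈ Y, ∀ y ∈ orbit x, y ∈ Y) ∧
      Function.Injective (roomMap (E := fun k => E k ∩ Y) θ) := by
  let e : ℕ ≃ Bool × ℕ := Equiv.boolProdNatEquivNat.symm
  obtain ⟨D, hDm, hDμ, hDd⟩ := exists_disjoint_sequence (a := fun n => μ.real (E (e n).2))
    (fun n => measureReal_nonneg) (fun n => by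
      have h1 : ∑ i ∈ Finset.range n, μ (E (e i).2) ≤ 1 := by
        refine (ENNReal.sum_le_tsum _).trans ?_
        rwa [Equiv.tsum_eq e fun r => μ (E r.2)]
      have h2 := ENNReal.toReal_mono ENNReal.one_ne_top h1
      rw [ENNReal.toReal_sum fun i _ => measure_ne_top _ _, ENNReal.toReal_one] at h2
      exact h2)
  have ht : ∀ r : Bool × ℕ, ∃ θ : borelFullGroup, ∀ᵐ x ∂μ,
      (x ∈ E r.2 ↔ (θ : Equiv.Perm X) x ∈ D (e.symm r)) := by
    intro r
    obtain ⟨θ, hθ⟩ := exists_transport {()} (fun _ => E r.2) (fun _ => D (e.symm r))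
      (fun _ _ => hE _) (fun _ _ => hDm _) (fun a _ b _ h => absurd (Subsingleton.elim a b) h)
      (fun a _ b _ h => absurd (Subsingleton.elim a b) h) (fun _ _ => by
        rw [← measureReal_eq_measureReal_iff, hDμ, Equiv.apply_symm_apply])
    exact ⟨θ, hθ () (by simp)⟩
  choose θ hθ using ht
  -- On Y the rooms go exactly, not just almost everywhere, into disjoint sets, which makes the room
  -- map injective.
  obtain ⟨Y, hYm, hYae, hYo, hY⟩ := exists_invariant_conull (ae_all_iff.2 hθ)
  refine ⟨θ, Y, hYm, hYae, hYo, ?_⟩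
  rintro ⟨⟨r, x⟩, hx⟩ ⟨⟨r', x'⟩, hx'⟩ heq
  change (θ r : Equiv.Perm X) x = (θ r' : Equiv.Perm X) x' at heq
  have h1 := (hY x hx.2 r).1 hx.1
  have h2 := (hY x' hx'.2 r').1 hx'.1
  have hr : r = r' := by
    by_contra hne
    refine Set.disjoint_left.1 (hDd _ _ fun h => hne (e.symm.injective h)) h1 ?_
    rwa [heq]
  subst hr
  rw [EmbeddingLike.apply_eq_iff_eq] at heq
  subst heq
  rfl

/-- An element of small support is, up to conjugation, a product of conjugates of five involutions of
small support. -/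
theorem exists_swindle (w₀ : borelFullGroup) (h : 6 * μ.real (fixSet w₀)ᶜ ≤ 1) :
    ∃ θ σ y u b : FullGroup, σ * σ = 1 ∧ y * y = 1 ∧ u * u = 1 ∧
      1 - fixMeasure σ ≤ 6 * μ.real (fixSet w₀)ᶜ ∧ 1 - fixMeasure y ≤ 6 * μ.real (fixSet w₀)ᶜ ∧
      1 - fixMeasure u ≤ 6 * μ.real (fixSet w₀)ᶜ ∧
      θ * (w₀ : FullGroup) * θ⁻¹ * (u * b * u) = σ * (y * b * y) := by
  classical
  obtain ⟨w, s, hw0, hws, hsi, hsf, hμ⟩ := exists_reduction_sequence w₀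
  set a := μ.real (fixSet w₀)ᶜ with ha
  have ha0 : 0 ≤ a := measureReal_nonneg
  have htot := tsum_rooms_le ha0 hμ
  obtain ⟨θ, Y, hYm, hYae, hYo, hinj⟩ := exists_rooms (E := fun k => (fixSet (w k))ᶜ)
    (fun k => (measurableSet_fixSet _).compl)
    (htot.trans (by rw [← ENNReal.ofReal_one]; exact ENNReal.ofReal_le_ofReal h))
  set E : ℕ → Set X := fun k => (fixSet (w k))ᶜ ∩ Y with hE
  have hEm : ∀ k, MeasurableSet (E k) := fun k => (measurableSet_fixSet _).compl.inter hYm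
  have hEtot : ∑' r : Bool × ℕ, μ (E r.2) ≤ ENNReal.ofReal (6 * a) :=
    (ENNReal.tsum_le_tsum fun r => measure_mono Set.inter_subset_left).trans htot
  have hwfix : ∀ k x, (w k : Equiv.Perm X) x = x → (w (k + 1) : Equiv.Perm X) x = x := by
    intro k x hx
    rw [hws, coe_mul_apply, hx, hsf k x hx]
  obtain ⟨ω, σ, y, u, b, hσ, hy, hu, hid, hω⟩ := room_identity hEm
    (fun k x hx => ⟨fun h' => hx.1 (hwfix k x h'), hx.2⟩) w s
    (fun k x => by rw [hws, coe_mul_apply, hsi]) hsi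
    (fun k x hx hx' => by
      by_contra h'
      exact hx' ⟨h', hx.2⟩)
    (fun k x hx => ⟨⟨mem_of_fixes_compl (fun z hz => not_not.1 hz) hx.1,
        hYo x hx.2 _ (coe_mem_orbit _ _)⟩,
      ⟨mem_of_fixes_compl (fun z hz => inv_fixes (not_not.1 hz)) hx.1,
        hYo x hx.2 _ (coe_mem_orbit _ _)⟩⟩)
    (fun k x hx => ⟨mem_of_fixes_compl (fun z hz => hsf k z (not_not.1 hz)) hx.1,
        hYo x hx.2 _ (coe_mem_orbit _ _)⟩)
  let Φ : roomGroup E →* FullGroup := (QuotientGroup.mk' nullSubgroup).comp (roomHom hEm hinj)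
  have hsmall : ∀ p : roomGroup E, 1 - fixMeasure (Φ p) ≤ 6 * a := fun p =>
    fixMeasure_roomHom hEm hinj p (by positivity) hEtot
  -- The room (false, 0) is, up to a null set, the support of w₀ placed by θ (false, 0), and ω is w₀
  -- there.
  have hωw : Φ ω = (θ (false, 0) : FullGroup) * (w₀ : FullGroup) * (θ (false, 0) : FullGroup)⁻¹ := by
    change ((roomHom hEm hinj ω : borelFullGroup) : FullGroup) =
      ((θ (false, 0) * w₀ * (θ (false, 0))⁻¹ : borelFullGroup) : FullGroup)
    rw [mk_eq_iff_ae]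
    filter_upwards [ae_apply (θ (false, 0))⁻¹ hYae] with x hx
    set x' := (((θ (false, 0))⁻¹ : borelFullGroup) : Equiv.Perm X) x with hx'
    have hxx' : (θ (false, 0) : Equiv.Perm X) x' = x := coe_apply_inv_self _ _
    rw [coe_mul_apply, coe_mul_apply, ← hx']
    by_cases hmv : (w₀ : Equiv.Perm X) x' = x'
    · rw [hmv, hxx']
      by_cases hr : x ∈ Set.range (roomMap (E := E) θ)
      · obtain ⟨z, hz⟩ := hr
        rw [← hz, roomHom_apply]
        congr 1
        refine Subtype.ext ?_
        rw [hω]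
        refine Prod.ext rfl ?_
        by_cases hz0 : z.1.1 = (false, 0)
        · exfalso
          have h1 : z.1.2 = x' := by
            rw [hx', ← hz, roomMap, hz0, coe_inv_apply_self]
          have h2 := z.2.1
          rw [hz0, h1, hw0] at h2
          exact h2 hmv
        · change ((if z.1.1 = (false, 0) then w 0 else 1 : borelFullGroup) : Equiv.Perm X) z.1.2 = _
          rw [if_neg hz0]; rfl
      · exact roomHom_apply_of_notMem hEm hinj ω hr
    · have hmem : x' ∈ E 0 := ⟨by rw [hw0]; exact hmv, hx⟩
      have h1 := roomHom_apply hEm hinj ω ⟨((false, 0), x'), hmem⟩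
      have h2 : roomMap (E := E) θ ⟨((false, 0), x'), hmem⟩ = x := hxx'
      rw [h2] at h1
      rw [h1, roomMap, hω]
      simp only [if_true, hw0]
  refine ⟨θ (false, 0), Φ σ, Φ y, Φ u, Φ b, ?_, ?_, ?_, hsmall σ, hsmall y, hsmall u, ?_⟩
  · rw [← map_mul, hσ, map_one]
  · rw [← map_mul, hy, map_one]
  · rw [← map_mul, hu, map_one]
  · rw [← hωw, ← map_mul, ← map_mul, ← map_mul, ← map_mul, ← map_mul, ← map_mul, hid]

/-- Continuity along involutions implies continuity. -/
theorem continuity_of_involutions {ψ : FullGroup → ℂ} (hψ : IsCentralPD ψ)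
    (hinv : ∀ ε > 0, ∃ δ > 0, ∀ s : FullGroup, s * s = 1 → 1 - fixMeasure s ≤ δ →
      nm ψ (el s - 1) ≤ ε) {ε : ℝ} (hε : 0 < ε) :
    ∃ δ > 0, ∀ g : FullGroup, 1 - fixMeasure g ≤ δ → nm ψ (el g - 1) ≤ ε := by
  -- Five involutive factors share ε. The rooms have total measure at most 6 times that of the
  -- support, which explains δ / 6, and 1 / 6 makes them fit into X.
  obtain ⟨δ, hδ, h⟩ := hinv (ε / 5) (by positivity)
  refine ⟨min (δ / 6) (1 / 6), by positivity, fun g hg => ?_⟩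
  obtain ⟨w, rfl⟩ := exists_mk_eq g
  have hw : 1 - fixMeasure (w : FullGroup) = μ.real (fixSet w)ᶜ := by
    rw [fixMeasure_mk, probReal_compl_eq_one_sub (measurableSet_fixSet w)]
  rw [hw, le_min_iff] at hg
  obtain ⟨θ, σ, y, u, b, hσ, hy, hu, mσ, my, mu, hid⟩ := exists_swindle w (by linarith [hg.2])
  have lσ := h σ hσ (by linarith [hg.1])
  have ly := h y hy (by linarith [hg.1])
  have lu := h u hu (by linarith [hg.1])
  have hy' : y⁻¹ = y := inv_eq_of_mul_eq_one_left hy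
  have hu' : u⁻¹ = u := inv_eq_of_mul_eq_one_left hu
  -- No bound on b is available or needed: it enters only through conjugations.
  have e : θ * (w : FullGroup) * θ⁻¹ = σ * ((y * (b * y * b⁻¹)) * (b * (u * b⁻¹ * u⁻¹))) := by
    rw [← mul_inv_eq_iff_eq_mul.2 hid.symm]
    simp only [mul_inv_rev, hu']
    group
  rw [← hψ.nm_el_conj_sub_one θ, e]
  have h1 := hψ.nm_el_mul_sub_one_le σ ((y * (b * y * b⁻¹)) * (b * (u * b⁻¹ * u⁻¹)))
  have h2 := hψ.nm_el_mul_sub_one_le (y * (b * y * b⁻¹)) (b * (u * b⁻¹ * u⁻¹))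
  have h3 := hψ.nm_el_mul_sub_one_le y (b * y * b⁻¹)
  rw [hψ.nm_el_conj_sub_one] at h3
  have h4 := hψ.nm_el_mul_conj_le b u
  linarith

end Odometer

/-! ### Density of word permutations -/

namespace Odometer

open Filter Topology

/-- Membership depends only on the first `N` coordinates. -/
def DependsOnPrefix (N : ℕ) (B : Set X) : Prop := ∀ x y : X, pre N x = pre N y → (x ∈ B ↔ y ∈ B)

theorem pre_eq_of_le {m n : ℕ} (h : m ≤ n) {x y : X} (hxy : pre n x = pre n y) : pre m x = pre m y := by
  funext i
  exact congrFun hxy ⟨i, i.2.trans_le h⟩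

theorem DependsOnPrefix.mono {m n : ℕ} (h : m ≤ n) {B : Set X} (hB : DependsOnPrefix m B) :
    DependsOnPrefix n B := fun x y hxy => hB x y (pre_eq_of_le h hxy)

theorem DependsOnPrefix.measurableSet {N : ℕ} {B : Set X} (hB : DependsOnPrefix N B) :
    MeasurableSet B := by
  have : B = {x | pre N x ∈ pre N '' B} := by
    ext x
    constructor
    · exact fun hx => ⟨x, hx, rfl⟩
    · rintro ⟨y, hy, hxy⟩
      exact (hB y x hxy).1 hy
  rw [this]
  exact measurableSet_pre N _

/-- Sets determined by finitely many coordinates form an algebra generating the σ-algebra. -/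
theorem exists_dependsOnPrefix_approx {A : Set X} (hA : MeasurableSet A) {ε : ℝ} (hε : 0 < ε) :
    ∃ N B, DependsOnPrefix N B ∧ μ (symmDiff A B) < ENNReal.ofReal ε := by
  have h1 : IsSetAlgebra {B : Set X | ∃ N, DependsOnPrefix N B} := by
    refine ⟨⟨0, fun x y _ => Iff.rfl⟩, ?_, ?_⟩
    · rintro s ⟨N, hN⟩
      exact ⟨N, fun x y h => not_congr (hN x y h)⟩
    · rintro s t ⟨N, hN⟩ ⟨M, hM⟩
      exact ⟨max N M, fun x y h => or_congr (hN.mono (le_max_left _ _) x y h)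
        (hM.mono (le_max_right _ _) x y h)⟩
  have h2 : (MeasurableSpace.pi : MeasurableSpace X) =
      MeasurableSpace.generateFrom {B : Set X | ∃ N, DependsOnPrefix N B} := by
    apply le_antisymm
    · rw [generateFrom_cyl]
      refine MeasurableSpace.generateFrom_mono ?_
      rintro _ ⟨n, a, rfl⟩
      refine ⟨n, fun x y h => forall₂_congr fun i hi => ?_⟩
      rw [show x i = y i from congrFun h ⟨i, hi⟩]
    · refine MeasurableSpace.generateFrom_le ?_
      rintro B ⟨N, hN⟩
      exact hN.measurableSet
  obtain ⟨B, ⟨N, hN⟩, hB⟩ := (Measure.MeasureDense.of_generateFrom_isSetAlgebra_finite μ h1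
    h2).approx A hA (measure_ne_top _ _) ε hε
  exact ⟨N, B, hN, hB⟩

/-- A measurable function with finitely many values is close to a function of finitely many
coordinates. -/
theorem exists_prefix_approx {P : Type*} [Finite P] [Nonempty P] (f : X → P)
    (hf : ∀ p, MeasurableSet (f ⁻¹' {p})) (n : ℕ) {ε : ℝ} (hε : 0 < ε) :
    ∃ N, n ≤ N ∧ ∃ f' : (Fin N → Bool) → P, μ {x | f x ≠ f' (pre N x)} ≤ ENNReal.ofReal ε := by
  classical
  have := Fintype.ofFinite P
  have hc : (0 : ℝ) < Fintype.card P := by exact_mod_cast Fintype.card_pos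
  choose N B hN hB using fun p =>
    exists_dependsOnPrefix_approx (hf p) (ε := ε / Fintype.card P) (by positivity)
  set N' := max n (Finset.univ.sup N) with hN'
  have hdep : ∀ p, DependsOnPrefix N' (B p) := fun p =>
    (hN p).mono ((Finset.le_sup (Finset.mem_univ p)).trans (le_max_right _ _))
  let f' : (Fin N' → Bool) → P := fun v =>
    if h : ∃ p, ∃ x ∈ B p, pre N' x = v then h.choose else Classical.arbitrary P
  refine ⟨N', le_max_left _ _, f', ?_⟩
  have hsub : {x | f x ≠ f' (pre N' x)} ⊆ ⋃ p, symmDiff (f ⁻¹' {p}) (B p) := by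
    intro x hx
    by_contra h
    have h' : ∀ p, f x = p ↔ x ∈ B p := by
      intro p
      by_contra h2
      refine h (Set.mem_iUnion.2 ⟨p, ?_⟩)
      rw [Set.mem_symmDiff]
      change (f x = p ∧ _) ∨ (_ ∧ ¬ f x = p)
      tauto
    apply hx
    have hex : ∃ p, ∃ y ∈ B p, pre N' y = pre N' x := ⟨f x, x, (h' _).1 rfl, rfl⟩
    have hfx : f' (pre N' x) = hex.choose := dif_pos hex
    obtain ⟨y, hy, hyx⟩ := hex.choose_spec
    rw [hfx]
    exact (h' _).2 ((hdep _ y x hyx).1 hy)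
  calc μ {x | f x ≠ f' (pre N' x)} ≤ ∑ p, μ (symmDiff (f ⁻¹' {p}) (B p)) :=
        (measure_mono hsub).trans (measure_iUnion_fintype_le _ _)
    _ ≤ ∑ _p : P, ENNReal.ofReal (ε / Fintype.card P) := Finset.sum_le_sum fun p _ => (hB p).le
    _ = ENNReal.ofReal ε := by
        rw [Finset.sum_const, Finset.card_univ, nsmul_eq_mul, ← ENNReal.ofReal_natCast,
          ← ENNReal.ofReal_mul (by positivity)]
        congr 1
        field_simp

/-- Almost every point of an orbit differs from the base point in finitely many coordinates. -/
theorem ae_tail_eq : ∀ᵐ x ∂μ, ∀ y ∈ orbit x, ∃ n, ∀ i, n ≤ i → y i = x i := by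
  -- Adding 1 changes infinitely many digits only at the all-ones point, whose orbit is null.
  have h1 : ∀ᵐ x ∂μ, ∀ k : ℤ, (T ^ k) x ≠ fun _ => true := by
    rw [ae_all_iff]
    intro k
    have := null_preimage_zpow k (measure_singleton_eq_zero fun _ => true)
    exact measure_eq_zero_iff_ae_notMem.1 this
  filter_upwards [h1] with x hx
  have step : ∀ k : ℤ, ∃ n, ∀ i, n ≤ i → (T ^ (k + 1)) x i = (T ^ k) x i := by
    intro k
    obtain ⟨m, hm⟩ := Function.ne_iff.1 (hx k)
    refine ⟨m + 1, fun i hi => ?_⟩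
    rw [add_comm, zpow_add, zpow_one, Equiv.Perm.mul_apply]
    change addOne _ i = _
    rw [addOne, if_neg]
    intro h
    exact hm (h m (by omega))
  rintro _ ⟨k, rfl⟩
  induction k with
  | zero => exact ⟨0, fun i _ => rfl⟩
  | succ k ih =>
    obtain ⟨n, hn⟩ := ih
    obtain ⟨m, hm⟩ := step k
    exact ⟨max n m, fun i hi => by
      rw [hm i (le_of_max_le_right hi), hn i (le_of_max_le_left hi)]⟩
  | pred k ih =>
    obtain ⟨n, hn⟩ := ih
    obtain ⟨m, hm⟩ := step (-k - 1)
    rw [sub_add_cancel] at hm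
    exact ⟨max n m, fun i hi => by
      rw [← hm i (le_of_max_le_right hi), hn i (le_of_max_le_left hi)]⟩

/-- A partial injection of a finite type extends to a permutation. -/
theorem exists_perm_extending {W : Type*} [Finite W] (q : Set (W × W))
    (h1 : ∀ w v v', (w, v) ∈ q → (w, v') ∈ q → v = v')
    (h2 : ∀ w w' v, (w, v) ∈ q → (w', v) ∈ q → w = w') :
    ∃ S : Equiv.Perm W, ∀ w v, (w, v) ∈ q → S w = v := by
  classical
  have := Fintype.ofFinite W
  let f : W → W := fun w => if h : ∃ v, (w, v) ∈ q then h.choose else w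
  have hf : ∀ w v, (w, v) ∈ q → f w = v := by
    intro w v hv
    have h : ∃ v, (w, v) ∈ q := ⟨v, hv⟩
    have : f w = h.choose := dif_pos h
    rw [this]
    exact h1 w _ _ h.choose_spec hv
  obtain ⟨g, hg⟩ := Finset.exists_equiv_extend_of_card_eq (α := W) (β := W) (t := Finset.univ)
    (s := Finset.univ.filter fun w => ∃ v, (w, v) ∈ q) (f := f) rfl (Finset.subset_univ _) (by
      intro w hw w' hw' he
      simp only [Finset.coe_filter, Finset.mem_univ, true_and, Set.mem_ofPred_eq] at hw hw'
      obtain ⟨v, hv⟩ := hw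
      obtain ⟨v', hv'⟩ := hw'
      rw [hf w v hv, hf w' v' hv'] at he
      subst he
      exact h2 w w' v hv hv')
  refine ⟨g.trans (Equiv.subtypeUnivEquiv Finset.mem_univ), fun w v hv => ?_⟩
  rw [← hf w v hv]
  exact hg w (by simpa using ⟨v, hv⟩)

/-- On each of the 2ⁿ cylinders the map coincides with a measure-preserving word swap. -/
theorem measure_preimage_putPre_le (n : ℕ) (w₀ : Fin n → Bool) {B : Set X} (hB : MeasurableSet B) :
    μ (putPre n w₀ ⁻¹' B) ≤ 2 ^ n * μ B := by
  have h : putPre n w₀ ⁻¹' B ⊆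
      ⋃ w, (liftBorel n (Equiv.swap w w₀) : Equiv.Perm X) ⁻¹' B := by
    intro x hx
    refine Set.mem_iUnion.2 ⟨pre n x, ?_⟩
    rw [Set.mem_preimage, liftBorel_apply, Equiv.swap_apply_left]
    exact hx
  refine (measure_mono h).trans ((measure_iUnion_fintype_le _ _).trans ?_)
  simp only [measure_preimage_coe _ hB, Finset.sum_const, Finset.card_univ, nsmul_eq_mul]
  simp

/-- An injective map acting on the first `N` coordinates comes from a permutation of words. -/
theorem exists_lift_eq (N : ℕ) (h : X → X) (hinj : Function.Injective h)
    (htail : ∀ x i, N ≤ i → h x i = x i) (hpre : ∀ x y, pre N x = pre N y → pre N (h x) = pre N (h y)) :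
    ∃ σ : Equiv.Perm (Fin N → Bool), ∀ x, (liftBorel N σ : Equiv.Perm X) x = h x := by
  set z : X := fun _ => false
  let f : (Fin N → Bool) → Fin N → Bool := fun v => pre N (h (putPre N v z))
  have hf : Function.Injective f := by
    intro v v' hv
    have : h (putPre N v z) = h (putPre N v' z) := by
      funext i
      by_cases hi : i < N
      · exact congrFun hv ⟨i, hi⟩
      · rw [htail _ i (not_lt.1 hi), htail _ i (not_lt.1 hi)]
        simp [putPre, hi]
    rw [← pre_putPre N v z, hinj this, pre_putPre]
  refine ⟨Equiv.ofBijective f (Finite.injective_iff_bijective.1 hf), fun x => ?_⟩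
  rw [liftBorel_apply, Equiv.ofBijective_apply]
  have : f (pre N x) = pre N (h x) := hpre _ _ (pre_putPre N _ _)
  rw [this]
  funext i
  by_cases hi : i < N
  · simp [putPre, hi, pre]
  · simp only [putPre, dif_neg hi]
    exact (htail x i (not_lt.1 hi)).symm

/-- The permutations of words are dense in the full group. -/
theorem exists_lift_close (g : borelFullGroup) {ε : ℝ} (hε : 0 < ε) :
    ∃ N, ∃ σ : Equiv.Perm (Fin N → Bool),
      μ {x | (g : Equiv.Perm X) x ≠ (liftBorel N σ : Equiv.Perm X) x} ≤ ENNReal.ofReal ε := by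
  classical
  let A : ℕ → Set X := fun n => {x | ∀ i, n ≤ i → (g : Equiv.Perm X) x i = x i}
  have hAm : ∀ n, MeasurableSet (A n) := by
    intro n
    have : A n = ⋂ i : ℕ, ⋂ _ : n ≤ i, {x | (g : Equiv.Perm X) x i = x i} := by
      ext x; simp [A]
    rw [this]
    refine MeasurableSet.iInter fun i => MeasurableSet.iInter fun _ => ?_
    exact measurableSet_eq_fun
      ((measurable_pi_apply (X := fun _ : ℕ => Bool) i).comp (coe_measurable g))
      (measurable_pi_apply (X := fun _ : ℕ => Bool) i)
  have hlim : Tendsto (fun n => μ (A n)ᶜ) atTop (𝓝 (μ (⋂ n, (A n)ᶜ))) :=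
    tendsto_measure_iInter_atTop (fun n => (hAm n).compl.nullMeasurableSet)
      (fun m n h x hx hx' => hx fun i hi => hx' i (h.trans hi)) ⟨0, measure_ne_top _ _⟩
  have h0 : μ (⋂ n, (A n)ᶜ) = 0 := by
    refine measure_eq_zero_iff_ae_notMem.2 ?_
    filter_upwards [ae_tail_eq] with x hx hx'
    obtain ⟨n, hn⟩ := hx _ (coe_mem_orbit g x)
    exact Set.mem_iInter.1 hx' n hn
  rw [h0] at hlim
  obtain ⟨n, hn⟩ := (hlim.eventually_lt_const
    (show (0 : ENNReal) < ENNReal.ofReal (ε / 2) by simpa using hε)).exists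
  have hgA : ∀ x ∈ A n, (g : Equiv.Perm X) x = putPre n (pre n ((g : Equiv.Perm X) x)) x := by
    intro x hx
    funext i
    by_cases hi : i < n
    · simp [putPre, hi, pre]
    · simp only [putPre, dif_neg hi]
      exact hx i (not_lt.1 hi)
  -- For each tail, the partial injection that g induces on the first n digits at points of A n. It
  -- takes finitely many values and ignores those digits of x.
  let R : X → Set ((Fin n → Bool) × (Fin n → Bool)) := fun x =>
    {p | putPre n p.1 x ∈ A n ∧ pre n ((g : Equiv.Perm X) (putPre n p.1 x)) = p.2}
  have hRm : ∀ q, MeasurableSet (R ⁻¹' {q}) := by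
    intro q
    have : R ⁻¹' {q} = ⋂ p : (Fin n → Bool) × (Fin n → Bool), {x | p ∈ R x ↔ p ∈ q} := by
      ext x; simp [Set.ext_iff]
    rw [this]
    refine MeasurableSet.iInter fun p => ?_
    have hp : MeasurableSet {x | p ∈ R x} := by
      have m1 : Measurable (putPre n p.1) := measurable_putPre n fun _ => p.1
      exact (m1 (hAm n)).inter (((measurable_pre n).comp ((coe_measurable g).comp m1))
        (measurableSet_singleton p.2))
    by_cases hpq : p ∈ q
    · simpa [hpq] using hp
    · have e : {x | p ∈ R x ↔ p ∈ q} = {x | p ∈ R x}ᶜ := by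
        ext x; simp [hpq]
      rw [e]
      exact hp.compl
  have hRinv : ∀ w x, R (putPre n w x) = R x := by
    intro w x
    ext p
    simp only [R, Set.mem_ofPred_eq, putPre_putPre]
  have hgood : ∀ x, ∃ S : Equiv.Perm (Fin n → Bool), ∀ w v, (w, v) ∈ R x → S w = v := by
    intro x
    refine exists_perm_extending _ (fun w v v' h h' => h.2.symm.trans h'.2) fun w w' v h h' => ?_
    have e1 := hgA _ h.1
    have e2 := hgA _ h'.1
    rw [h.2, putPre_putPre] at e1
    rw [h'.2, putPre_putPre] at e2
    have := (g : Equiv.Perm X).injective (e1.trans e2.symm)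
    rw [← pre_putPre n w x, this, pre_putPre]
  let ext : Set ((Fin n → Bool) × (Fin n → Bool)) → Equiv.Perm (Fin n → Bool) := fun q =>
    if h : ∃ S : Equiv.Perm (Fin n → Bool), ∀ w v, (w, v) ∈ q → S w = v then h.choose else 1
  have hext : ∀ x w v, (w, v) ∈ R x → ext (R x) w = v := by
    intro x w v h
    have : ext (R x) = (hgood x).choose := dif_pos (hgood x)
    rw [this]
    exact (hgood x).choose_spec w v h
  -- The factor 2ⁿ pays for evaluating R' below at a point whose first n digits have been
  -- overwritten.
  obtain ⟨N, hnN, R', hR'⟩ := exists_prefix_approx R hRm n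
    (ε := ε / 2 / 2 ^ n) (by positivity)
  let w₀ : Fin n → Bool := fun _ => false
  -- Overwriting the first n digits before reading R' makes the chosen permutation depend on the
  -- tail only; this keeps h injective.
  let h : X → X := fun x => putPre n (ext (R' (pre N (putPre n w₀ x))) (pre n x)) x
  have hputN : ∀ x y, pre N x = pre N y → pre N (putPre n w₀ x) = pre N (putPre n w₀ y) := by
    intro x y hxy
    funext i
    by_cases hi : (i : ℕ) < n
    · simp [pre, putPre, hi]
    · simp only [pre, putPre, dif_neg hi]
      exact congrFun hxy i
  obtain ⟨σ, hσ⟩ := exists_lift_eq N h (by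
      intro x y hxy
      have e1 : putPre n w₀ x = putPre n w₀ y := by
        have := congrArg (putPre n w₀) hxy
        simpa only [h, putPre_putPre] using this
      have e2 := congrArg (pre n) hxy
      simp only [h, pre_putPre, e1] at e2
      have e3 : pre n x = pre n y := Equiv.injective _ e2
      rw [← putPre_pre n x, ← putPre_putPre n _ w₀ x, e1, e3, putPre_putPre, putPre_pre])
    (by
      intro x i hi
      simp [h, putPre, not_lt.2 (hnN.trans hi)])
    (by
      intro x y hxy
      funext i
      simp only [h, pre, putPre]
      have e1 := hputN x y hxy
      have e2 := pre_eq_of_le hnN hxy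
      by_cases hi : (i : ℕ) < n
      · simp only [dif_pos hi]
        change ext (R' (pre N (putPre n w₀ x))) (pre n x) _ =
          ext (R' (pre N (putPre n w₀ y))) (pre n y) _
        rw [e1, e2]
      · simp only [dif_neg hi]
        exact congrFun hxy i)
  refine ⟨N, σ, ?_⟩
  have hbad : MeasurableSet {x | R x ≠ R' (pre N x)} := by
    have : {x | R x ≠ R' (pre N x)} = ⋃ q, (R ⁻¹' {q} ∩ {x | pre N x ∈ {v | R' v ≠ q}}) := by
      ext x
      simp only [Set.mem_iUnion, Set.mem_inter_iff, Set.mem_preimage, Set.mem_singleton_iff,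
        Set.mem_ofPred_eq]
      constructor
      · exact fun hx => ⟨R x, rfl, fun h' => hx h'.symm⟩
      · rintro ⟨q, rfl, hq⟩ h'
        exact hq h'.symm
    rw [this]
    exact MeasurableSet.iUnion fun q => (hRm q).inter (measurableSet_pre N _)
  have hsub : {x | (g : Equiv.Perm X) x ≠ (liftBorel N σ : Equiv.Perm X) x} ⊆
      (A n)ᶜ ∪ putPre n w₀ ⁻¹' {x | R x ≠ R' (pre N x)} := by
    intro x hx
    by_contra hc
    rw [Set.mem_union, not_or, Set.mem_compl_iff, not_not] at hc
    obtain ⟨hxA, hxR⟩ := hc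
    have hxR' : R (putPre n w₀ x) = R' (pre N (putPre n w₀ x)) := not_not.1 hxR
    rw [hRinv] at hxR'
    apply hx
    rw [hσ, hgA x hxA]
    simp only [h]
    rw [← hxR', hext x (pre n x) (pre n ((g : Equiv.Perm X) x))]
    refine ⟨?_, ?_⟩
    · simpa only [putPre_pre] using hxA
    · simp only [putPre_pre]
  calc _ ≤ μ (A n)ᶜ + μ (putPre n w₀ ⁻¹' {x | R x ≠ R' (pre N x)}) :=
        (measure_mono hsub).trans (measure_union_le _ _)
    _ ≤ ENNReal.ofReal (ε / 2) + 2 ^ n * ENNReal.ofReal (ε / 2 / 2 ^ n) :=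
        add_le_add hn.le ((measure_preimage_putPre_le n w₀ hbad).trans
          (mul_le_mul_right hR' _))
    _ = ENNReal.ofReal ε := by
        rw [show (2 : ENNReal) ^ n = ENNReal.ofReal (2 ^ n) by
          rw [ENNReal.ofReal_pow (by norm_num)]; simp,
          ← ENNReal.ofReal_mul (by positivity), ← ENNReal.ofReal_add (by positivity) (by positivity)]
        congr 1
        field_simp
        norm_num

end Odometer

/-! ### Sums and limits of positive definite functions -/

section Closure

open Filter Topology
open scoped ComplexOrder

variable {G : Type*} [Group G] {φ ψ : G → ℂ}

theorem IsCentralPD.add (hφ : IsCentralPD φ) (hψ : IsCentralPD ψ) :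
    IsCentralPD fun g => φ g + ψ g := by
  refine ⟨fun g h => by simp only [hφ.central g h, hψ.central g h], fun x => ?_⟩
  have e : tr (fun g => φ g + ψ g) (gstar x * x) = tr φ (gstar x * x) + tr ψ (gstar x * x) := by
    have := tr_sub_left (fun g => φ g + ψ g) ψ (gstar x * x)
    simp only [add_sub_cancel_right] at this
    rw [this, sub_add_cancel]
  rw [e]
  exact add_nonneg (hφ.nonneg x) (hψ.nonneg x)

theorem IsCentralPD.const_mul (hφ : IsCentralPD φ) {a : ℝ} (ha : 0 ≤ a) :
    IsCentralPD fun g => (a : ℂ) * φ g := by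
  refine ⟨fun g h => by simp only [hφ.central g h], fun x => ?_⟩
  have e : ∀ y, tr (fun g => (a : ℂ) * φ g) y = a * tr φ y := by
    intro y
    induction y using alg_induction with
    | h0 => simp
    | ha x y hx hy => rw [tr_add, tr_add, hx, hy, mul_add]
    | hs g b => simp only [tr_single]; ring
  rw [e]
  exact mul_nonneg (Complex.zero_le_real.2 ha) (hφ.nonneg x)

theorem IsCentralPD.sum {Φ : ℕ → G → ℂ} (h : ∀ k, IsCentralPD (Φ k)) (n : ℕ) :
    IsCentralPD fun g => ∑ k ∈ Finset.range n, Φ k g := by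
  induction n with
  | zero => simpa using (h 0).const_mul le_rfl
  | succ n ih => simpa only [Finset.sum_range_succ] using ih.add (h n)

theorem IsCentralPD.of_tendsto {Φ : ℕ → G → ℂ} (h : ∀ n, IsCentralPD (Φ n))
    (hlim : ∀ g, Tendsto (fun n => Φ n g) atTop (𝓝 (φ g))) : IsCentralPD φ := by
  refine ⟨fun g g' => tendsto_nhds_unique (hlim _) ?_, fun x => ?_⟩
  · simpa only [(h _).central g g'] using hlim (g' * g)
  · exact ge_of_tendsto' (tendsto_tr_of_pointwise _ fun g _ => hlim g) fun n => (h n).nonneg x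

end Closure

/-! ### Mixtures of powers of the fixed point measure are characters -/

namespace Odometer

open Filter Topology
open scoped ComplexOrder

theorem fixMeasure_eq_one_iff (g : FullGroup) : fixMeasure g = 1 ↔ g = 1 := by
  obtain ⟨s, rfl⟩ := exists_mk_eq g
  rw [fixMeasure_mk, ← QuotientGroup.mk_one, mk_eq_iff_ae, Measure.real, ENNReal.toReal_eq_one_iff,
    prob_compl_eq_zero_iff (measurableSet_fixSet s) |>.symm]
  rfl

theorem fixMeasure_one : fixMeasure 1 = 1 := (fixMeasure_eq_one_iff 1).2 rfl

theorem fixMeasure_mul_comm (g h : FullGroup) : fixMeasure (g * h) = fixMeasure (h * g) := by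
  rw [← fixMeasure_conj g (h * g)]
  congr 1
  group

/-- The entry is the measure of the x with gᵢ⁻¹ x = gⱼ⁻¹ x, so the matrix is the integral over x of
Gram matrices of point masses. -/
theorem posSemidef_fixMeasure (n : ℕ) (g : Fin n → FullGroup) :
    (Matrix.of fun i j : Fin n => (fixMeasure (g i * (g j)⁻¹) : ℂ)).PosSemidef := by
  classical
  choose s hs using fun i => exists_mk_eq (g i)
  set f : X → Fin n → X := fun x i => ((s i)⁻¹ : borelFullGroup).1 x with hf
  set K : X → Matrix (Fin n) (Fin n) ℂ := fun x => (1 : Matrix X X ℂ).submatrix (f x) (f x) with hK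
  have hKpos : ∀ x, (K x).PosSemidef := fun x => Matrix.PosSemidef.one.submatrix (f x)
  have hset : ∀ i j, fixSet (s i * (s j)⁻¹) = {x | f x i = f x j} := by
    intro i j
    ext x
    change (s i : Equiv.Perm X) (((s j)⁻¹ : borelFullGroup).1 x) = x ↔ f x i = f x j
    constructor
    · intro h
      simp only [hf]
      conv_lhs => rw [← h]
      exact coe_inv_apply_self _ _
    · intro h
      change (s i : Equiv.Perm X) (f x j) = x
      rw [← h]
      exact coe_apply_inv_self _ _
  have hm : ∀ i j, MeasurableSet {x | f x i = f x j} := fun i j => by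
    rw [← hset]; exact measurableSet_fixSet _
  have hKi : ∀ i j, (fun x => K x i j) = {x | f x i = f x j}.indicator fun _ => (1 : ℂ) := by
    intro i j
    funext x
    simp [hK, Matrix.one_apply, Set.indicator_apply]
  have hint : ∀ i j, Integrable (fun x => K x i j) μ := fun i j => by
    rw [hKi]; exact (integrable_const _).indicator (hm i j)
  have hval : ∀ i j, (fixMeasure (g i * (g j)⁻¹) : ℂ) = ∫ x, K x i j ∂μ := by
    intro i j
    rw [hKi, integral_indicator_const _ (hm i j), ← hset, ← hs, ← hs, ← QuotientGroup.mk_inv,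
      ← QuotientGroup.mk_mul, fixMeasure_mk]
    simp
  refine Matrix.PosSemidef.of_dotProduct_mulVec_nonneg ?_ fun v => ?_
  · ext i j
    rw [Matrix.conjTranspose_apply, Matrix.of_apply, Matrix.of_apply, RCLike.star_def,
      Complex.conj_ofReal]
    congr 1
    rw [← hs i, ← hs j]
    change μ.real (fixSet (s j * (s i)⁻¹)) = μ.real (fixSet (s i * (s j)⁻¹))
    rw [hset, hset]
    simp only [eq_comm]
  · have e : star v ⬝ᵥ ((Matrix.of fun i j : Fin n => (fixMeasure (g i * (g j)⁻¹) : ℂ)).mulVec v) =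
        ∫ x, star v ⬝ᵥ ((K x).mulVec v) ∂μ := by
      simp only [dotProduct, Matrix.mulVec, Matrix.of_apply, hval]
      rw [integral_finsetSum _ fun i _ => ?_]
      · refine Finset.sum_congr rfl fun i _ => ?_
        rw [integral_const_mul, integral_finsetSum _ fun j _ => (hint i j).mul_const _]
        simp only [integral_mul_const]
      · exact (integrable_finsetSum _ fun j _ => (hint i j).mul_const _).const_mul _
    rw [e]
    exact integral_nonneg fun x => (hKpos x).dotProduct_mulVec_nonneg v

theorem isCentralPD_fixMeasure_pow (k : ℕ) :
    IsCentralPD fun g : FullGroup => ((fixMeasure g ^ k : ℝ) : ℂ) := by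
  refine ⟨fun g h => by simp only [fixMeasure_mul_comm g h], (posSemidef_iff_tr _).1 fun n g => ?_⟩
  induction k with
  | zero =>
    have : (Matrix.of fun i j : Fin n => ((fixMeasure (g i * (g j)⁻¹) ^ 0 : ℝ) : ℂ)) =
        (1 : Matrix Unit Unit ℂ).submatrix (fun _ => ()) fun _ => () := by
      ext i j; simp
    rw [this]
    exact Matrix.PosSemidef.one.submatrix _
  | succ k ih =>
    have := ih.hadamard (posSemidef_fixMeasure n g)
    have e : (Matrix.of fun i j : Fin n => ((fixMeasure (g i * (g j)⁻¹) ^ (k + 1) : ℝ) : ℂ)) =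
        (Matrix.of fun i j : Fin n => ((fixMeasure (g i * (g j)⁻¹) ^ k : ℝ) : ℂ)).hadamard
          (Matrix.of fun i j : Fin n => (fixMeasure (g i * (g j)⁻¹) : ℂ)) := by
      ext i j
      simp [pow_succ]
    rw [e]
    exact this

theorem isCentralPD_extPow_top :
    IsCentralPD fun g : FullGroup => (extPow (fixMeasure g) ⊤ : ℂ) := by
  classical
  refine ⟨fun g h => by simp only [fixMeasure_mul_comm g h], fun x => ?_⟩
  have e : (fun g : FullGroup => (extPow (fixMeasure g) ⊤ : ℂ)) =
      fun g => (1 : ℂ) * if g = 1 then 1 else 0 := by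
    funext g
    simp only [extPow, if_true, fixMeasure_eq_one_iff, one_mul]
    split_ifs <;> simp
  rw [e, tr_delta, one_mul]
  exact coeff_gstar_mul_self_one_nonneg x

/-- The mixture `∑ cₖ μ(Fix g)ᵏ + b μ(Fix g)^∞`. -/
noncomputable def mixture (c : ℕ → ℝ) (b : ℝ) (g : FullGroup) : ℂ :=
  ((∑' k, c k * fixMeasure g ^ k + b * extPow (fixMeasure g) ⊤ : ℝ) : ℂ)

theorem summable_mul_pow {c : ℕ → ℝ} (hc : ∀ k, 0 ≤ c k) (hs : Summable c) {t : ℝ} (h0 : 0 ≤ t)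
    (h1 : t ≤ 1) : Summable fun k => c k * t ^ k :=
  hs.of_nonneg_of_le (fun k => mul_nonneg (hc k) (pow_nonneg h0 k)) fun k =>
    mul_le_of_le_one_right (hc k) (pow_le_one₀ h0 h1)

theorem mixture_one (c : ℕ → ℝ) (b : ℝ) : mixture c b 1 = ((∑' k, c k + b : ℝ) : ℂ) := by
  simp [mixture, fixMeasure_one, extPow]

theorem isCentralPD_mixture {c : ℕ → ℝ} {b : ℝ} (hc : ∀ k, 0 ≤ c k) (hs : Summable c)
    (hb : 0 ≤ b) : IsCentralPD (mixture c b) := by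
  have h1 : IsCentralPD fun g => ((∑' k, c k * fixMeasure g ^ k : ℝ) : ℂ) := by
    refine IsCentralPD.of_tendsto
      (fun n => IsCentralPD.sum (fun k => (isCentralPD_fixMeasure_pow k).const_mul (hc k)) n)
      fun g => ?_
    have := (summable_mul_pow hc hs (fixMeasure_nonneg g) (fixMeasure_le_one g)).hasSum.tendsto_sum_nat
    refine ((Complex.continuous_ofReal.tendsto _).comp this).congr fun n => ?_
    simp
  have h2 := h1.add (isCentralPD_extPow_top.const_mul hb)
  convert h2 using 2 with g
  simp [mixture]

theorem isGroupCharacter_mixture {c : ℕ → ℝ} (hc : ∀ k, 0 ≤ c k) (hs : Summable c)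
    (h1 : ∑' k, c k ≤ 1) : IsGroupCharacter (mixture c (1 - ∑' k, c k)) :=
  (isCentralPD_mixture hc hs (sub_nonneg.2 h1)).isGroupCharacter (by simp [mixture_one])

end Odometer

/-! ### Every character is a mixture -/

namespace Odometer

open Filter Topology
open scoped ComplexOrder

theorem exists_involution_fixMeasure_eq {t : ℝ} (h0 : 0 ≤ t) (h1 : t ≤ 1) :
    ∃ s : FullGroup, s * s = 1 ∧ fixMeasure s = t := by
  obtain ⟨R, -, hR, hRt⟩ := exists_subset_measure_eq (A := Set.univ) MeasurableSet.univ
    (r := 1 - t) (by linarith) (by simp [h0])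
  obtain ⟨r, hr, -, hr'⟩ := exists_involution_of_set hR
  exact ⟨r, hr, by rw [hr', hRt]; ring⟩

/-- The first limit feeds the continuity of the character, the second that of the power series. -/
theorem exists_lift_seq (g : FullGroup) : ∃ l : ℕ → FullGroup,
    (∀ m, ∃ N, ∃ σ : Equiv.Perm (Fin N → Bool), l m = lift N σ) ∧
    Tendsto (fun m => fixMeasure (g⁻¹ * l m)) atTop (𝓝 1) ∧
    Tendsto (fun m => fixMeasure (l m)) atTop (𝓝 (fixMeasure g)) := by
  obtain ⟨s, rfl⟩ := exists_mk_eq g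
  have hpos : ∀ m : ℕ, (0 : ℝ) < 1 / (m + 1) := fun m => by positivity
  choose N σ h using fun m : ℕ => exists_lift_close s (hpos m)
  have h' : ∀ m, μ.real {x | (s : Equiv.Perm X) x ≠ (liftBorel (N m) (σ m) : Equiv.Perm X) x} ≤
      1 / (m + 1) := fun m => ENNReal.toReal_le_of_le_ofReal (hpos m).le (h m)
  have hlim := tendsto_one_div_add_atTop_nhds_zero_nat (𝕜 := ℝ)
  refine ⟨fun m => lift (N m) (σ m), fun m => ⟨_, _, rfl⟩, ?_, ?_⟩
  · have h1 : ∀ m : ℕ, 1 - 1 / ((m : ℝ) + 1) ≤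
        fixMeasure ((s : FullGroup)⁻¹ * lift (N m) (σ m)) := by
      intro m
      have e : (fixSet (s⁻¹ * liftBorel (N m) (σ m)))ᶜ ⊆
          {x | (s : Equiv.Perm X) x ≠ (liftBorel (N m) (σ m) : Equiv.Perm X) x} := by
        intro x hx hx'
        apply hx
        change ((s⁻¹ : borelFullGroup) : Equiv.Perm X) ((liftBorel (N m) (σ m)).1 x) = x
        rw [← hx']
        exact coe_inv_apply_self _ _
      have := (measureReal_mono (μ := μ) e).trans (h' m)
      rw [probReal_compl_eq_one_sub (measurableSet_fixSet _)] at this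
      change _ ≤ μ.real (fixSet (s⁻¹ * liftBorel (N m) (σ m)))
      linarith
    refine tendsto_of_tendsto_of_tendsto_of_le_of_le ?_ tendsto_const_nhds h1
      fun m => fixMeasure_le_one _
    simpa using hlim.const_sub 1
  · rw [tendsto_iff_dist_tendsto_zero]
    refine squeeze_zero (fun _ => dist_nonneg) (fun m => ?_) hlim
    have key : ∀ a b : borelFullGroup, fixMeasure (a : FullGroup) ≤ fixMeasure (b : FullGroup) +
        μ.real {x | (a : Equiv.Perm X) x ≠ (b : Equiv.Perm X) x} := by
      intro a b
      refine (measureReal_mono (μ := μ) (?_ : fixSet a ⊆ fixSet b ∪ _)).trans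
        (measureReal_union_le _ _)
      intro x hx
      by_cases hab : (a : Equiv.Perm X) x = (b : Equiv.Perm X) x
      · exact Or.inl (hab.symm.trans hx)
      · exact Or.inr hab
    have k1 := key s (liftBorel (N m) (σ m))
    have k2 := key (liftBorel (N m) (σ m)) s
    simp only [ne_comm] at k2
    have k3 := h' m
    rw [Real.dist_eq, abs_le]
    simp only [lift_eq_mk]
    constructor <;> linarith

/-- Every character of the full group is a mixture of powers of `μ(Fix g)`. -/
theorem exists_eq_mixture {χ : FullGroup → ℂ} (h : IsGroupCharacter χ) :
    ∃ c : ℕ → ℝ, (∀ k, 0 ≤ c k) ∧ Summable c ∧ ∑' k, c k ≤ 1 ∧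
      χ = mixture c (1 - ∑' k, c k) := by
  classical
  have hχ := h.isCentralPD
  obtain ⟨F, hF⟩ := exists_involution_value hχ
  obtain ⟨c, hc, hs, hc1, hFc⟩ := exists_power_series hχ h.map_one hF
  refine ⟨c, hc, hs, hc1, ?_⟩
  have hF1 : F 1 = 1 := by
    have := hF 1 (by simp)
    rw [h.map_one, fixMeasure_one] at this
    exact_mod_cast this.symm
  have hψ := isCentralPD_sub_delta hχ hF hF1 hc hs hFc
  set C := ∑' k, c k with hC
  set ψ : FullGroup → ℂ := fun g => χ g - ((1 - C : ℝ) : ℂ) * if g = 1 then 1 else 0 with hψdef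
  set P : ℝ → ℝ := fun t => ∑' k, c k * t ^ k with hP
  have hψ1 : ψ 1 = (C : ℂ) := by simp [hψdef, h.map_one]
  have hψne : ∀ g, g ≠ 1 → ψ g = χ g := fun g hg => by simp [hψdef, hg]
  have hP1 : P 1 = C := by simp [hP, hC]
  -- k = 0 is excluded: F(1) = 1 while P(1) = C.
  have hFP : ∀ n k : ℕ, 0 < k → k ≤ 2 ^ n → F (1 - k / (2 : ℝ) ^ n) = P (1 - k / (2 : ℝ) ^ n) := by
    intro n k hk hk'
    have e : (1 : ℝ) - k / (2 : ℝ) ^ n = ((2 ^ n - k : ℕ) : ℝ) / 2 ^ n := by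
      rw [Nat.cast_sub hk']; push_cast; field_simp
    rw [e, hFc n _ (by omega)]
  -- The value function of ψ on involutions; it differs from F only in that the jump at 1 is gone.
  obtain ⟨F', hF'⟩ := exists_involution_value hψ
  have hF'P : ∀ m : ℕ, F' (1 - 1 / (2 : ℝ) ^ m) = P (1 - 1 / (2 : ℝ) ^ m) := by
    intro m
    have hle : 1 / (2 : ℝ) ^ m ≤ 1 := by
      rw [div_le_one (by positivity)]; exact one_le_pow₀ (by norm_num)
    have hpos : 0 < 1 / (2 : ℝ) ^ m := by positivity
    obtain ⟨s, hs, hst⟩ := exists_involution_fixMeasure_eq (t := 1 - 1 / (2 : ℝ) ^ m)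
      (by linarith) (by linarith)
    have hs1 : s ≠ 1 := by
      rw [Ne, ← fixMeasure_eq_one_iff, hst]; linarith
    have h1 := hF' s hs
    rw [hψne s hs1, hF s hs, hst] at h1
    have h2 := hFP m 1 one_pos Nat.one_le_two_pow
    rw [Nat.cast_one] at h2
    rw [← h2]
    exact_mod_cast h1.symm
  have hPcont : ContinuousOn P (Set.Icc 0 1) := by
    refine continuousOn_tsum (u := c) (fun k => by fun_prop) hs fun k t ht => ?_
    rw [Real.norm_of_nonneg (mul_nonneg (hc k) (pow_nonneg ht.1 k))]
    exact mul_le_of_le_one_right (hc k) (pow_le_one₀ ht.1 ht.2)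
  have hlim : Tendsto (fun m : ℕ => F' (1 - 1 / (2 : ℝ) ^ m)) atTop (𝓝 (ψ 1).re) := by
    rw [hψ1, Complex.ofReal_re]
    simp only [hF'P]
    refine tendsto_power_series hc hs (Eventually.of_forall fun m => ?_)
      (Eventually.of_forall fun m => sub_le_self _ (by positivity)) ?_
    · rw [sub_nonneg, div_le_one (by positivity)]; exact one_le_pow₀ (by norm_num)
    · have := (tendsto_pow_atTop_nhds_zero_of_lt_one (r := (2 : ℝ)⁻¹) (by norm_num)
        (by norm_num)).const_sub 1
      simpa [inv_pow, div_eq_mul_inv] using this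
  have hcont := fun {ε : ℝ} (hε : 0 < ε) => continuity_of_involutions hψ
    (fun ε hε => involution_continuity hψ hF' hlim hε) hε
  have hψlift : ∀ N (σ : Equiv.Perm (Fin N → Bool)),
      ψ (lift N σ) = (P (fixMeasure (lift N σ)) : ℂ) := by
    intro N σ
    by_cases h1 : lift N σ = 1
    · rw [h1, hψ1, fixMeasure_one, hP1]
    · rw [hψne _ h1, value_lift hχ hF]
      rw [← fixMeasure_eq_one_iff] at h1
      rw [fixMeasure_lift] at h1 ⊢
      rw [hFP N _ (Nat.pos_of_ne_zero fun h0 => h1 (by rw [h0]; simp)) ?_]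
      simpa using Finset.card_filter_le (Finset.univ : Finset (Fin N → Bool)) fun w => σ w ≠ w
  have hψP : ∀ g, ψ g = (P (fixMeasure g) : ℂ) := by
    intro g
    obtain ⟨l, hl, hl1, hl2⟩ := exists_lift_seq g
    have t1 : Tendsto (fun m => ψ (l m)) atTop (𝓝 (P (fixMeasure g) : ℂ)) := by
      have e : ∀ m, ψ (l m) = (P (fixMeasure (l m)) : ℂ) := by
        intro m
        obtain ⟨N, σ, e⟩ := hl m
        rw [e, hψlift]
      simp only [e]
      refine (Complex.continuous_ofReal.tendsto _).comp ?_
      exact (hPcont _ ⟨fixMeasure_nonneg g, fixMeasure_le_one g⟩).tendsto.comp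
        (tendsto_nhdsWithin_iff.2 ⟨hl2, Eventually.of_forall fun m =>
          ⟨fixMeasure_nonneg _, fixMeasure_le_one _⟩⟩)
    have t2 : Tendsto (fun m => ψ (l m)) atTop (𝓝 (ψ g)) := by
      rw [Metric.tendsto_atTop']
      intro ε hε
      have hn := hψ.nm_nonneg 1
      obtain ⟨δ, hδ, hd⟩ := hcont (ε := ε / (nm ψ 1 + 1)) (by positivity)
      obtain ⟨M, hM⟩ := eventually_atTop.1 (hl1.eventually (lt_mem_nhds (sub_lt_self 1 hδ)))
      refine ⟨M, fun m hm => ?_⟩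
      have h1 := hd _ (show 1 - fixMeasure (g⁻¹ * l m) ≤ δ by linarith [hM m hm.le])
      rw [dist_comm, dist_eq_norm]
      calc _ ≤ _ := hψ.norm_sub_le g (l m)
        _ ≤ nm ψ 1 * (ε / (nm ψ 1 + 1)) := by gcongr
        _ < ε := by
          rw [mul_div_assoc', div_lt_iff₀ (by positivity)]
          nlinarith
    exact tendsto_nhds_unique t2 t1
  funext g
  have e := hψP g
  simp only [hψdef, sub_eq_iff_eq_add] at e
  rw [e, mixture, extPow, if_pos rfl]
  simp only [fixMeasure_eq_one_iff]
  split_ifs <;> simp [hP]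

end Odometer

/-! ### Extreme points -/

namespace Odometer

theorem mixture_single (n : ℕ) (g : FullGroup) :
    mixture (Pi.single n 1) 0 g = (extPow (fixMeasure g) n : ℂ) := by
  have h : ∑' k, (Pi.single n 1 : ℕ → ℝ) k * fixMeasure g ^ k = fixMeasure g ^ n := by
    rw [tsum_eq_single n fun k hk => by simp [hk]]
    simp
  rw [mixture, h, extPow, extPow]
  simp

theorem mixture_zero_one (g : FullGroup) :
    mixture 0 1 g = (extPow (fixMeasure g) ⊤ : ℂ) := by
  simp [mixture]

theorem isGroupCharacter_extPow (α : ℕ∞) :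
    IsGroupCharacter fun g : FullGroup => (extPow (fixMeasure g) α : ℂ) := by
  induction α with
  | top =>
    simp only [← mixture_zero_one]
    exact (isCentralPD_mixture (c := 0) (fun _ => le_rfl) summable_zero zero_le_one).isGroupCharacter
      (by simp [mixture_one])
  | coe n =>
    simp only [← mixture_single]
    exact (isCentralPD_mixture (fun k => by
      rcases eq_or_ne k n with rfl | h <;> simp [*]) (hasSum_pi_single n 1).summable
      le_rfl).isGroupCharacter (by simp [mixture_one, tsum_pi_single])

/-- A power series with nonnegative coefficients that equals `tⁿ` on `(0, 1)` is `tⁿ`. -/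
theorem coeff_eq_single_of_tsum_eq_pow {d : ℕ → ℝ} (hd : ∀ k, 0 ≤ d k) (hs : Summable d) (n : ℕ)
    (h : ∀ t : ℝ, 0 < t → t < 1 → ∑' k, d k * t ^ k = t ^ n) : d = Pi.single n 1 := by
  have hsum := fun {t : ℝ} (h0 : 0 < t) (h1 : t < 1) => summable_mul_pow hd hs h0.le h1.le
  -- For k < n, comparing d k tᵏ ≤ tⁿ gives d k ≤ t for every small t.
  have hlow : ∀ k < n, d k = 0 := by
    intro k hk
    refine le_antisymm (le_of_forall_pos_lt_add fun ε hε => ?_) (hd k)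
    set t := min (ε / 2) (1 / 2) with ht
    have t0 : 0 < t := by positivity
    have t1 : t < 1 := (min_le_right _ _).trans_lt (by norm_num)
    have h1 : d k * t ^ k ≤ t ^ n := by
      rw [← h t t0 t1]
      exact (hsum t0 t1).le_tsum k fun j _ => mul_nonneg (hd j) (pow_nonneg t0.le j)
    have h2 : t ^ n ≤ t * t ^ k := by
      rw [← pow_succ']
      exact pow_le_pow_of_le_one t0.le t1.le hk
    have h3 := le_of_mul_le_mul_right (h1.trans h2) (pow_pos t0 k)
    have h4 : t ≤ ε / 2 := min_le_left _ _
    linarith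
  -- The quotient of the series by tⁿ is 1 at both t = 1/2 and t = 1/4, yet every term with k > n
  -- increases strictly with t unless d k = 0.
  have hhigh : ∀ k, n < k → d k = 0 := by
    have a0 := hsum (t := 1 / 2) (by norm_num) (by norm_num)
    have b0 := hsum (t := 1 / 4) (by norm_num) (by norm_num)
    have e1 := h (1 / 2) (by norm_num) (by norm_num)
    have e2 := h (1 / 4) (by norm_num) (by norm_num)
    have key : HasSum (fun k => 2 ^ n * (d k * (1 / 2) ^ k) - 4 ^ n * (d k * (1 / 4) ^ k)) 0 := by
      have := (a0.hasSum.mul_left (2 ^ n)).sub (b0.hasSum.mul_left (4 ^ n))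
      rwa [e1, e2, ← mul_pow, ← mul_pow, show (2 : ℝ) * (1 / 2) = 1 by norm_num,
        show (4 : ℝ) * (1 / 4) = 1 by norm_num, sub_self] at this
    have hterm : ∀ k, n ≤ k → 2 ^ n * (d k * (1 / 2) ^ k) - 4 ^ n * (d k * (1 / 4) ^ k) =
        d k * ((1 / 2) ^ (k - n) - (1 / 4) ^ (k - n)) := by
      intro k hk
      obtain ⟨j, rfl⟩ := Nat.exists_eq_add_of_le hk
      rw [Nat.add_sub_cancel_left, pow_add, pow_add]
      have f1 : (2 : ℝ) ^ n * (1 / 2) ^ n = 1 := by rw [← mul_pow]; norm_num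
      have f2 : (4 : ℝ) ^ n * (1 / 4) ^ n = 1 := by rw [← mul_pow]; norm_num
      linear_combination d (n + j) * (1 / 2) ^ j * f1 - d (n + j) * (1 / 4) ^ j * f2
    have hnn : ∀ k, 0 ≤ 2 ^ n * (d k * (1 / 2) ^ k) - 4 ^ n * (d k * (1 / 4) ^ k) := by
      intro k
      rcases lt_or_ge k n with hk | hk
      · simp [hlow k hk]
      · rw [hterm k hk]
        refine mul_nonneg (hd k) (sub_nonneg.2 ?_)
        gcongr
        norm_num
    have hz := (hasSum_zero_iff_of_nonneg hnn).1 key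
    intro k hk
    have h1 := congrFun hz k
    rw [hterm k hk.le, Pi.zero_apply, mul_eq_zero] at h1
    refine h1.resolve_right (sub_pos.2 ?_).ne'
    exact pow_lt_pow_left₀ (by norm_num) (by norm_num) (by omega)
  have hn : d n = 1 := by
    have e1 := h (1 / 2) (by norm_num) (by norm_num)
    rw [tsum_eq_single n fun k hk => by
      rcases lt_or_gt_of_ne hk with hk | hk
      · simp [hlow k hk]
      · simp [hhigh k hk]] at e1
    exact mul_right_cancel₀ (b := (1 / 2 : ℝ) ^ n) (by positivity) (e1.trans (one_mul _).symm)
  funext k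
  rcases lt_trichotomy k n with hk | rfl | hk
  · simp [hlow k hk, hk.ne]
  · simp [hn]
  · simp [hhigh k hk, hk.ne']

/-- Both parts of a decomposition are mixtures by `exists_eq_mixture`. Comparing at elements with 0
< μ(Fix) < 1, where δ₁ vanishes, determines the convex combination of their coefficients, and
nonnegativity determines each. -/
theorem isIndecomposableCharacter_extPow (α : ℕ∞) :
    IsIndecomposableCharacter fun g : FullGroup => (extPow (fixMeasure g) α : ℂ) := by
  refine ⟨isGroupCharacter_extPow α, ?_⟩
  rintro ⟨a, χ₁, χ₂, ha0, ha1, h₁, h₂, hne, h⟩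
  obtain ⟨c₁, hc₁, hs₁, hl₁, rfl⟩ := exists_eq_mixture h₁
  obtain ⟨c₂, hc₂, hs₂, hl₂, rfl⟩ := exists_eq_mixture h₂
  suffices c₁ = c₂ from hne (by rw [this])
  set d : ℕ → ℝ := fun k => a * c₁ k + (1 - a) * c₂ k with hd
  have hd0 : ∀ k, 0 ≤ d k := fun k =>
    add_nonneg (mul_nonneg ha0.le (hc₁ k)) (mul_nonneg (sub_nonneg.2 ha1.le) (hc₂ k))
  have hds : Summable d := (hs₁.mul_left a).add (hs₂.mul_left (1 - a))
  have hval : ∀ t : ℝ, 0 < t → t < 1 → ∑' k, d k * t ^ k = extPow t α := by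
    intro t t0 t1
    obtain ⟨s, -, hs⟩ := exists_involution_fixMeasure_eq t0.le t1.le
    have e := h s
    simp only [mixture, hs, extPow, if_pos, if_neg t1.ne, mul_zero, add_zero] at e
    have e' : extPow t α = a * ∑' k, c₁ k * t ^ k + (1 - a) * ∑' k, c₂ k * t ^ k := by
      rw [extPow, if_neg t1.ne]
      exact_mod_cast e
    have s₁ := summable_mul_pow hc₁ hs₁ t0.le t1.le
    have s₂ := summable_mul_pow hc₂ hs₂ t0.le t1.le
    rw [e', ← tsum_mul_left, ← tsum_mul_left, ← (s₁.mul_left a).tsum_add (s₂.mul_left (1 - a))]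
    congr 1
    funext k
    simp only [hd]
    ring
  have hzero : ∀ k, d k = 0 → c₁ k = 0 ∧ c₂ k = 0 := by
    intro k hk
    have p₁ := mul_nonneg ha0.le (hc₁ k)
    have p₂ := mul_nonneg (sub_nonneg.2 ha1.le) (hc₂ k)
    simp only [hd] at hk
    exact ⟨(mul_eq_zero.1 (by linarith : a * c₁ k = 0)).resolve_left ha0.ne',
      (mul_eq_zero.1 (by linarith : (1 - a) * c₂ k = 0)).resolve_left (sub_pos.2 ha1).ne'⟩
  have hle₁ : ∀ k, c₁ k ≤ 1 := fun k => (hs₁.le_tsum k fun j _ => hc₁ j).trans hl₁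
  have hle₂ : ∀ k, c₂ k ≤ 1 := fun k => (hs₂.le_tsum k fun j _ => hc₂ j).trans hl₂
  induction α with
  | top =>
    have e := hval (1 / 2) (by norm_num) (by norm_num)
    have hsum := (summable_mul_pow hd0 hds (t := 1 / 2) (by norm_num) (by norm_num)).hasSum
    rw [e, extPow, if_pos rfl, if_neg (by norm_num)] at hsum
    have hz := (hasSum_zero_iff_of_nonneg fun k =>
      mul_nonneg (hd0 k) (by positivity : (0 : ℝ) ≤ (1 / 2) ^ k)).1 hsum
    funext k
    have h1 := congrFun hz k
    rw [Pi.zero_apply, mul_eq_zero] at h1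
    obtain ⟨e1, e2⟩ := hzero k (h1.resolve_right (by positivity))
    rw [e1, e2]
  | coe n =>
    have e := coeff_eq_single_of_tsum_eq_pow hd0 hds n fun t t0 t1 => by
      rw [hval t t0 t1, extPow]; simp
    funext k
    rcases eq_or_ne k n with rfl | hk
    · have e1 := congrFun e k
      rw [Pi.single_eq_same] at e1
      simp only [hd] at e1
      have l₁ := mul_le_mul_of_nonneg_left (hle₁ k) ha0.le
      -- Two numbers at most 1 with a proper convex combination equal to 1 are both 1.
      have l₂ := mul_le_mul_of_nonneg_left (hle₂ k) (sub_nonneg.2 ha1.le)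
      have f₁ : a * c₁ k = a * 1 := by linarith
      have f₂ : (1 - a) * c₂ k = (1 - a) * 1 := by linarith
      rw [mul_left_cancel₀ ha0.ne' f₁, mul_left_cancel₀ (sub_pos.2 ha1).ne' f₂]
    · obtain ⟨e1, e2⟩ := hzero k (by rw [e]; simp [hk])
      rw [e1, e2]

/-- If no cₖ is positive, only δ₁ remains. Otherwise one term splits off; the normalized rest is a
character unless cₖ = 1, and indecomposability makes it equal to that term. -/
theorem exists_extPow_of_isIndecomposableCharacter {χ : FullGroup → ℂ}
    (h : IsIndecomposableCharacter χ) :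
    ∃ α : ℕ∞, ∀ g, χ g = (extPow (fixMeasure g) α : ℂ) := by
  obtain ⟨hχ, hind⟩ := h
  obtain ⟨c, hc, hs, hl, rfl⟩ := exists_eq_mixture hχ
  by_cases hz : ∀ k, c k = 0
  · refine ⟨⊤, fun g => ?_⟩
    obtain rfl : c = 0 := funext hz
    rw [← mixture_zero_one]
    simp
  push Not at hz
  obtain ⟨k, hk⟩ := hz
  have hk0 : 0 < c k := (hc k).lt_of_ne' hk
  refine ⟨k, ?_⟩
  set d : ℕ → ℝ := fun j => if j = k then 0 else c j with hd
  have hd0 : ∀ j, 0 ≤ d j := fun j => by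
    simp only [hd]; split_ifs; exacts [le_rfl, hc j]
  have hds : Summable d := hs.of_nonneg_of_le hd0 fun j => by
    simp only [hd]; split_ifs; exacts [hc j, le_rfl]
  have hsplit : ∀ t : ℝ, 0 ≤ t → t ≤ 1 →
      ∑' j, c j * t ^ j = c k * t ^ k + ∑' j, d j * t ^ j := by
    intro t t0 t1
    rw [(summable_mul_pow hc hs t0 t1).tsum_eq_add_tsum_ite k]
    congr 2
    funext j
    simp only [hd]
    split_ifs <;> simp
  have hC : ∑' j, c j = c k + ∑' j, d j := by simpa using hsplit 1 zero_le_one le_rfl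
  have hD0 : 0 ≤ ∑' j, d j := tsum_nonneg hd0
  have hmix : ∀ g, mixture c (1 - ∑' j, c j) g =
      (c k : ℂ) * (extPow (fixMeasure g) k : ℂ) + mixture d (1 - ∑' j, c j) g := by
    intro g
    rw [mixture, mixture, hsplit _ (fixMeasure_nonneg g) (fixMeasure_le_one g),
      show extPow (fixMeasure g) k = fixMeasure g ^ k by simp [extPow]]
    push_cast
    ring
  rcases (show c k ≤ 1 by linarith).eq_or_lt with hk1 | hk1
  · have hD : ∑' j, d j = 0 := by linarith
    have hdz : d = 0 := (hasSum_zero_iff_of_nonneg hd0).1 (hD ▸ hds.hasSum)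
    intro g
    rw [hmix, hC, hD, hk1, hdz]
    simp [mixture]
  · have hpos : 0 < 1 - c k := sub_pos.2 hk1
    set c' : ℕ → ℝ := fun j => (1 - c k)⁻¹ * d j with hc'
    have hc'sum : ∑' j, c' j = (1 - c k)⁻¹ * ∑' j, d j := tsum_mul_left
    have hχ' : IsGroupCharacter (mixture c' (1 - ∑' j, c' j)) := by
      refine isGroupCharacter_mixture (fun j => mul_nonneg (inv_pos.2 hpos).le (hd0 j))
        (hds.mul_left _) ?_
      rw [hc'sum, inv_mul_le_iff₀ hpos]
      linarith
    have hdec : ∀ g, mixture d (1 - ∑' j, c j) g =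
        (1 - (c k : ℂ)) * mixture c' (1 - ∑' j, c' j) g := by
      intro g
      have e : ∑' j, c' j * fixMeasure g ^ j = (1 - c k)⁻¹ * ∑' j, d j * fixMeasure g ^ j := by
        rw [← tsum_mul_left]
        simp only [hc', mul_assoc]
      rw [mixture, mixture, e, hc'sum, hC, ← Complex.ofReal_one, ← Complex.ofReal_sub,
        ← Complex.ofReal_mul]
      congr 1
      field_simp
      ring
    have heq : (fun g : FullGroup => (extPow (fixMeasure g) k : ℂ)) =
        mixture c' (1 - ∑' j, c' j) := by
      by_contra hne
      exact hind ⟨c k, _, _, hk0, hk1, isGroupCharacter_extPow k, hχ', hne, fun g => by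
        rw [hmix, hdec]⟩
    intro g
    rw [hmix, hdec, ← heq]
    ring

end Odometer

theorem mainTheorem2 (χ : Odometer.FullGroup → ℂ) :
    IsIndecomposableCharacter χ ↔
      ∃ α : ℕ∞, ∀ f : Odometer.FullGroup,
        χ f = ((Odometer.extPow (Odometer.fixMeasure f) α : ℝ) : ℂ) := by
  refine ⟨Odometer.exists_extPow_of_isIndecomposableCharacter, ?_⟩
  rintro ⟨α, h⟩
  rw [funext h]
  exact Odometer.isIndecomposableCharacter_extPow α
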